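/- Setting. Let $k\ge 2$, $A=\{1,\dots,k\}$ (with the discrete topology), and let $M$ be a $k\times k$ matrix with entries in $\{0,1\}$ such that for some integer $p\ge 1$ all entries of $M^p$ are positive. Let $$\mathbb X=\{x\in A^{\mathbb Z}: M(x_n,x_{n+1})=1\ \ \forall n\in\mathbb Z\},\qquad \mathbb X^+=\{x\in A^{\mathbb N}: M(x_n,x_{n+1})=1\ \ \forall n\ge 0\},$$ with the topologies induced by the product topologies, and let $T$ denote the shift $(Tx)_n=x_{n+1}$ on either space. For $x\ne y$ put $\omega(x,y)=\min\{j\ge 0: x_j\ne y_j \text{ or } x_{-j}\neq y_{-j}\}$ on $\mathbb X$ and $\omega(x,y)=\min\{j\ge 0: x_j\ne y_j\}$ on $\mathbb X^+$. A real function $h$ on $\mathbb X$ (or $\mathbb X^+$) is called Hölder continuous if there are $C>0$ and $\alpha\in(0,1)$ with $|h(x)-h(y)|\le C\alpha^{\omega(x,y)}$ for all $x\ne y$. A function $f$ on $\mathbb X$ is a coboundary if $f=g\circ T-g$ on $\mathbb X$ for some Hölder continuous $g:\mathbb X\to\mathbb R$. Let $\psi:\mathbb X^+\to\mathbb R$ be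 Hölder continuous and normalized, i.e. $\mathcal L_\psi 1=1$, where $\mathcal L_\psi g(x)=\sum_{y\in\mathbb X^+:\,Ty=x}e^{-\psi(y)}g(y)$. Let $\nu$ be the Gibbs measure of $\psi$ on $\mathbb X$, i.e. the $T$-invariant Borel probability measure whose image $\nu^+$ under the natural projection $\mathbb X\to\mathbb X^+$ satisfies $\int\mathcal L_\psi g\,d\nu^+=\int g\,d\nu^+$ for every continuous $g:\mathbb X^+\to\mathbb R$. For $f:\mathbb X\to\mathbb R$ write $S_nf=\sum_{i=0}^{n-1}f\circ T^i$ and, for $t\in\mathbb R$, $\tau_t^f(x)=\inf\{j\ge 1: t+S_jf(x)<0\}\in\mathbb N\cup\{\infty\}$ (with $\inf\emptyset=\infty$). Theorem. Let $f:\mathbb X\to\mathbb R$ be Hölder continuous, with $\nu(f)=\int f\,d\nu=0$, and not a coboundary. Then there exists a unique non-decreasing and right-continuous function $V^f:\mathbb R\to\mathbb R_+=[0,\infty)$ such that, for every continuous compactly supported function $\varphi:\mathbb R\to\mathbb R$, $$\lim_{n\to\infty}\int_{\mathbb R}\varphi(t)\int_{\mathbb X}S_nf(x)\,\mathbf 1_{\{\tau_t^f(x)>n\}}\,\nu(dx)\,dt=\int_{\mathbb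 R}\varphi(t)V^f(t)\,dt .$$ Moreover, there exists a constant $c>0$ such that, for every $t\in\mathbb R$, $$\max\{t-c,0\}\le V^f(t)\le\max\{t,0\}+c .$$ -/

import Mathlib

open MeasureTheory Filter Topology

noncomputable section

namespace SFT

/-- The two-sided subshift of finite type with transition matrix `M` on the alphabet `Fin k`.
It carries the topology and the sigma-algebra induced by the product `ℤ → Fin k`, where `Fin k`
is discrete (the sigma-algebra is the Borel one). -/
abbrev TwoSided {k : ℕ} (M : Matrix (Fin k) (Fin k) ℕ) : Type :=
  {x : ℤ → Fin k // ∀ n : ℤ, M (x n) (x (n + 1)) = 1}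

/-- The one-sided subshift of finite type with transition matrix `M`. -/
abbrev OneSided {k : ℕ} (M : Matrix (Fin k) (Fin k) ℕ) : Type :=
  {x : ℕ → Fin k // ∀ n : ℕ, M (x n) (x (n + 1)) = 1}

variable {k : ℕ} {M : Matrix (Fin k) (Fin k) ℕ}

/-- `M` is a transition matrix (entries `0` or `1`) which is irreducible in the strong sense that
some power `M ^ p`, `p ≥ 1`, has only positive entries. -/
def IsIrreducibleTransition (M : Matrix (Fin k) (Fin k) ℕ) : Prop :=
  (∀ i j, M i j = 0 ∨ M i j = 1) ∧ ∃ p : ℕ, 1 ≤ p ∧ ∀ i j, 0 < (M ^ p) i j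

/-- The two-sided shift `(T x)_n = x_{n+1}`. -/
def shift (x : TwoSided M) : TwoSided M :=
  ⟨fun n => x.1 (n + 1), fun n => x.2 (n + 1)⟩

/-- The one-sided shift. -/
def shiftPlus (x : OneSided M) : OneSided M :=
  ⟨fun n => x.1 (n + 1), fun n => x.2 (n + 1)⟩

/-- The natural projection that keeps the coordinates of index `n ≥ 0`. -/
def proj (x : TwoSided M) : OneSided M :=
  ⟨fun n => x.1 (n : ℤ), fun n => by
    have h := x.2 (n : ℤ)
    rwa [← Nat.cast_succ] at h⟩

/-- `ω(x, y)`, the least `k ≥ 0` with `x_k ≠ y_k` or `x_{-k} ≠ y_{-k}`; used only for `x ≠ y`. -/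
def omega (x y : TwoSided M) : ℕ :=
  sInf {n : ℕ | x.1 (n : ℤ) ≠ y.1 (n : ℤ) ∨ x.1 (-(n : ℤ)) ≠ y.1 (-(n : ℤ))}

/-- The one-sided separation index; used only for `x ≠ y`. -/
def omegaPlus (x y : OneSided M) : ℕ :=
  sInf {n : ℕ | x.1 n ≠ y.1 n}

/-- Hölder continuity on the two-sided subshift: `|f x - f y| ≤ C α ^ ω(x, y)` for some `C > 0` and
`α ∈ (0, 1)`. For `x = y`, where `ω = ∞`, the condition is void. -/
def IsHolder (f : TwoSided M → ℝ) : Prop :=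
  ∃ C α : ℝ, 0 < C ∧ 0 < α ∧ α < 1 ∧ ∀ x y, x ≠ y → |f x - f y| ≤ C * α ^ omega x y

/-- Hölder continuity on the one-sided subshift. -/
def IsHolderPlus (ψ : OneSided M → ℝ) : Prop :=
  ∃ C α : ℝ, 0 < C ∧ 0 < α ∧ α < 1 ∧ ∀ x y, x ≠ y → |ψ x - ψ y| ≤ C * α ^ omegaPlus x y

/-- `f` is a coboundary: `f = g ∘ T - g` for a Hölder continuous `g`. -/
def IsCoboundary (f : TwoSided M → ℝ) : Prop :=
  ∃ g : TwoSided M → ℝ, IsHolder g ∧ ∀ x, f x = g (shift x) - g x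

/-- The Ruelle operator `L_ψ g (x) = ∑_{y : T y = x} e^{-ψ y} g y` (each `x` has finitely many
preimages under the one-sided shift, at most one for each letter). -/
def ruelle (ψ g : OneSided M → ℝ) (x : OneSided M) : ℝ :=
  ∑ᶠ (y : OneSided M) (_ : shiftPlus y = x), Real.exp (-ψ y) * g y

/-- The potential `ψ` is normalized: `L_ψ 1 = 1`. -/
def IsNormalized (ψ : OneSided M → ℝ) : Prop :=
  ∀ x, ruelle ψ (fun _ => 1) x = 1

/-- `ν` is the Gibbs measure on the two-sided subshift of the (normalized) potential `ψ`: the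
shift-invariant Borel probability measure whose image on the one-sided subshift is the
`L_ψ`-invariant probability measure. -/
structure IsGibbsMeasure (ψ : OneSided M → ℝ) (ν : Measure (TwoSided M)) : Prop where
  isProbabilityMeasure : IsProbabilityMeasure ν
  invariant : MeasurePreserving (shift (M := M)) ν ν
  ruelle_invariant : ∀ g : C(OneSided M, ℝ),
    ∫ z, ruelle ψ g z ∂(ν.map proj) = ∫ z, g z ∂(ν.map proj)

/-- The Birkhoff sum `S_n f = f + f ∘ T + ⋯ + f ∘ T^{n-1}`. -/
def S (n : ℕ) (f : TwoSided M → ℝ) (x : TwoSided M) : ℝ :=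
  birkhoffSum shift f n x

/-- The exit time `τ_t^f(x) = inf {k ≥ 1 : t + S_k f(x) < 0}`, with `inf ∅ = ∞`. -/
def exitTime (f : TwoSided M → ℝ) (t : ℝ) (x : TwoSided M) : ℕ∞ :=
  ⨅ (j : ℕ) (_ : 1 ≤ j ∧ t + S j f x < 0), (j : ℕ∞)

/-- `∫ S_n f 1_{τ_t^f > n} dν`. -/
def killedMean (ν : Measure (TwoSided M)) (f : TwoSided M → ℝ) (n : ℕ) (t : ℝ) : ℝ :=
  ∫ x, Set.indicator {x | (n : ℕ∞) < exitTime f t x} (S n f) x ∂ν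

/-- `V : ℝ → ℝ₊` is non-decreasing, right-continuous and is the weak limit, against continuous
compactly supported functions of `t`, of `∫ S_n f 1_{τ_t^f > n} dν`. -/
structure IsHarmonicFunction (ν : Measure (TwoSided M)) (f : TwoSided M → ℝ) (V : ℝ → ℝ) :
    Prop where
  nonneg : ∀ t, 0 ≤ V t
  monotone : Monotone V
  rightContinuous : ∀ t, ContinuousWithinAt V (Set.Ici t) t
  tendsto : ∀ φ : ℝ → ℝ, Continuous φ → HasCompactSupport φ →
    Tendsto (fun n : ℕ => ∫ t, φ t * killedMean ν f n t) atTop (𝓝 (∫ t, φ t * V t))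

end SFT

end

/-!
The starting point `t` of the walk `t + S_n f` is averaged over an interval `[s, t)`. For a fixed
trajectory, the set of the `r ∈ [s, t)` from which the walk survives up to time `n` is the interval
`[level_n, t)`, where `level_n` is the maximum of `-S_1 f, …, -S_n f` truncated to `[s, t]`. Hence
the mean over `r` of `E[S_n f; τ_r > n]` is `E[S_n f (t - level_n)]` (`integral_killedMean`), and
`t - level_n` is, unlike the indicator function of the event `τ_r > n`, a Lipschitz function of the
walk. Summation by parts (`averagedMean_succ`) writes this mean as the sum over `j < n` of
`-E[S_{j+1} f (level_{j+1} - level_j)]`, which is absolutely summable since `S_{j+1} f` is bounded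
where the level moves, and of the correlations `-E[f ∘ T^j (level_{l+1} - level_l)]`, `l < j`.

The correlations are bounded by `C β^{j-l} b_l`, where `b_l` is essentially the probability that at
time `l` the walk is in a window of bounded width at the bottom of its range
(`exists_drop_decorrelation`). This rests on two facts about the Gibbs measure.
* Decay of correlations relatively to the past (`exists_mixing`, `exists_decorrelation`): if `u ≥ 0`
  depends on the coordinates of index `≤ l`, then `|E[u f ∘ T^{l+n}]| ≤ C β^n E[u]`. The transfer
  operator sends `u` into a cone of functions with bounded distortion, on which it is a contraction
  relatively to the mean (`exists_cone_contraction`).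
* Summability of the `b_l`, with a bound that depends on the width of the window only
  (`exists_sum_integral_visit_le`): at each visit, and whatever the past, the walk has a probability
  bounded below to fall under the window within a bounded time, after which that window is no
  longer at the bottom of its range. This uses that `f` has arbitrarily negative Birkhoff sums, which holds
  because `f` is not a coboundary: a Hölder sub-action exists as soon as the Birkhoff sums are
  bounded from below (`isCoboundary_of_le_S`), and it solves the coboundary equation because `f` is
  centred and the measure has full support.

So the averaged means converge, and the explicit sums give bounds that are uniform in `n` and linear
in the position of the interval (`exists_averagedMean_estimates`); together they force the walk to
be killed almost surely (`tendsto_integral_sub_level`). Finally `E[t + S_n f; τ_t > n]` is monotone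
in `t`, and differs from `E[S_n f; τ_t > n]` by a quantity that tends to `0`. Monotone functions whose
averages converge have a monotone right-continuous limit almost everywhere
(`exists_ae_tendsto_of_tendsto_setIntegral`), which is `V`.
-/

noncomputable section

namespace SFT

variable {k : ℕ} {M : Matrix (Fin k) (Fin k) ℕ}

/-! ### Shifts, Birkhoff sums and Hölder functions -/

/-- The shift by `m` places, `(T^m x)_n = x_{n+m}`, for an integer `m` of any sign. -/
def shiftBy (m : ℤ) (x : TwoSided M) : TwoSided M :=
  ⟨fun n => x.1 (n + m), fun n => by
    have h := x.2 (n + m)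
    rwa [show n + m + 1 = n + 1 + m by ring] at h⟩

@[simp] lemma shiftBy_apply (m : ℤ) (x : TwoSided M) (n : ℤ) :
    (shiftBy m x).1 n = x.1 (n + m) := rfl

lemma shift_eq_shiftBy (x : TwoSided M) : shift x = shiftBy 1 x := rfl

lemma shiftBy_shiftBy (m n : ℤ) (x : TwoSided M) :
    shiftBy m (shiftBy n x) = shiftBy (m + n) x :=
  Subtype.ext <| funext fun i => by simp [add_assoc]

@[simp] lemma shiftBy_zero (x : TwoSided M) : shiftBy 0 x = x :=
  Subtype.ext <| funext fun i => by simp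

lemma shift_iterate (n : ℕ) (x : TwoSided M) : shift^[n] x = shiftBy n x := by
  induction n with
  | zero => simp
  | succ n ih =>
    rw [Function.iterate_succ_apply', ih, shift_eq_shiftBy, shiftBy_shiftBy]
    congr 1
    push_cast
    ring

lemma shiftPlus_iterate_apply (n : ℕ) (z : OneSided M) (i : ℕ) :
    (shiftPlus^[n] z).1 i = z.1 (i + n) := by
  induction n generalizing i with
  | zero => simp
  | succ n ih =>
    rw [Function.iterate_succ_apply']
    change (shiftPlus^[n] z).1 (i + 1) = _
    rw [ih, show i + 1 + n = i + (n + 1) by ring]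

lemma proj_shiftBy (n : ℕ) (x : TwoSided M) : proj (shiftBy n x) = shiftPlus^[n] (proj x) :=
  Subtype.ext <| funext fun i => by
    rw [shiftPlus_iterate_apply]
    simp [proj]

lemma S_eq_sum (n : ℕ) (f : TwoSided M → ℝ) (x : TwoSided M) :
    S n f x = ∑ i ∈ Finset.range n, f (shiftBy i x) := by
  simp [S, birkhoffSum, shift_iterate]

@[simp] lemma S_zero (f : TwoSided M → ℝ) (x : TwoSided M) : S 0 f x = 0 := by simp [S_eq_sum]

lemma S_succ (n : ℕ) (f : TwoSided M → ℝ) (x : TwoSided M) :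
    S (n + 1) f x = S n f x + f (shiftBy n x) := by
  simp [S_eq_sum, Finset.sum_range_succ]

lemma S_add (m n : ℕ) (f : TwoSided M → ℝ) (x : TwoSided M) :
    S (m + n) f x = S m f x + S n f (shiftBy m x) := by
  simp only [S_eq_sum, Finset.sum_range_add, shiftBy_shiftBy]
  congr 1
  refine Finset.sum_congr rfl fun i _ => ?_
  rw [add_comm (i : ℤ)]
  simp

lemma continuous_coord (i : ℤ) : Continuous fun x : TwoSided M => x.1 i :=
  (continuous_apply i).comp continuous_subtype_val

lemma continuous_coordPlus (i : ℕ) : Continuous fun x : OneSided M => x.1 i :=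
  (continuous_apply i).comp continuous_subtype_val

lemma continuous_shiftBy (m : ℤ) : Continuous (shiftBy (M := M) m) :=
  Continuous.subtype_mk (continuous_pi fun n => continuous_coord (n + m)) _

lemma continuous_shiftPlus : Continuous (shiftPlus (M := M)) :=
  Continuous.subtype_mk (continuous_pi fun n => continuous_coordPlus (n + 1)) _

lemma continuous_proj : Continuous (proj (M := M)) :=
  Continuous.subtype_mk (f := fun (x : TwoSided M) (n : ℕ) => x.1 (n : ℤ))
    (continuous_pi fun n => continuous_coord (n : ℤ)) _

lemma continuous_S (n : ℕ) {f : TwoSided M → ℝ} (hf : Continuous f) : Continuous (S n f) := by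
  have : S n f = fun x => ∑ i ∈ Finset.range n, f (shiftBy i x) := funext fun x => S_eq_sum n f x
  rw [this]
  exact continuous_finsetSum _ fun i _ => hf.comp (continuous_shiftBy _)

/-- Hölder continuity expressed through cylinders: two points that agree at all places `i` with
`|i| < n` have images at distance at most `C α ^ n`. -/
def HasModulus (C α : ℝ) (f : TwoSided M → ℝ) : Prop :=
  ∀ (n : ℕ) (x y : TwoSided M), (∀ i : ℤ, |i| < n → x.1 i = y.1 i) → |f x - f y| ≤ C * α ^ n

/-- The one-sided counterpart of `HasModulus`. -/
def HasModulusPlus (C α : ℝ) (ψ : OneSided M → ℝ) : Prop :=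
  ∀ (n : ℕ) (x y : OneSided M), (∀ i : ℕ, i < n → x.1 i = y.1 i) → |ψ x - ψ y| ≤ C * α ^ n

lemma le_omega {x y : TwoSided M} (hxy : x ≠ y) {n : ℕ}
    (h : ∀ i : ℤ, |i| < n → x.1 i = y.1 i) : n ≤ omega x y := by
  have hne : {m : ℕ | x.1 (m : ℤ) ≠ y.1 (m : ℤ) ∨ x.1 (-(m : ℤ)) ≠ y.1 (-(m : ℤ))}.Nonempty := by
    by_contra hcon
    rw [Set.not_nonempty_iff_eq_empty, Set.eq_empty_iff_forall_notMem] at hcon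
    refine hxy (Subtype.ext <| funext fun i => ?_)
    have hi := hcon i.natAbs
    simp only [Set.mem_ofPred_eq, not_or, not_not] at hi
    rcases Int.natAbs_eq i with h' | h' <;> rw [h'] <;> tauto
  refine le_csInf hne fun m hm => ?_
  by_contra hlt
  push Not at hlt
  have h1 := h m (by rw [abs_of_nonneg (by positivity)]; exact_mod_cast hlt)
  have h2 := h (-m) (by rw [abs_neg, abs_of_nonneg (by positivity)]; exact_mod_cast hlt)
  rcases hm with hm | hm
  · exact hm h1
  · exact hm h2

lemma le_omegaPlus {x y : OneSided M} (hxy : x ≠ y) {n : ℕ}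
    (h : ∀ i : ℕ, i < n → x.1 i = y.1 i) : n ≤ omegaPlus x y := by
  have hne : {m : ℕ | x.1 m ≠ y.1 m}.Nonempty := by
    by_contra hcon
    rw [Set.not_nonempty_iff_eq_empty, Set.eq_empty_iff_forall_notMem] at hcon
    exact hxy (Subtype.ext <| funext fun i => by simpa using hcon i)
  refine le_csInf hne fun m hm => ?_
  by_contra hlt
  exact hm (h m (not_le.mp hlt))

lemma eq_of_abs_lt_omega {x y : TwoSided M} {i : ℤ} (hi : |i| < omega x y) : x.1 i = y.1 i := by
  have h : i.natAbs < omega x y := by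
    have : (i.natAbs : ℤ) < omega x y := by rwa [Int.natCast_natAbs]
    exact_mod_cast this
  have h' := Nat.notMem_of_lt_sInf h
  simp only [Set.mem_ofPred_eq, not_or, not_not] at h'
  rcases Int.natAbs_eq i with h'' | h'' <;> rw [h''] <;> tauto

lemma IsHolder.exists_modulus {f : TwoSided M → ℝ} (hf : IsHolder f) :
    ∃ C α : ℝ, 0 < C ∧ 0 < α ∧ α < 1 ∧ HasModulus C α f := by
  obtain ⟨C, α, hC, hα, hα1, h⟩ := hf
  refine ⟨C, α, hC, hα, hα1, fun n x y hxy => ?_⟩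
  by_cases hne : x = y
  · subst hne
    simp only [sub_self, abs_zero]
    positivity
  · refine (h x y hne).trans ?_
    exact mul_le_mul_of_nonneg_left (pow_le_pow_of_le_one hα.le hα1.le (le_omega hne hxy)) hC.le

lemma IsHolderPlus.exists_modulus {ψ : OneSided M → ℝ} (hψ : IsHolderPlus ψ) :
    ∃ C α : ℝ, 0 < C ∧ 0 < α ∧ α < 1 ∧ HasModulusPlus C α ψ := by
  obtain ⟨C, α, hC, hα, hα1, h⟩ := hψ
  refine ⟨C, α, hC, hα, hα1, fun n x y hxy => ?_⟩
  by_cases hne : x = y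
  · subst hne
    simp only [sub_self, abs_zero]
    positivity
  · refine (h x y hne).trans ?_
    exact mul_le_mul_of_nonneg_left (pow_le_pow_of_le_one hα.le hα1.le (le_omegaPlus hne hxy)) hC.le

lemma HasModulus.isHolder {C α : ℝ} (hC : 0 < C) (hα : 0 < α) (hα1 : α < 1) {f : TwoSided M → ℝ}
    (hf : HasModulus C α f) : IsHolder f :=
  ⟨C, α, hC, hα, hα1, fun x y _ => hf _ x y fun _ hi => eq_of_abs_lt_omega hi⟩

lemma HasModulus.mono {C α β : ℝ} (hC : 0 ≤ C) (hα : 0 ≤ α) (hαβ : α ≤ β) {f : TwoSided M → ℝ}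
    (hf : HasModulus C α f) : HasModulus C β f := fun n x y h =>
  (hf n x y h).trans (mul_le_mul_of_nonneg_left (pow_le_pow_left₀ hα hαβ n) hC)

lemma eventually_agree (x : TwoSided M) (n : ℕ) :
    ∀ᶠ y in 𝓝 x, ∀ i : ℤ, |i| < n → x.1 i = y.1 i := by
  have h : ∀ᶠ y in 𝓝 x, ∀ i ∈ Finset.Icc (-(n : ℤ)) n, x.1 i = y.1 i := by
    rw [Filter.eventually_all_finset]
    intro i _
    have := (continuous_coord (M := M) i).continuousAt (x := x)
    have h2 := this.eventually (IsOpen.mem_nhds (isOpen_discrete {x.1 i}) rfl)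
    filter_upwards [h2] with y hy
    exact hy.symm
  filter_upwards [h] with y hy i hi
  exact hy i (by rw [Finset.mem_Icc]; rw [abs_lt] at hi; omega)

lemma eventually_agreePlus (x : OneSided M) (n : ℕ) :
    ∀ᶠ y in 𝓝 x, ∀ i : ℕ, i < n → x.1 i = y.1 i := by
  have h : ∀ᶠ y in 𝓝 x, ∀ i ∈ Finset.range n, x.1 i = y.1 i := by
    rw [Filter.eventually_all_finset]
    intro i _
    have := (continuous_coordPlus (M := M) i).continuousAt (x := x)
    have h2 := this.eventually (IsOpen.mem_nhds (isOpen_discrete {x.1 i}) rfl)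
    filter_upwards [h2] with y hy
    exact hy.symm
  filter_upwards [h] with y hy i hi
  exact hy i (Finset.mem_range.mpr hi)

lemma HasModulus.continuous {C α : ℝ} (hα : 0 ≤ α) (hα1 : α < 1) {f : TwoSided M → ℝ}
    (hf : HasModulus C α f) : Continuous f := by
  rw [continuous_iff_continuousAt]
  intro x
  rw [ContinuousAt, Metric.tendsto_nhds]
  intro ε hε
  have h0 : Tendsto (fun n : ℕ => C * α ^ n) atTop (𝓝 0) := by
    simpa using (tendsto_pow_atTop_nhds_zero_of_lt_one hα hα1).const_mul C
  obtain ⟨n, hn⟩ := (h0.eventually (gt_mem_nhds hε)).exists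
  filter_upwards [eventually_agree x n] with y hy
  rw [dist_comm, Real.dist_eq]
  exact (hf n x y hy).trans_lt hn

lemma HasModulus.exists_bound {C α : ℝ} (hC : 0 ≤ C) {f : TwoSided M → ℝ}
    (hf : HasModulus C α f) : ∃ B, 0 < B ∧ ∀ x, |f x| ≤ B := by
  rcases isEmpty_or_nonempty (TwoSided M) with h | ⟨⟨x₀⟩⟩
  · exact ⟨1, one_pos, fun x => (h.false x).elim⟩
  · refine ⟨|f x₀| + C + 1, by positivity, fun x => ?_⟩
    have h1 := hf 0 x x₀ fun i hi => absurd hi (by simp)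
    have h2 := abs_sub_abs_le_abs_sub (f x) (f x₀)
    simp only [pow_zero, mul_one] at h1
    linarith

lemma HasModulusPlus.exists_bound {C α : ℝ} (hC : 0 ≤ C) {f : OneSided M → ℝ}
    (hf : HasModulusPlus C α f) : ∃ B, 0 < B ∧ ∀ x, |f x| ≤ B := by
  rcases isEmpty_or_nonempty (OneSided M) with h | ⟨⟨x₀⟩⟩
  · exact ⟨1, one_pos, fun x => (h.false x).elim⟩
  · refine ⟨|f x₀| + C + 1, by positivity, fun x => ?_⟩
    have h1 := hf 0 x x₀ fun i hi => absurd hi (by simp)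
    have h2 := abs_sub_abs_le_abs_sub (f x) (f x₀)
    simp only [pow_zero, mul_one] at h1
    linarith

lemma IsIrreducibleTransition.exists_succ (hM : IsIrreducibleTransition M) (a : Fin k) :
    ∃ b, M a b = 1 := by
  obtain ⟨h01, p, hp, hpos⟩ := hM
  obtain ⟨q, rfl⟩ : ∃ q, p = q + 1 := ⟨p - 1, by omega⟩
  have h := hpos a a
  rw [pow_succ', Matrix.mul_apply] at h
  obtain ⟨b, -, hb⟩ := Finset.exists_ne_zero_of_sum_ne_zero h.ne'
  exact ⟨b, (h01 a b).resolve_left (left_ne_zero_of_mul hb)⟩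

lemma IsIrreducibleTransition.exists_pred (hM : IsIrreducibleTransition M) (a : Fin k) :
    ∃ b, M b a = 1 := by
  obtain ⟨h01, p, hp, hpos⟩ := hM
  obtain ⟨q, rfl⟩ : ∃ q, p = q + 1 := ⟨p - 1, by omega⟩
  have h := hpos a a
  rw [pow_succ, Matrix.mul_apply] at h
  obtain ⟨b, -, hb⟩ := Finset.exists_ne_zero_of_sum_ne_zero h.ne'
  exact ⟨b, (h01 b a).resolve_left (right_ne_zero_of_mul hb)⟩

/-- A chosen letter that may follow `a`. -/
def succLetter (hM : IsIrreducibleTransition M) (a : Fin k) : Fin k := (hM.exists_succ a).choose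

/-- A chosen letter that may precede `a`. -/
def predLetter (hM : IsIrreducibleTransition M) (a : Fin k) : Fin k := (hM.exists_pred a).choose

lemma succLetter_spec (hM : IsIrreducibleTransition M) (a : Fin k) : M a (succLetter hM a) = 1 :=
  (hM.exists_succ a).choose_spec

lemma predLetter_spec (hM : IsIrreducibleTransition M) (a : Fin k) : M (predLetter hM a) a = 1 :=
  (hM.exists_pred a).choose_spec

lemma admissible_congr {a b a' b' : Fin k} (ha : a = a') (hb : b = b') (h : M a' b' = 1) :
    M a b = 1 := by
  rw [ha, hb, h]

/-- The sequence `x` with its coordinates of index `> l` replaced by a continuation that depends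
on `x_l` only. A function that is invariant under `trunc hM l` depends on the coordinates of index
`≤ l` only. -/
def trunc (hM : IsIrreducibleTransition M) (l : ℤ) (x : TwoSided M) : TwoSided M :=
  ⟨fun i => if i ≤ l then x.1 i else (succLetter hM)^[(i - l).toNat] (x.1 l), fun i => by
    rcases lt_trichotomy i l with h | h | h
    · exact admissible_congr (if_pos h.le) (if_pos (by omega)) (x.2 i)
    · subst h
      refine admissible_congr (if_pos le_rfl) (if_neg (by omega)) ?_
      rw [show (i + 1 - i).toNat = 1 by simp]
      exact succLetter_spec hM _
    · refine admissible_congr (if_neg (by omega)) (if_neg (by omega)) ?_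
      rw [show (i + 1 - l).toNat = (i - l).toNat + 1 by omega, Function.iterate_succ_apply']
      exact succLetter_spec hM _⟩

/-- The two-sided sequence that extends `z` by a past that depends on `z_0` only. -/
def ext (hM : IsIrreducibleTransition M) (z : OneSided M) : TwoSided M :=
  ⟨fun i => if 0 ≤ i then z.1 i.toNat else (predLetter hM)^[(-i).toNat] (z.1 0), fun i => by
    rcases lt_trichotomy i (-1) with h | h | h
    · refine admissible_congr (if_neg (by omega)) (if_neg (by omega)) ?_
      rw [show (-i).toNat = (-(i + 1)).toNat + 1 by omega, Function.iterate_succ_apply']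
      exact predLetter_spec hM _
    · subst h
      exact predLetter_spec hM _
    · refine admissible_congr (if_pos (by omega)) (if_pos (by omega)) ?_
      rw [show (i + 1).toNat = i.toNat + 1 by omega]
      exact z.2 _⟩

lemma trunc_apply_of_le (hM : IsIrreducibleTransition M) {l i : ℤ} (h : i ≤ l) (x : TwoSided M) :
    (trunc hM l x).1 i = x.1 i := if_pos h

lemma trunc_congr (hM : IsIrreducibleTransition M) {l : ℤ} {x y : TwoSided M}
    (h : ∀ i ≤ l, x.1 i = y.1 i) : trunc hM l x = trunc hM l y := by
  refine Subtype.ext <| funext fun i => ?_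
  simp only [trunc]
  split_ifs with hi
  · exact h i hi
  · rw [h l le_rfl]

lemma ext_apply_of_nonneg (hM : IsIrreducibleTransition M) {i : ℤ} (h : 0 ≤ i) (z : OneSided M) :
    (ext hM z).1 i = z.1 i.toNat := if_pos h

lemma continuous_trunc (hM : IsIrreducibleTransition M) (l : ℤ) : Continuous (trunc hM l) := by
  refine Continuous.subtype_mk (continuous_pi fun i => ?_) _
  by_cases h : i ≤ l
  · simpa only [if_pos h] using continuous_coord i
  · simp only [if_neg h]
    exact (continuous_of_discreteTopology (f := (succLetter hM)^[(i - l).toNat])).comp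
      (continuous_coord l)

lemma continuous_ext (hM : IsIrreducibleTransition M) : Continuous (ext hM) := by
  refine Continuous.subtype_mk (continuous_pi fun i => ?_) _
  by_cases h : 0 ≤ i
  · simpa only [if_pos h] using continuous_coordPlus i.toNat
  · simp only [if_neg h]
    exact (continuous_of_discreteTopology (f := (predLetter hM)^[(-i).toNat])).comp
      (continuous_coordPlus 0)

@[simp] lemma proj_ext (hM : IsIrreducibleTransition M) (z : OneSided M) : proj (ext hM z) = z :=
  Subtype.ext <| funext fun i => by simp [proj, ext]

/-- A power of an integer part is bounded by a geometric sequence; the ratio can be chosen with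
`β ≤ γ ^ p`. -/
lemma exists_pow_div_le {β : ℝ} (hβ : 0 < β) (hβ1 : β < 1) {p : ℕ} (hp : 1 ≤ p) :
    ∃ C γ : ℝ, 0 < C ∧ β ≤ γ ∧ γ < 1 ∧ β ≤ γ ^ p ∧ ∀ n : ℕ, β ^ (n / p) ≤ C * γ ^ n := by
  have hp' : (1 : ℝ) ≤ p := by exact_mod_cast hp
  have hp0 : (0 : ℝ) < p := by linarith
  set γ : ℝ := 1 - (1 - β) / p with hγ
  have h1 : (1 - β) / p ≤ 1 - β := div_le_self (by linarith) hp'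
  have h2 : 0 < (1 - β) / p := div_pos (by linarith) hp0
  have hγ0 : 0 < γ := by linarith
  have hγ1 : γ < 1 := by linarith
  -- Bernoulli's inequality
  have hpow : β ≤ γ ^ p := by
    have := one_add_mul_le_pow (a := -((1 - β) / p)) (by linarith) p
    have h3 : (p : ℝ) * ((1 - β) / p) = 1 - β := by field_simp
    rw [← sub_eq_add_neg, ← hγ] at this
    linarith
  refine ⟨(γ ^ p)⁻¹, γ, by positivity, by linarith, hγ1, hpow, fun n => ?_⟩
  rw [← div_eq_inv_mul, le_div_iff₀ (by positivity)]
  calc β ^ (n / p) * γ ^ p ≤ (γ ^ p) ^ (n / p) * γ ^ p :=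
        mul_le_mul_of_nonneg_right (pow_le_pow_left₀ hβ.le hpow _) (by positivity)
    _ = γ ^ (p * (n / p) + p) := by rw [pow_add, pow_mul]
    _ ≤ γ ^ n := by
        refine pow_le_pow_of_le_one hγ0.le hγ1.le ?_
        have := Nat.div_add_mod n p
        have := Nat.mod_lt n (show 0 < p by omega)
        omega

lemma sum_pow_le {α : ℝ} (hα : 0 ≤ α) (hα1 : α < 1) (n : ℕ) :
    ∑ i ∈ Finset.range n, α ^ i ≤ 1 / (1 - α) := by
  have h := (summable_geometric_of_lt_one hα hα1).sum_le_tsum (Finset.range n)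
    fun i _ => pow_nonneg hα i
  rwa [tsum_geometric_of_lt_one hα hα1, ← one_div] at h

/-- Birkhoff sums of `f` up to time `j` are determined, up to an error `O(α ^ q)`, by the
coordinates of index less than `j + q`. -/
lemma HasModulus.abs_S_sub_S_le {C α : ℝ} (hC : 0 ≤ C) (hα : 0 ≤ α) (hα1 : α < 1)
    {f : TwoSided M → ℝ} (hf : HasModulus C α f) {j q : ℕ} {x y : TwoSided M}
    (h : ∀ i : ℤ, i < j + q → x.1 i = y.1 i) : |S j f x - S j f y| ≤ C / (1 - α) * α ^ q := by
  have h1 : ∀ i ∈ Finset.range j,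
      |f (shiftBy i x) - f (shiftBy i y)| ≤ C * α ^ q * α ^ (j - 1 - i) := by
    intro i hi
    rw [Finset.mem_range] at hi
    refine (hf (q + (j - 1 - i)) _ _ fun m hm => ?_).trans_eq (by rw [pow_add]; ring)
    rw [abs_lt] at hm
    exact h _ (by omega)
  rw [S_eq_sum, S_eq_sum, ← Finset.sum_sub_distrib]
  refine (Finset.abs_sum_le_sum_abs _ _).trans ((Finset.sum_le_sum h1).trans ?_)
  rw [← Finset.mul_sum, Finset.sum_range_reflect (fun i => α ^ i) j]
  calc C * α ^ q * ∑ i ∈ Finset.range j, α ^ i ≤ C * α ^ q * (1 / (1 - α)) :=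
        mul_le_mul_of_nonneg_left (sum_pow_le hα hα1 j) (by positivity)
    _ = _ := by ring

/-- Birkhoff sums over a time interval are determined, up to a bounded error, by the coordinates
with index in that interval. -/
lemma HasModulus.abs_S_sub_S_le_of_agree {C α : ℝ} (hC : 0 ≤ C) (hα : 0 ≤ α) (hα1 : α < 1)
    {f : TwoSided M → ℝ} (hf : HasModulus C α f) {j : ℕ} {x y : TwoSided M}
    (h : ∀ i : ℤ, 0 ≤ i → i < j → x.1 i = y.1 i) : |S j f x - S j f y| ≤ 2 * (C / (1 - α)) := by
  have h1 : ∀ i ∈ Finset.range j,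
      |f (shiftBy i x) - f (shiftBy i y)| ≤ C * (α ^ i + α ^ (j - 1 - i)) := by
    intro i hi
    rw [Finset.mem_range] at hi
    refine (hf (min i (j - 1 - i)) _ _ fun m hm => ?_).trans ?_
    · rw [abs_lt] at hm
      exact h _ (by omega) (by omega)
    · refine mul_le_mul_of_nonneg_left ?_ hC
      rcases min_choice i (j - 1 - i) with h' | h' <;> rw [h']
      · linarith [pow_nonneg hα (j - 1 - i)]
      · linarith [pow_nonneg hα i]
  rw [S_eq_sum, S_eq_sum, ← Finset.sum_sub_distrib]
  refine (Finset.abs_sum_le_sum_abs _ _).trans ((Finset.sum_le_sum h1).trans ?_)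
  rw [← Finset.mul_sum, Finset.sum_add_distrib, Finset.sum_range_reflect (fun i => α ^ i) j]
  have := sum_pow_le hα hα1 j
  calc C * _ ≤ C * (1 / (1 - α) + 1 / (1 - α)) :=
        mul_le_mul_of_nonneg_left (by linarith) hC
    _ = _ := by ring

/-! ### The transfer operator and its invariant cones -/

/-- The one-sided sequence `a z_0 z_1 …`. The value is junk, namely `z`, when the letter `a` may not
precede `z_0`; such terms are always multiplied by the weight `0`. -/
def pre (a : Fin k) (z : OneSided M) : OneSided M :=
  if h : M a (z.1 0) = 1 then
    ⟨fun n => Nat.casesOn n a z.1, fun n => by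
      cases n with
      | zero => exact h
      | succ n => exact z.2 n⟩
  else z

lemma pre_zero {a : Fin k} {z : OneSided M} (h : M a (z.1 0) = 1) : (pre a z).1 0 = a := by
  simp [pre, h]

lemma pre_succ {a : Fin k} {z : OneSided M} (h : M a (z.1 0) = 1) (n : ℕ) :
    (pre a z).1 (n + 1) = z.1 n := by
  simp [pre, h]

lemma shiftPlus_pre {a : Fin k} {z : OneSided M} (h : M a (z.1 0) = 1) :
    shiftPlus (pre a z) = z :=
  Subtype.ext <| funext fun n => pre_succ h n

lemma pre_shiftPlus (z : OneSided M) : pre (z.1 0) (shiftPlus z) = z := by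
  have h : M (z.1 0) ((shiftPlus z).1 0) = 1 := z.2 0
  refine Subtype.ext <| funext fun n => ?_
  cases n with
  | zero => exact pre_zero h
  | succ n => exact pre_succ h n

/-- The probability `e^{-ψ(az)}` of a transition to the preimage `az` of `z`. -/
def weight (ψ : OneSided M → ℝ) (a : Fin k) (z : OneSided M) : ℝ :=
  if M a (z.1 0) = 1 then Real.exp (-ψ (pre a z)) else 0

/-- The Ruelle operator written as a sum over letters, see `ruelle_eq_transfer`. -/
def transfer (ψ g : OneSided M → ℝ) (z : OneSided M) : ℝ :=
  ∑ a, weight ψ a z * g (pre a z)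

lemma weight_nonneg (ψ : OneSided M → ℝ) (a : Fin k) (z : OneSided M) : 0 ≤ weight ψ a z := by
  unfold weight
  split_ifs
  · exact (Real.exp_pos _).le
  · exact le_rfl

lemma ruelle_eq_transfer (ψ g : OneSided M → ℝ) : ruelle ψ g = transfer ψ g := by
  funext z
  have hbij : Set.BijOn (fun a => pre a z) {a | M a (z.1 0) = 1} {y | shiftPlus y = z} := by
    refine ⟨fun a ha => shiftPlus_pre ha, fun a ha b hb hab => ?_, fun y hy => ?_⟩
    · rw [← pre_zero ha, ← pre_zero hb]
      exact congrArg (fun y : OneSided M => y.1 0) hab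
    · have hy' : shiftPlus y = z := hy
      subst hy'
      exact ⟨y.1 0, y.2 0, pre_shiftPlus y⟩
  have h := finsum_mem_eq_of_bijOn (fun a => pre a z) hbij
    (f := fun a => Real.exp (-ψ (pre a z)) * g (pre a z))
    (g := fun y => Real.exp (-ψ y) * g y) (fun _ _ => rfl)
  unfold ruelle transfer
  refine Eq.trans h.symm ?_
  rw [finsum_eq_sum_of_fintype]
  refine Finset.sum_congr rfl fun a _ => ?_
  rw [finsum_eq_if]
  simp only [weight, Set.mem_ofPred_eq]
  split_ifs <;> simp

lemma sum_weight {ψ : OneSided M → ℝ} (hψ : IsNormalized ψ) (z : OneSided M) :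
    ∑ a, weight ψ a z = 1 := by
  have h := hψ z
  rw [ruelle_eq_transfer] at h
  simpa [transfer] using h

lemma transfer_const_add {ψ : OneSided M → ℝ} (hψ : IsNormalized ψ) (c : ℝ) (g : OneSided M → ℝ) :
    transfer ψ (fun z => c + g z) = fun z => c + transfer ψ g z := by
  funext z
  simp only [transfer, mul_add, Finset.sum_add_distrib, ← Finset.sum_mul, sum_weight hψ, one_mul]

lemma transfer_iterate_nonneg (ψ : OneSided M → ℝ) {g : OneSided M → ℝ} (hg : ∀ z, 0 ≤ g z)
    (n : ℕ) (z : OneSided M) : 0 ≤ (transfer ψ)^[n] g z := by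
  induction n generalizing z with
  | zero => exact hg z
  | succ n ih =>
    rw [Function.iterate_succ_apply']
    exact Finset.sum_nonneg fun a _ => mul_nonneg (weight_nonneg ψ a z) (ih _)

lemma transfer_iterate_const_add {ψ : OneSided M → ℝ} (hψ : IsNormalized ψ) (c : ℝ)
    (g : OneSided M → ℝ) (n : ℕ) :
    (transfer ψ)^[n] (fun z => c + g z) = fun z => c + (transfer ψ)^[n] g z := by
  induction n with
  | zero => rfl
  | succ n ih => rw [Function.iterate_succ_apply', ih, transfer_const_add hψ,
      Function.iterate_succ_apply']

lemma transfer_mul_comp (ψ g v : OneSided M → ℝ) :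
    transfer ψ (fun z => g z * v (shiftPlus z)) = fun z => transfer ψ g z * v z := by
  funext z
  rw [transfer, transfer, Finset.sum_mul]
  refine Finset.sum_congr rfl fun a _ => ?_
  by_cases h : M a (z.1 0) = 1
  · rw [shiftPlus_pre h, mul_assoc]
  · simp [weight, h]

/-- The cone of nonnegative functions `w` with `w z ≤ exp (D α ^ n) w z'` whenever `z` and `z'`
agree at the first `n` places, `n ≥ m`. -/
structure InCone (D α : ℝ) (m : ℕ) (w : OneSided M → ℝ) : Prop where
  nonneg : ∀ z, 0 ≤ w z
  le : ∀ n, m ≤ n → ∀ z z' : OneSided M, (∀ i < n, z.1 i = z'.1 i) →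
    w z ≤ Real.exp (D * α ^ n) * w z'

lemma InCone.mono {D D' α : ℝ} {m m' : ℕ} (hα : 0 ≤ α) (hD : D ≤ D') (hm : m ≤ m')
    {w : OneSided M → ℝ} (hw : InCone D α m w) : InCone D' α m' w :=
  ⟨hw.nonneg, fun n hn z z' h => (hw.le n (hm.trans hn) z z' h).trans
    (mul_le_mul_of_nonneg_right (Real.exp_le_exp.mpr
      (mul_le_mul_of_nonneg_right hD (pow_nonneg hα n))) (hw.nonneg z'))⟩

lemma InCone.continuous {D α : ℝ} (hα : 0 ≤ α) (hα1 : α < 1) {m : ℕ} {w : OneSided M → ℝ}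
    (hw : InCone D α m w) : Continuous w := by
  rw [continuous_iff_continuousAt]
  intro z
  have h0 : Tendsto (fun n : ℕ => Real.exp (D * α ^ n) * w z) atTop (𝓝 (w z)) := by
    have := ((tendsto_pow_atTop_nhds_zero_of_lt_one hα hα1).const_mul D).rexp.mul_const (w z)
    simpa using this
  have h1 : Tendsto (fun n : ℕ => Real.exp (-(D * α ^ n)) * w z) atTop (𝓝 (w z)) := by
    have := ((tendsto_pow_atTop_nhds_zero_of_lt_one hα hα1).const_mul D).neg.rexp.mul_const (w z)
    simpa using this
  refine tendsto_order.mpr ⟨fun a ha => ?_, fun a ha => ?_⟩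
  · obtain ⟨n, hn, hmn⟩ := ((h1.eventually (lt_mem_nhds ha)).and (eventually_ge_atTop m)).exists
    filter_upwards [eventually_agreePlus z n] with y hy
    refine hn.trans_le ?_
    rw [Real.exp_neg, inv_mul_le_iff₀ (Real.exp_pos _)]
    exact hw.le n hmn z y hy
  · obtain ⟨n, hn, hmn⟩ := ((h0.eventually (gt_mem_nhds ha)).and (eventually_ge_atTop m)).exists
    filter_upwards [eventually_agreePlus z n] with y hy
    exact (hw.le n hmn y z fun i hi => (hy i hi).symm).trans_lt hn

lemma HasModulusPlus.continuous {C α : ℝ} {ψ : OneSided M → ℝ} (hα : 0 ≤ α) (hα1 : α < 1)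
    (hψ : HasModulusPlus C α ψ) : Continuous ψ := by
  have h0 : InCone C α 0 (fun z => Real.exp (ψ z)) := by
    refine ⟨fun z => (Real.exp_pos _).le, fun n _ z z' h => ?_⟩
    rw [← Real.exp_add, Real.exp_le_exp]
    linarith [(abs_le.mp (hψ n z z' h)).2]
  simpa using (h0.continuous hα hα1).log fun z => (Real.exp_pos _).ne'

lemma InCone.transfer {C D α : ℝ} {ψ : OneSided M → ℝ}
    (hψ : HasModulusPlus C α ψ) {m : ℕ} (hm : 1 ≤ m) {w : OneSided M → ℝ}
    (hw : InCone D α (m + 1) w) : InCone ((C + D) * α) α m (transfer ψ w) := by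
  refine ⟨fun z => Finset.sum_nonneg fun a _ => mul_nonneg (weight_nonneg ψ a z) (hw.nonneg _),
    fun n hn z z' h => ?_⟩
  rw [SFT.transfer, SFT.transfer, Finset.mul_sum]
  refine Finset.sum_le_sum fun a _ => ?_
  have h0 : z.1 0 = z'.1 0 := h 0 (by omega)
  by_cases ha : M a (z.1 0) = 1
  · have ha' : M a (z'.1 0) = 1 := h0 ▸ ha
    have hagree : ∀ i < n + 1, (pre a z).1 i = (pre a z').1 i := by
      intro i hi
      cases i with
      | zero => rw [pre_zero ha, pre_zero ha']
      | succ i => rw [pre_succ ha, pre_succ ha', h i (by omega)]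
    have h1 := hw.le (n + 1) (by omega) _ _ hagree
    have h2 := (abs_le.mp (hψ (n + 1) _ _ hagree)).1
    rw [weight, weight, if_pos ha, if_pos ha']
    calc Real.exp (-ψ (pre a z)) * w (pre a z)
        ≤ Real.exp (C * α ^ (n + 1) + -ψ (pre a z')) *
          (Real.exp (D * α ^ (n + 1)) * w (pre a z')) :=
          mul_le_mul (Real.exp_le_exp.mpr (by linarith)) h1 (hw.nonneg _) (Real.exp_pos _).le
      _ = Real.exp ((C + D) * α * α ^ n) * (Real.exp (-ψ (pre a z')) * w (pre a z')) := by
          rw [show (C + D) * α * α ^ n = C * α ^ (n + 1) + D * α ^ (n + 1) by ring,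
            Real.exp_add, Real.exp_add]
          ring
  · have ha' : ¬ M a (z'.1 0) = 1 := h0 ▸ ha
    simp [weight, ha, ha']

/-- A nonnegative function of the first `N + m` coordinates enters the cone after `N` steps. -/
lemma InCone.transfer_iterate {C D α : ℝ} (hα : 0 ≤ α) (hD : (C + D) * α ≤ D)
    {ψ : OneSided M → ℝ} (hψ : HasModulusPlus C α ψ) {m : ℕ} (hm : 1 ≤ m) (N : ℕ)
    {w : OneSided M → ℝ} (hw : InCone D α (N + m) w) :
    InCone D α m ((SFT.transfer ψ)^[N] w) := by
  induction N generalizing w with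
  | zero => simpa using hw
  | succ N ih =>
    rw [Function.iterate_succ_apply]
    refine ih ?_
    refine (InCone.transfer hψ (m := N + m) (by omega) ?_).mono hα hD le_rfl
    rwa [show N + m + 1 = N + 1 + m by ring]

lemma InCone.transfer_iterate_one {C D α : ℝ} (hα : 0 ≤ α) (hD : (C + D) * α ≤ D)
    {ψ : OneSided M → ℝ} (hψ : HasModulusPlus C α ψ) (N : ℕ) {w : OneSided M → ℝ}
    (hw : InCone D α 1 w) : InCone D α 1 ((SFT.transfer ψ)^[N] w) :=
  InCone.transfer_iterate hα hD hψ le_rfl N (hw.mono hα le_rfl (by omega))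

/-- If the letter `a` is joined to `z_0` by a path of length `n`, then one of the terms of
`L^n w z` is a multiple of a value of `w` in the cylinder of `a`. -/
lemma exists_le_transfer_iterate {B : ℝ} {ψ : OneSided M → ℝ} (hB : ∀ z, |ψ z| ≤ B)
    (h01 : ∀ i j, M i j = 0 ∨ M i j = 1) (n : ℕ) {a : Fin k} {z : OneSided M}
    (h : 0 < (M ^ n) a (z.1 0)) :
    ∃ y : OneSided M, y.1 0 = a ∧ ∀ w : OneSided M → ℝ, (∀ z, 0 ≤ w z) →
      Real.exp (-B) ^ n * w y ≤ (transfer ψ)^[n] w z := by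
  induction n generalizing z with
  | zero =>
    refine ⟨z, ?_, fun w _ => by simp⟩
    by_contra hne
    rw [pow_zero, Matrix.one_apply_ne (fun h' => hne h'.symm)] at h
    exact lt_irrefl _ h
  | succ n ih =>
    rw [pow_succ, Matrix.mul_apply] at h
    obtain ⟨b, -, hb⟩ := Finset.exists_ne_zero_of_sum_ne_zero h.ne'
    have hbz : M b (z.1 0) = 1 := (h01 _ _).resolve_left (right_ne_zero_of_mul hb)
    have hab : 0 < (M ^ n) a ((pre b z).1 0) := by
      rw [pre_zero hbz]
      exact Nat.pos_of_ne_zero (left_ne_zero_of_mul hb)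
    obtain ⟨y, hy, hw⟩ := ih hab
    refine ⟨y, hy, fun w hw0 => ?_⟩
    rw [Function.iterate_succ_apply']
    refine le_trans ?_ (Finset.single_le_sum (f := fun a => weight ψ a z *
      (transfer ψ)^[n] w (pre a z)) (fun c _ => mul_nonneg (weight_nonneg ψ c z)
        (transfer_iterate_nonneg ψ hw0 n _)) (Finset.mem_univ b))
    rw [pow_succ', mul_assoc]
    refine mul_le_mul ?_ (hw w hw0) (mul_nonneg (by positivity) (hw0 y)) (weight_nonneg ψ b z)
    rw [weight, if_pos hbz, Real.exp_le_exp]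
    linarith [(abs_le.mp (hB (pre b z))).2]

lemma le_transfer_iterate_shiftPlus {B : ℝ} {ψ : OneSided M → ℝ} (hB : ∀ z, |ψ z| ≤ B)
    (n : ℕ) (z : OneSided M) {w : OneSided M → ℝ} (hw0 : ∀ z, 0 ≤ w z) :
    Real.exp (-B) ^ n * w z ≤ (transfer ψ)^[n] w (shiftPlus^[n] z) := by
  induction n with
  | zero => simp
  | succ n ih =>
    rw [Function.iterate_succ_apply', Function.iterate_succ_apply']
    set y := shiftPlus^[n] z
    refine le_trans ?_ (Finset.single_le_sum (f := fun a => weight ψ a (shiftPlus y) *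
      (transfer ψ)^[n] w (pre a (shiftPlus y))) (fun c _ => mul_nonneg (weight_nonneg ψ c _)
        (transfer_iterate_nonneg ψ hw0 n _)) (Finset.mem_univ (y.1 0)))
    simp only [pre_shiftPlus]
    rw [pow_succ', mul_assoc]
    refine mul_le_mul ?_ ih (mul_nonneg (by positivity) (hw0 z)) (weight_nonneg ψ _ _)
    rw [weight, if_pos (show M (y.1 0) ((shiftPlus y).1 0) = 1 from y.2 0), pre_shiftPlus,
      Real.exp_le_exp]
    linarith [(abs_le.mp (hB y)).2]

/-- Doeblin's minorization on the cone: by primitivity of `M`, the iterate `L^p w` is bounded below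
everywhere by a fixed multiple of any value of `w`. -/
lemma exists_minorization (hM : IsIrreducibleTransition M) {D α B : ℝ} (hD : 0 ≤ D)
    (hα1 : α ≤ 1) {ψ : OneSided M → ℝ} (hB : ∀ z, |ψ z| ≤ B) :
    ∃ (p : ℕ) (c : ℝ), 1 ≤ p ∧ 0 < c ∧ ∀ w : OneSided M → ℝ, InCone D α 1 w →
      ∀ y z, c * w y ≤ (transfer ψ)^[p] w z := by
  obtain ⟨h01, p, hp, hpos⟩ := hM
  refine ⟨p, Real.exp (-B) ^ p * Real.exp (-D), hp, by positivity, fun w hw y z => ?_⟩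
  obtain ⟨y', hy', h⟩ := exists_le_transfer_iterate hB h01 p (hpos (y.1 0) (z.1 0))
  refine le_trans ?_ (h w hw.nonneg)
  rw [mul_assoc]
  refine mul_le_mul_of_nonneg_left ?_ (by positivity)
  rw [Real.exp_neg, inv_mul_le_iff₀ (Real.exp_pos _)]
  have h1 := hw.le 1 le_rfl y y' fun i hi => by
    obtain rfl : i = 0 := by omega
    exact hy'.symm
  refine h1.trans (mul_le_mul_of_nonneg_right (Real.exp_le_exp.mpr ?_) (hw.nonneg _))
  rw [pow_one]
  exact mul_le_of_le_one_right hD hα1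

section Gibbs

variable {ψ : OneSided M → ℝ} {ν : Measure (TwoSided M)}

lemma IsGibbsMeasure.isProbabilityMeasure_map (hν : IsGibbsMeasure ψ ν) :
    IsProbabilityMeasure (ν.map proj) := by
  have := hν.isProbabilityMeasure
  exact Measure.isProbabilityMeasure_map continuous_proj.measurable.aemeasurable

lemma integral_map_proj {g : OneSided M → ℝ} (hg : Continuous g) :
    ∫ z, g z ∂(ν.map proj) = ∫ x, g (proj x) ∂ν :=
  integral_map continuous_proj.measurable.aemeasurable hg.aestronglyMeasurable

lemma integrable_of_bdd {Y : Type*} [MeasurableSpace Y] [TopologicalSpace Y] [BorelSpace Y]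
    {μ : Measure Y} [IsFiniteMeasure μ] {g : Y → ℝ} (hg : Continuous g)
    {B : ℝ} (hB : ∀ z, |g z| ≤ B) : Integrable g μ :=
  (integrable_const B).mono' hg.aestronglyMeasurable (Eventually.of_forall hB)

lemma continuous_pre (a : Fin k) : Continuous (pre (M := M) a) := by
  refine continuous_induced_rng.mpr (continuous_pi fun n => ?_)
  refine continuous_iff_continuousAt.mpr fun z => ?_
  refine tendsto_nhds_of_eventually_eq ?_
  filter_upwards [eventually_agreePlus z (n + 1)] with y hy
  have h0 := hy 0 (by omega)
  by_cases h : M a (z.1 0) = 1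
  · have h' : M a (y.1 0) = 1 := h0 ▸ h
    change (pre a y).1 n = (pre a z).1 n
    cases n with
    | zero => rw [pre_zero h, pre_zero h']
    | succ n => rw [pre_succ h, pre_succ h', hy n (by omega)]
  · have h' : ¬ M a (y.1 0) = 1 := h0 ▸ h
    simp [pre, h, h', hy n (by omega)]

lemma continuous_weight (hψ : Continuous ψ) (a : Fin k) : Continuous (weight ψ a) := by
  have h : weight ψ a = fun z : OneSided M =>
      (fun b : Fin k => if M a b = 1 then (1 : ℝ) else 0) (z.1 0) * Real.exp (-ψ (pre a z)) := by
    funext z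
    simp only [weight]
    split_ifs <;> simp
  rw [h]
  have h1 : Continuous fun z : OneSided M =>
      (fun b : Fin k => if M a b = 1 then (1 : ℝ) else 0) (z.1 0) :=
    (continuous_of_discreteTopology (f := fun b : Fin k => if M a b = 1 then (1 : ℝ) else 0)).comp
      (continuous_coordPlus 0)
  have h2 : Continuous fun z : OneSided M => Real.exp (-ψ (pre a z)) :=
    (hψ.comp (continuous_pre a)).neg.rexp
  exact h1.mul h2

lemma continuous_transfer_iterate (hψ : Continuous ψ) {g : OneSided M → ℝ} (hg : Continuous g)
    (n : ℕ) : Continuous ((transfer ψ)^[n] g) := by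
  induction n with
  | zero => exact hg
  | succ n ih =>
    rw [Function.iterate_succ_apply']
    exact continuous_finsetSum _ fun a _ =>
      (continuous_weight hψ a).mul (ih.comp (continuous_pre a))

lemma IsGibbsMeasure.integral_transfer (hν : IsGibbsMeasure ψ ν) {g : OneSided M → ℝ}
    (hg : Continuous g) : ∫ z, transfer ψ g z ∂(ν.map proj) = ∫ z, g z ∂(ν.map proj) := by
  rw [← ruelle_eq_transfer]
  exact hν.ruelle_invariant ⟨g, hg⟩

/-- Duality between composition with the shift and the transfer operator. -/
lemma IsGibbsMeasure.integral_mul_comp_iterate (hν : IsGibbsMeasure ψ ν) (hψ : Continuous ψ)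
    {g v : OneSided M → ℝ} (hg : Continuous g) (hv : Continuous v) (n : ℕ) :
    ∫ z, g z * v (shiftPlus^[n] z) ∂(ν.map proj) =
      ∫ z, (transfer ψ)^[n] g z * v z ∂(ν.map proj) := by
  induction n generalizing g with
  | zero => rfl
  | succ n ih =>
    have hvn : Continuous fun z : OneSided M => v (shiftPlus^[n] z) :=
      hv.comp (continuous_shiftPlus.iterate n)
    have h1 := hν.integral_transfer (hg.mul (hvn.comp continuous_shiftPlus))
    have h2 := transfer_mul_comp ψ g fun z => v (shiftPlus^[n] z)
    simp only [Function.iterate_succ_apply]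
    refine h1.symm.trans ?_
    refine Eq.trans ?_ (ih (continuous_transfer_iterate hψ hg 1))
    exact congrArg (fun F => ∫ z, F z ∂(ν.map proj)) h2

lemma IsGibbsMeasure.integral_transfer_iterate (hν : IsGibbsMeasure ψ ν) (hψ : Continuous ψ)
    {g : OneSided M → ℝ} (hg : Continuous g) (n : ℕ) :
    ∫ z, (transfer ψ)^[n] g z ∂(ν.map proj) = ∫ z, g z ∂(ν.map proj) := by
  have h := hν.integral_mul_comp_iterate hψ hg (continuous_const (y := (1 : ℝ))) n
  simpa using h.symm

end Gibbs

/-! ### Contraction of the cones -/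

section Contraction

variable {ψ : OneSided M → ℝ} {ν : Measure (TwoSided M)}

/-- A fraction of a lower bound can be subtracted from a function in a cone, at the cost of a larger
cone. -/
lemma InCone.sub_const {D α η b : ℝ} {m : ℕ} (hα : 0 ≤ α) (hη0 : 0 ≤ η) (hη : η ≤ 1)
    {g : OneSided M → ℝ} (hg : InCone ((1 - η) * D) α m g) (hD : 0 ≤ D)
    (hb : ∀ z, b ≤ η * g z) : InCone D α m (fun z => g z - b) := by
  refine ⟨fun z => ?_, fun n hn z z' h => ?_⟩
  · have := mul_le_of_le_one_left (hg.nonneg z) hη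
    linarith [hb z]
  · set s := D * α ^ n with hs
    have hs0 : 0 ≤ s := by positivity
    have h1 := hg.le n hn z z' h
    rw [mul_assoc, ← hs] at h1
    -- convexity of `exp` on `[0, s]`
    have hconv : Real.exp ((1 - η) * s) ≤ (1 - η) * Real.exp s + η := by
      have := convexOn_exp.2 (Set.mem_univ s) (Set.mem_univ 0) (sub_nonneg.mpr hη) hη0 (by ring)
      simpa using this
    have h2 : 1 ≤ Real.exp s := Real.one_le_exp hs0
    nlinarith [hg.nonneg z', hb z', mul_le_mul_of_nonneg_right hconv (hg.nonneg z'),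
      mul_le_mul_of_nonneg_right (hb z') (sub_nonneg.mpr h2)]

/-- Spectral gap of the transfer operator on the cone: on functions `w` in the cone, `L^n w`
converges to the mean of `w` exponentially fast, and relatively to that mean. -/
theorem exists_cone_contraction (hM : IsIrreducibleTransition M) {C α : ℝ} (hC : 0 < C) (hα : 0 < α)
    (hα1 : α < 1) (hψ : HasModulusPlus C α ψ) (hψn : IsNormalized ψ) (hν : IsGibbsMeasure ψ ν) :
    ∃ (D c K θ : ℝ) (p : ℕ), 0 < D ∧ (C + D) * α ≤ D ∧ 0 < c ∧ 0 < K ∧ 0 < θ ∧ θ < 1 ∧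
      ∀ w : OneSided M → ℝ, InCone D α 1 w →
        (∀ y, c * w y ≤ ∫ z, w z ∂(ν.map proj)) ∧
        (∀ z, c * ∫ z, w z ∂(ν.map proj) ≤ (transfer ψ)^[p] w z) ∧
        ∀ n z, |(transfer ψ)^[n] w z - ∫ z, w z ∂(ν.map proj)| ≤
          K * θ ^ n * ∫ z, w z ∂(ν.map proj) := by
  have := hν.isProbabilityMeasure_map
  obtain ⟨B, -, hB⟩ := hψ.exists_bound hC.le
  have h1α : 0 < 1 - α := by linarith
  -- with this choice the transfer operator maps the cone of parameter `D` to that of parameter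
  -- `(1 - η) D`
  set D : ℝ := 2 * C * α / (1 - α) with hDdef
  have hD : 0 < D := by positivity
  set η : ℝ := (1 - α) / 2 with hηdef
  have hη0 : 0 < η := by positivity
  have hη1 : η < 1 := by rw [hηdef]; linarith
  have hD' : (C + D) * α = (1 - η) * D := by
    rw [hDdef, hηdef]
    field_simp
    ring
  have hDα : (C + D) * α ≤ D := by
    rw [hD']
    nlinarith
  obtain ⟨p, c, hp, hc, hmin⟩ := exists_minorization hM hD.le hα1.le hB
  have hψc : Continuous ψ := hψ.continuous hα.le hα1
  obtain ⟨z₀⟩ := (ν.map proj).nonempty_of_neZero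
  set μ := ν.map proj with hμ
  have hint : ∀ w : OneSided M → ℝ, InCone D α 1 w → Integrable w μ := fun w hw =>
    integrable_of_bdd (hw.continuous hα.le hα1) (B := (transfer ψ)^[p] w z₀ / c) fun y => by
      rw [abs_of_nonneg (hw.nonneg y), le_div_iff₀ hc, mul_comm]
      exact hmin w hw y z₀
  have hcontp : ∀ w : OneSided M → ℝ, InCone D α 1 w → ∀ n,
      InCone D α 1 ((transfer ψ)^[n] w) := fun w hw n =>
    InCone.transfer_iterate_one hα.le hDα hψ n hw
  have hinteq : ∀ w : OneSided M → ℝ, InCone D α 1 w → ∀ n,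
      ∫ z, (transfer ψ)^[n] w z ∂μ = ∫ z, w z ∂μ := fun w hw n =>
    hν.integral_transfer_iterate hψc (hw.continuous hα.le hα1) n
  have hup : ∀ w : OneSided M → ℝ, InCone D α 1 w → ∀ y, c * w y ≤ ∫ z, w z ∂μ := by
    intro w hw y
    rw [← hinteq w hw p]
    have := integral_mono (μ := μ) (integrable_const (c * w y)) (hint _ (hcontp w hw p))
      fun z => hmin w hw y z
    simpa using this
  have hlow : ∀ w : OneSided M → ℝ, InCone D α 1 w → ∀ z,
      c * ∫ z, w z ∂μ ≤ (transfer ψ)^[p] w z := by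
    intro w hw z
    have := integral_mono (μ := μ) ((hint w hw).const_mul c)
      (integrable_const ((transfer ψ)^[p] w z)) fun y => hmin w hw y z
    simpa [integral_const_mul] using this
  have hc1 : c ≤ 1 := by
    have hone : InCone D α 1 (fun _ : OneSided M => (1 : ℝ)) :=
      ⟨fun _ => zero_le_one, fun n _ z z' _ => by
        rw [mul_one]
        exact Real.one_le_exp (by positivity)⟩
    simpa using hup _ hone z₀
  set ε : ℝ := η * c with hε
  have hε0 : 0 < ε := by positivity
  have hε1 : ε < 1 := by nlinarith
  -- each block of `p` steps extracts a fraction `ε` of the mean and leaves a remainder in the cone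
  have hdecomp : ∀ w : OneSided M → ℝ, InCone D α 1 w → ∀ n : ℕ,
      ∃ v : OneSided M → ℝ, InCone D α 1 v ∧ ∫ z, v z ∂μ = (1 - ε) ^ n * ∫ z, w z ∂μ ∧
        (transfer ψ)^[p * n] w = fun z => (1 - (1 - ε) ^ n) * ∫ z, w z ∂μ + v z := by
    intro w hw n
    induction n with
    | zero => exact ⟨w, hw, by simp, by simp⟩
    | succ n ih =>
      obtain ⟨v, hv, hvint, hveq⟩ := ih
      have hLv : InCone ((1 - η) * D) α 1 ((transfer ψ)^[p] v) := by
        obtain ⟨q, rfl⟩ : ∃ q, p = q + 1 := ⟨p - 1, by omega⟩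
        rw [Function.iterate_succ_apply', ← hD']
        exact InCone.transfer hψ le_rfl ((hcontp v hv q).mono hα.le le_rfl (by omega))
      refine ⟨fun z => (transfer ψ)^[p] v z - ε * ∫ z, v z ∂μ,
        hLv.sub_const hα.le hη0.le hη1.le hD.le fun z => ?_, ?_, ?_⟩
      · rw [hε, mul_assoc]
        exact mul_le_mul_of_nonneg_left (hlow v hv z) hη0.le
      · rw [integral_sub (hint _ (hcontp v hv p)) (integrable_const _), hinteq v hv p, hvint]
        simp only [integral_const, probReal_univ, smul_eq_mul]
        ring
      · rw [show p * (n + 1) = p + p * n by ring, Function.iterate_add_apply, hveq,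
          transfer_iterate_const_add hψn]
        funext z
        rw [hvint]
        ring
  obtain ⟨K₀, θ, hK₀, hθ0, hθ1, -, hθ⟩ := exists_pow_div_le (β := 1 - ε) (by linarith)
    (by linarith) hp
  refine ⟨D, c, c⁻¹ * K₀, θ, p, hD, hDα, hc, by positivity, by linarith, hθ1, fun w hw =>
    ⟨hup w hw, hlow w hw, fun n z => ?_⟩⟩
  have hw0 : 0 ≤ ∫ z, w z ∂μ := integral_nonneg hw.nonneg
  obtain ⟨v, hv, hvint, hveq⟩ := hdecomp _ (hcontp w hw (n % p)) (n / p)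
  rw [hinteq w hw] at hvint hveq
  have hn : (transfer ψ)^[n] w z = (1 - (1 - ε) ^ (n / p)) * ∫ z, w z ∂μ + v z := by
    rw [← congrFun hveq z, ← Function.iterate_add_apply, Nat.div_add_mod]
  have hvz := hup v hv z
  rw [hvint, ← le_div_iff₀' hc, div_eq_inv_mul] at hvz
  have hpow : 0 < (1 - ε) ^ (n / p) := pow_pos (by linarith) _
  have hcinv : 1 ≤ c⁻¹ := (one_le_inv₀ hc).mpr hc1
  have hle : |(transfer ψ)^[n] w z - ∫ z, w z ∂μ| ≤ c⁻¹ * ((1 - ε) ^ (n / p) * ∫ z, w z ∂μ) := by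
    have h3 : 0 ≤ (1 - ε) ^ (n / p) * ∫ z, w z ∂μ := by positivity
    have h4 := le_mul_of_one_le_left h3 hcinv
    rw [hn, abs_le]
    constructor <;> nlinarith [hv.nonneg z]
  refine hle.trans ?_
  rw [mul_assoc, mul_assoc]
  refine mul_le_mul_of_nonneg_left ?_ (by positivity)
  rw [← mul_assoc]
  exact mul_le_mul_of_nonneg_right (hθ n) hw0

end Contraction

/-! ### Decay of correlations between the past and the future -/

/-- The function `u` is determined by the coordinates of index at most `l`. -/
def DependsOnPast (l : ℤ) (u : TwoSided M → ℝ) : Prop :=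
  ∀ x y : TwoSided M, (∀ i ≤ l, x.1 i = y.1 i) → u x = u y

lemma dependsOnPast_comp_trunc (hM : IsIrreducibleTransition M) (l : ℤ) (u : TwoSided M → ℝ) :
    DependsOnPast l (fun x => u (trunc hM l x)) := fun _ _ h => by
  simp only [trunc_congr hM h]

section Mixing

variable {ψ : OneSided M → ℝ} {ν : Measure (TwoSided M)}

lemma IsGibbsMeasure.integral_comp_shiftBy (hν : IsGibbsMeasure ψ ν) {F : TwoSided M → ℝ}
    (hF : Continuous F) (n : ℕ) : ∫ x, F (shiftBy n x) ∂ν = ∫ x, F x ∂ν := by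
  have h := hν.invariant.iterate n
  have h2 := integral_map h.measurable.aemeasurable (f := F)
    (hF.aestronglyMeasurable (μ := ν.map (shift^[n])))
  rw [h.map_eq] at h2
  rw [h2]
  simp only [shift_iterate]

/-- Replacing the coordinates of index less than `-N` by a standard past is harmless as
`N → ∞`. -/
lemma tendsto_shiftBy_ext_proj (hM : IsIrreducibleTransition M) (x : TwoSided M) :
    Tendsto (fun N : ℕ => shiftBy N (ext hM (proj (shiftBy (-N) x)))) atTop (𝓝 x) := by
  rw [tendsto_subtype_rng, tendsto_pi_nhds]
  intro i
  refine tendsto_nhds_of_eventually_eq ?_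
  filter_upwards [eventually_ge_atTop i.natAbs] with N hN
  have h : 0 ≤ i + (N : ℤ) := by omega
  rw [shiftBy_apply, ext_apply_of_nonneg hM h]
  refine congrArg x.1 ?_
  omega

/-- For a function `u` of the past up to time `l` that moreover ignores the coordinates of index
less than `-N`, the correlations with the future are computed by the transfer operator. -/
lemma exists_inCone_integral_eq (hM : IsIrreducibleTransition M) {C D α : ℝ}
    (hα : 0 < α) (hψ : HasModulusPlus C α ψ) (hψc : Continuous ψ)
    (hν : IsGibbsMeasure ψ ν) (hD : 0 ≤ D) (hDα : (C + D) * α ≤ D) (N l : ℕ)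
    {u : TwoSided M → ℝ} (hu : Continuous u) (hu0 : ∀ x, 0 ≤ u x) (hul : DependsOnPast l u) :
    ∃ w : OneSided M → ℝ, InCone D α 1 w ∧ ∀ (v : OneSided M → ℝ), Continuous v → ∀ n : ℕ,
      ∫ x, u (shiftBy N (ext hM (proj (shiftBy (-N) x)))) *
        v (proj (shiftBy ((l + n : ℕ) : ℤ) x)) ∂ν =
      ∫ z, (transfer ψ)^[n] w z * v z ∂(ν.map proj) := by
  set g : OneSided M → ℝ := fun z => u (shiftBy N (ext hM z)) with hg
  have hgc : Continuous g := hu.comp ((continuous_shiftBy _).comp (continuous_ext hM))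
  have hcone : InCone D α (N + l + 1) g := by
    refine ⟨fun z => hu0 _, fun n hn z z' h => ?_⟩
    have : g z = g z' := by
      refine hul _ _ fun i hi => ?_
      rw [shiftBy_apply, shiftBy_apply]
      by_cases hi0 : 0 ≤ i + (N : ℤ)
      · rw [ext_apply_of_nonneg hM hi0, ext_apply_of_nonneg hM hi0]
        exact h _ (by omega)
      · simp only [ext, if_neg hi0]
        rw [h 0 (by omega)]
    rw [this]
    exact le_mul_of_one_le_left (hu0 _) (Real.one_le_exp (by positivity))
  refine ⟨(transfer ψ)^[N + l] g, InCone.transfer_iterate hα.le hDα hψ le_rfl _ hcone,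
    fun v hv n => ?_⟩
  rw [← Function.iterate_add_apply, ← hν.integral_mul_comp_iterate hψc hgc hv,
    integral_map_proj (g := fun z => g z * v (shiftPlus^[n + (N + l)] z))
      (hgc.mul (hv.comp (continuous_shiftPlus.iterate _))),
    ← hν.integral_comp_shiftBy _ N]
  · refine integral_congr_ae (Eventually.of_forall fun x => ?_)
    simp only [shiftBy_shiftBy, ← proj_shiftBy, hg]
    congr 4
    · simp
    · push_cast
      ring
  · exact (hu.comp ((continuous_shiftBy _).comp ((continuous_ext hM).comp
      (continuous_proj.comp (continuous_shiftBy _))))).mul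
      (hv.comp (continuous_proj.comp (continuous_shiftBy _)))

/-- Mixing of the past and the future: the covariance of a nonnegative function `u` of the past with
a bounded function of the future decays exponentially fast relatively to the mean of `u`, and after
a fixed gap the past and the future are comparable to independent ones. -/
theorem exists_mixing (hM : IsIrreducibleTransition M) (hψ : IsHolderPlus ψ)
    (hψn : IsNormalized ψ) (hν : IsGibbsMeasure ψ ν) :
    ∃ (c K θ : ℝ) (p : ℕ), 0 < c ∧ 0 < K ∧ 0 < θ ∧ θ < 1 ∧
      ∀ (l : ℕ) (u : TwoSided M → ℝ), Continuous u → (∀ x, 0 ≤ u x) → (∃ B, ∀ x, u x ≤ B) →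
        DependsOnPast l u → ∀ (v : OneSided M → ℝ) (B : ℝ), Continuous v → (∀ z, |v z| ≤ B) →
        (∀ n : ℕ, |∫ x, u x * v (proj (shiftBy ((l + n : ℕ) : ℤ) x)) ∂ν -
          (∫ x, u x ∂ν) * ∫ x, v (proj x) ∂ν| ≤ K * θ ^ n * B * ∫ x, u x ∂ν) ∧
        ((∀ z, 0 ≤ v z) → c * ((∫ x, u x ∂ν) * ∫ x, v (proj x) ∂ν) ≤
          ∫ x, u x * v (proj (shiftBy ((l + p : ℕ) : ℤ) x)) ∂ν) := by
  obtain ⟨C, α, hC, hα, hα1, hψm⟩ := hψ.exists_modulus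
  have hψc := hψm.continuous hα.le hα1
  obtain ⟨D, c, K, θ, p, hD, hDα, hc, hK, hθ, hθ1, hw⟩ :=
    exists_cone_contraction hM hC hα hα1 hψm hψn hν
  have := hν.isProbabilityMeasure
  have := hν.isProbabilityMeasure_map
  refine ⟨c, K, θ, p, hc, hK, hθ, hθ1, fun l u hu hu0 ⟨Bu, hBu⟩ hul v B hv hB => ?_⟩
  set uN : ℕ → TwoSided M → ℝ := fun N x => u (shiftBy N (ext hM (proj (shiftBy (-N) x))))
    with huN
  have huNc : ∀ N, Continuous (uN N) := fun N =>
    hu.comp ((continuous_shiftBy _).comp ((continuous_ext hM).comp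
      (continuous_proj.comp (continuous_shiftBy _))))
  have hvc : ∀ m : ℤ, Continuous fun x : TwoSided M => v (proj (shiftBy m x)) := fun m =>
    hv.comp (continuous_proj.comp (continuous_shiftBy _))
  have hlim : ∀ F : TwoSided M → ℝ, Continuous F → (∀ x, |F x| ≤ B) →
      Tendsto (fun N => ∫ x, uN N x * F x ∂ν) atTop (𝓝 (∫ x, u x * F x ∂ν)) := by
    intro F hF hFB
    refine tendsto_integral_of_dominated_convergence (fun _ => Bu * B)
      (fun N => ((huNc N).mul hF).aestronglyMeasurable) (integrable_const _)
      (fun N => Eventually.of_forall fun x => ?_) (Eventually.of_forall fun x => ?_)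
    · rw [Real.norm_eq_abs, abs_mul, abs_of_nonneg (hu0 _)]
      exact mul_le_mul (hBu _) (hFB x) (abs_nonneg _) ((hu0 x).trans (hBu x))
    · exact ((hu.tendsto x).comp (tendsto_shiftBy_ext_proj hM x)).mul_const _
  have hlim1 : Tendsto (fun N => ∫ x, uN N x ∂ν) atTop (𝓝 (∫ x, u x ∂ν)) := by
    refine tendsto_integral_of_dominated_convergence (fun _ => Bu)
      (fun N => (huNc N).aestronglyMeasurable) (integrable_const _)
      (fun N => Eventually.of_forall fun x => ?_) (Eventually.of_forall fun x => ?_)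
    · rw [Real.norm_eq_abs, abs_of_nonneg (hu0 _)]
      exact hBu _
    · exact (hu.tendsto x).comp (tendsto_shiftBy_ext_proj hM x)
  have hvint : Integrable v (ν.map proj) := integrable_of_bdd hv hB
  have key : ∀ N : ℕ,
      (∀ n : ℕ, |∫ x, uN N x * v (proj (shiftBy ((l + n : ℕ) : ℤ) x)) ∂ν -
          (∫ x, uN N x ∂ν) * ∫ x, v (proj x) ∂ν| ≤ K * θ ^ n * B * ∫ x, uN N x ∂ν) ∧
        ((∀ z, 0 ≤ v z) → c * ((∫ x, uN N x ∂ν) * ∫ x, v (proj x) ∂ν) ≤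
          ∫ x, uN N x * v (proj (shiftBy ((l + p : ℕ) : ℤ) x)) ∂ν) := by
    intro N
    obtain ⟨w, hwc, hweq⟩ := exists_inCone_integral_eq hM hα hψm hψc hν hD.le hDα N l hu hu0 hul
    obtain ⟨hw1, hw2, hw3⟩ := hw w hwc
    have hmean : ∫ x, uN N x ∂ν = ∫ z, w z ∂(ν.map proj) := by
      simpa using hweq (fun _ => 1) continuous_const 0
    have hwb : ∀ n, ∃ b, ∀ z, |(transfer ψ)^[n] w z| ≤ b := by
      intro n
      refine ⟨K * θ ^ n * ∫ z, w z ∂(ν.map proj) + |∫ z, w z ∂(ν.map proj)|, fun z => ?_⟩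
      have h1 := hw3 n z
      have h2 := abs_sub_abs_le_abs_sub ((transfer ψ)^[n] w z) (∫ z, w z ∂(ν.map proj))
      linarith
    have hwint : ∀ n, Integrable (fun z => (transfer ψ)^[n] w z * v z) (ν.map proj) := by
      intro n
      obtain ⟨b, hb⟩ := hwb n
      exact integrable_of_bdd ((continuous_transfer_iterate hψc
        (hwc.continuous hα.le hα1) n).mul hv) (B := b * B) fun z => by
          rw [abs_mul]
          exact mul_le_mul (hb z) (hB z) (abs_nonneg _) ((abs_nonneg _).trans (hb z))
    have hw0 : 0 ≤ ∫ z, w z ∂(ν.map proj) := integral_nonneg hwc.nonneg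
    refine ⟨fun n => ?_, fun hv0 => ?_⟩
    · rw [hweq v hv n, hmean, ← integral_map_proj hv, ← integral_const_mul,
        ← integral_sub (hwint n) (hvint.const_mul _)]
      have h4 := norm_integral_le_of_norm_le_const (μ := ν.map proj)
        (f := fun z => (transfer ψ)^[n] w z * v z - (∫ z, w z ∂(ν.map proj)) * v z)
        (C := K * θ ^ n * B * ∫ z, w z ∂(ν.map proj)) (Eventually.of_forall fun z => ?_)
      · simpa using h4
      · rw [← sub_mul, Real.norm_eq_abs, abs_mul]
        refine (mul_le_mul (hw3 n z) (hB z) (abs_nonneg _) (by positivity)).trans_eq (by ring)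
    · rw [hweq v hv p, hmean, ← integral_map_proj hv, ← mul_assoc, ← integral_const_mul]
      exact integral_mono (hvint.const_mul _) (hwint p) fun z =>
        mul_le_mul_of_nonneg_right (hw2 z) (hv0 z)
  refine ⟨fun n => ?_, fun hv0 => ?_⟩
  · exact le_of_tendsto_of_tendsto' (((hlim _ (hvc _) fun x => hB _).sub
      (hlim1.mul_const _)).abs) (hlim1.const_mul _) fun N => (key N).1 n
  · exact le_of_tendsto_of_tendsto' ((hlim1.mul_const _).const_mul c)
      (hlim _ (hvc _) fun x => hB _) fun N => (key N).2 hv0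

/-- The correlations of a centred Hölder function with a nonnegative function `u` of the past up to
time `l` decay exponentially fast, relatively to the mean of `u`. -/
theorem exists_decorrelation (hM : IsIrreducibleTransition M) (hψ : IsHolderPlus ψ)
    (hψn : IsNormalized ψ) (hν : IsGibbsMeasure ψ ν) {f : TwoSided M → ℝ} (hf : IsHolder f)
    (hf0 : ∫ x, f x ∂ν = 0) :
    ∃ K β : ℝ, 0 < K ∧ 0 < β ∧ β < 1 ∧ ∀ (l n : ℕ) (u : TwoSided M → ℝ), Continuous u →
      (∀ x, 0 ≤ u x) → (∃ B, ∀ x, u x ≤ B) → DependsOnPast l u →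
      |∫ x, u x * f (shiftBy ((l + n : ℕ) : ℤ) x) ∂ν| ≤ K * β ^ n * ∫ x, u x ∂ν := by
  obtain ⟨c, K, θ, p, -, hK, hθ, hθ1, hmix⟩ := exists_mixing hM hψ hψn hν
  obtain ⟨C, α, hC, hα, hα1, hfm⟩ := hf.exists_modulus
  have hfc := hfm.continuous hα.le hα1
  obtain ⟨B, hB, hfB⟩ := hfm.exists_bound hC.le
  have := hν.isProbabilityMeasure
  set β₀ := max α θ with hβ₀
  have hβ₀0 : 0 < β₀ := hα.trans_le (le_max_left _ _)
  obtain ⟨K', β, hK', hβ, hβ1, -, hpow⟩ :=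
    exists_pow_div_le hβ₀0 (max_lt hα1 hθ1) (p := 2) (by norm_num)
  refine ⟨(2 * C + K * B) * K', β, by positivity, hβ₀0.trans_le hβ, hβ1,
    fun l n u hu hu0 hub hul => ?_⟩
  -- half of the gap is used to make `f` depend on the future only, the other half to mix
  set q := n / 2 with hq
  set v : OneSided M → ℝ := fun z => f (shiftBy q (ext hM z)) with hv
  have hvc : Continuous v := hfc.comp ((continuous_shiftBy _).comp (continuous_ext hM))
  have happrox : ∀ x : TwoSided M, |f (shiftBy q x) - v (proj x)| ≤ C * β₀ ^ q := by
    intro x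
    refine (hfm q _ _ fun i hi => ?_).trans (mul_le_mul_of_nonneg_left
      (pow_le_pow_left₀ hα.le (le_max_left _ _) _) hC.le)
    rw [abs_lt] at hi
    rw [shiftBy_apply, shiftBy_apply, ext_apply_of_nonneg hM (by omega)]
    refine congrArg x.1 ?_
    omega
  have hfi : Integrable (fun x => f (shiftBy q x)) ν :=
    integrable_of_bdd (hfc.comp (continuous_shiftBy _)) fun x => hfB _
  have hvi : Integrable (fun x => v (proj x)) ν :=
    integrable_of_bdd (hvc.comp continuous_proj) fun x => hfB _
  have hmean : |∫ x, v (proj x) ∂ν| ≤ C * β₀ ^ q := by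
    have h1 : ∫ x, f (shiftBy q x) - v (proj x) ∂ν = -∫ x, v (proj x) ∂ν := by
      rw [integral_sub hfi hvi, hν.integral_comp_shiftBy hfc, hf0, zero_sub]
    have h2 := norm_integral_le_of_norm_le_const (μ := ν)
      (f := fun x => f (shiftBy q x) - v (proj x)) (Eventually.of_forall happrox)
    rw [h1] at h2
    simpa using h2
  obtain ⟨Bu, hBu⟩ := hub
  have hui : Integrable u ν := integrable_of_bdd hu fun x => by
    rw [abs_of_nonneg (hu0 x)]
    exact hBu x
  have hu0' : 0 ≤ ∫ x, u x ∂ν := integral_nonneg hu0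
  have h1 := (hmix l u hu hu0 ⟨Bu, hBu⟩ hul v B hvc fun z => hfB _).1 (n - q)
  have hprod : ∀ F : TwoSided M → ℝ, Continuous F → (∀ x, |F x| ≤ B) →
      Integrable (fun x => u x * F x) ν := fun F hF hFB =>
    integrable_of_bdd (hu.mul hF) (B := Bu * B) fun x => by
      rw [abs_mul, abs_of_nonneg (hu0 _)]
      exact mul_le_mul (hBu _) (hFB x) (abs_nonneg _) ((hu0 x).trans (hBu x))
  have hi1 := hprod (fun x => f (shiftBy ((l + n : ℕ) : ℤ) x)) (hfc.comp (continuous_shiftBy _))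
    fun x => hfB _
  have hi2 := hprod (fun x => v (proj (shiftBy ((l + (n - q) : ℕ) : ℤ) x)))
    (hvc.comp (continuous_proj.comp (continuous_shiftBy _))) fun x => hfB _
  have h2 : |∫ x, u x * f (shiftBy ((l + n : ℕ) : ℤ) x) ∂ν -
      ∫ x, u x * v (proj (shiftBy ((l + (n - q) : ℕ) : ℤ) x)) ∂ν| ≤ C * β₀ ^ q * ∫ x, u x ∂ν := by
    rw [← integral_sub hi1 hi2, ← integral_const_mul]
    refine (abs_integral_le_integral_abs).trans
      (integral_mono (hi1.sub hi2).abs (hui.const_mul _) fun x => ?_)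
    change |_ - _| ≤ C * β₀ ^ q * u x
    rw [← mul_sub, abs_mul, abs_of_nonneg (hu0 x), mul_comm]
    refine mul_le_mul_of_nonneg_right ?_ (hu0 x)
    have h3 := happrox (shiftBy ((l + (n - q) : ℕ) : ℤ) x)
    rwa [shiftBy_shiftBy, show (q : ℤ) + ((l + (n - q) : ℕ) : ℤ) = ((l + n : ℕ) : ℤ) by omega] at h3
  have hpq : θ ^ (n - q) ≤ β₀ ^ q :=
    (pow_le_pow_left₀ hθ.le (le_max_right _ _) _).trans
      (pow_le_pow_of_le_one hβ₀0.le (max_lt hα1 hθ1).le (by omega))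
  have h3 : |(∫ x, u x ∂ν) * ∫ x, v (proj x) ∂ν| ≤ C * β₀ ^ q * ∫ x, u x ∂ν := by
    rw [abs_mul, abs_of_nonneg hu0', mul_comm]
    exact mul_le_mul_of_nonneg_right hmean hu0'
  have h4 : K * θ ^ (n - q) * B * ∫ x, u x ∂ν ≤ K * B * β₀ ^ q * ∫ x, u x ∂ν := by
    refine mul_le_mul_of_nonneg_right ?_ hu0'
    nlinarith [mul_le_mul_of_nonneg_left hpq (mul_pos hK hB).le]
  calc |∫ x, u x * f (shiftBy ((l + n : ℕ) : ℤ) x) ∂ν|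
      ≤ (2 * C + K * B) * β₀ ^ q * ∫ x, u x ∂ν := by
        rw [abs_le] at *
        constructor <;> linarith
    _ ≤ (2 * C + K * B) * (K' * β ^ n) * ∫ x, u x ∂ν :=
        mul_le_mul_of_nonneg_right (mul_le_mul_of_nonneg_left (hpow n) (by positivity)) hu0'
    _ = _ := by ring

/-- The Gibbs measure charges every cylinder. -/
theorem integral_cylinder_pos (hM : IsIrreducibleTransition M) (hψ : IsHolderPlus ψ)
    (hψn : IsNormalized ψ) (hν : IsGibbsMeasure ψ ν) (m : ℕ) {v : OneSided M → ℝ}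
    (hv : Continuous v) (hv0 : ∀ z, 0 ≤ v z)
    (hvm : ∀ z z' : OneSided M, (∀ i < m, z.1 i = z'.1 i) → v z = v z')
    {z₀ : OneSided M} (hz₀ : 0 < v z₀) : 0 < ∫ x, v (proj x) ∂ν := by
  obtain ⟨C, α, hC, hα, hα1, hψm⟩ := hψ.exists_modulus
  have hψc := hψm.continuous hα.le hα1
  obtain ⟨B, -, hB⟩ := hψm.exists_bound hC.le
  obtain ⟨D, c, K, θ, p, hD, hDα, hc, hK, hθ, hθ1, hw⟩ :=
    exists_cone_contraction hM hC hα hα1 hψm hψn hν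
  have hcone : InCone D α (m + 1) v := ⟨hv0, fun n hn z z' h => by
    rw [hvm z z' fun i hi => h i (by omega)]
    exact le_mul_of_one_le_left (hv0 _) (Real.one_le_exp (by positivity))⟩
  have h1 := (hw _ (InCone.transfer_iterate hα.le hDα hψm le_rfl m hcone)).1 (shiftPlus^[m] z₀)
  rw [hν.integral_transfer_iterate hψc hv, integral_map_proj hv] at h1
  refine lt_of_lt_of_le ?_ h1
  have h2 := le_transfer_iterate_shiftPlus hB m z₀ hv0
  have : 0 < Real.exp (-B) ^ m * v z₀ := by positivity
  exact mul_pos hc (this.trans_le h2)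

end Mixing

/-! ### Functions with Birkhoff sums bounded from below -/

section Coboundary

variable {ψ : OneSided M → ℝ} {ν : Measure (TwoSided M)}

open Classical in
/-- The indicator function of the cylinder of the sequences that start with `a_0 … a_{m-1}`. -/
def cylinder (a : ℕ → Fin k) (m : ℕ) (z : OneSided M) : ℝ :=
  if ∀ i < m, z.1 i = a i then 1 else 0

lemma cylinder_nonneg (a : ℕ → Fin k) (m : ℕ) (z : OneSided M) : 0 ≤ cylinder a m z := by
  unfold cylinder
  split_ifs <;> norm_num

lemma cylinder_le_one (a : ℕ → Fin k) (m : ℕ) (z : OneSided M) : cylinder a m z ≤ 1 := by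
  unfold cylinder
  split_ifs <;> norm_num

lemma agree_of_cylinder_ne_zero {a : ℕ → Fin k} {m : ℕ} {z : OneSided M}
    (h : cylinder a m z ≠ 0) : ∀ i < m, z.1 i = a i := by
  unfold cylinder at h
  split_ifs at h with h'
  · exact h'
  · exact absurd rfl h

lemma cylinder_congr (a : ℕ → Fin k) (m : ℕ) {z z' : OneSided M}
    (h : ∀ i < m, z.1 i = z'.1 i) : cylinder a m z = cylinder a m z' := by
  have : (∀ i < m, z.1 i = a i) ↔ ∀ i < m, z'.1 i = a i :=
    forall₂_congr fun i hi => by rw [h i hi]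
  simp only [cylinder, this]

lemma continuous_cylinder (a : ℕ → Fin k) (m : ℕ) : Continuous (cylinder (M := M) a m) := by
  refine continuous_iff_continuousAt.mpr fun z => tendsto_nhds_of_eventually_eq ?_
  filter_upwards [eventually_agreePlus z m] with y hy
  exact cylinder_congr a m fun i hi => (hy i hi).symm

lemma integral_cylinder_proj_pos (hM : IsIrreducibleTransition M) (hψ : IsHolderPlus ψ)
    (hψn : IsNormalized ψ) (hν : IsGibbsMeasure ψ ν) (m : ℕ) (z : OneSided M) :
    0 < ∫ x, cylinder z.1 m (proj x) ∂ν :=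
  integral_cylinder_pos hM hψ hψn hν m (continuous_cylinder _ _) (cylinder_nonneg _ _)
    (fun _ _ h => cylinder_congr _ _ h) (z₀ := z) (by simp [cylinder])

/-- A nonnegative Hölder function with zero mean vanishes, as the Gibbs measure has full support. -/
lemma eq_zero_of_integral_eq_zero (hM : IsIrreducibleTransition M) (hψ : IsHolderPlus ψ)
    (hψn : IsNormalized ψ) (hν : IsGibbsMeasure ψ ν) {C α : ℝ} (hC : 0 ≤ C) (hα : 0 ≤ α)
    (hα1 : α < 1) {φ : TwoSided M → ℝ} (hφ : HasModulus C α φ) (hφ0 : ∀ x, 0 ≤ φ x)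
    (hint : ∫ x, φ x ∂ν = 0) (x : TwoSided M) : φ x = 0 := by
  have := hν.isProbabilityMeasure
  by_contra hne
  have hpos : 0 < φ x := lt_of_le_of_ne (hφ0 x) (Ne.symm hne)
  have hφc := hφ.continuous hα hα1
  obtain ⟨B, -, hB⟩ := hφ.exists_bound hC
  have h0 : Tendsto (fun n : ℕ => C * α ^ n) atTop (𝓝 0) := by
    simpa using (tendsto_pow_atTop_nhds_zero_of_lt_one hα hα1).const_mul C
  obtain ⟨N, hN⟩ := (h0.eventually (gt_mem_nhds (half_pos hpos))).exists
  set z : OneSided M := proj (shiftBy (-N) x) with hz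
  have hle : ∀ y, φ x / 2 * cylinder z.1 (2 * N) (proj y) ≤ φ (shiftBy N y) := by
    intro y
    by_cases hy : cylinder z.1 (2 * N) (proj y) = 0
    · rw [hy, mul_zero]
      exact hφ0 _
    · have h1 := hφ N x (shiftBy N y) fun i hi => by
        rw [abs_lt] at hi
        have h2 := agree_of_cylinder_ne_zero hy (i + N).toNat (by omega)
        simp only [hz, proj, shiftBy_apply] at h2
        rw [Int.toNat_of_nonneg (by omega)] at h2
        rw [shiftBy_apply, h2, add_neg_cancel_right]
      have h3 := (abs_le.mp h1).2
      have h4 := cylinder_le_one z.1 (2 * N) (proj y)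
      nlinarith
  have h5 := integral_cylinder_proj_pos hM hψ hψn hν (2 * N) z
  have h6 : ∫ y, φ x / 2 * cylinder z.1 (2 * N) (proj y) ∂ν ≤ ∫ y, φ (shiftBy N y) ∂ν :=
    integral_mono ((integrable_of_bdd ((continuous_cylinder _ _).comp continuous_proj) (B := 1)
      fun y => by
        rw [Function.comp, abs_of_nonneg (cylinder_nonneg _ _ _)]
        exact cylinder_le_one _ _ _).const_mul _)
      (integrable_of_bdd (hφc.comp (continuous_shiftBy _)) fun y => hB _) hle
  rw [integral_const_mul, hν.integral_comp_shiftBy hφc, hint] at h6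
  have := mul_pos (half_pos hpos) h5
  linarith

/-- The sequence with the past of `x` and the future of `y`, when `x_0 = y_0`. -/
def glue (x y : TwoSided M) (h : x.1 0 = y.1 0) : TwoSided M :=
  ⟨fun i => if i < 0 then x.1 i else y.1 i, fun i => by
    rcases lt_trichotomy i (-1) with hi | hi | hi
    · exact admissible_congr (if_pos (by omega)) (if_pos (by omega)) (x.2 i)
    · subst hi
      exact admissible_congr (if_pos (by omega))
        ((if_neg (by omega : ¬ (-1 : ℤ) + 1 < 0)).trans h.symm) (x.2 (-1))
    · exact admissible_congr (if_neg (by omega)) (if_neg (by omega)) (y.2 i)⟩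

lemma glue_of_nonneg {x y : TwoSided M} (h : x.1 0 = y.1 0) {i : ℤ} (hi : 0 ≤ i) :
    (glue x y h).1 i = y.1 i := if_neg (by omega)

lemma glue_of_nonpos {x y : TwoSided M} (h : x.1 0 = y.1 0) {i : ℤ} (hi : i ≤ 0) :
    (glue x y h).1 i = x.1 i := by
  rcases hi.eq_or_lt with rfl | hi
  · rw [glue_of_nonneg h le_rfl, h]
  · exact if_pos hi

/-- For `y` with the same future as `x`, the Birkhoff sum of `f` along the `n` steps that lead
to `y`, corrected so as to compare the future orbits of `y` and `x`. -/
def pastSum (f : TwoSided M → ℝ) (n : ℕ) (y x : TwoSided M) : ℝ :=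
  S n f (shiftBy (-n) y) + ∑' i : ℕ, (f (shiftBy i y) - f (shiftBy i x))

/-- The infimum of `pastSum f n y x` over `n` and over the points `y` with the same future as `x`.
When it is finite it is a Hölder sub-action: `f - (g ∘ T - g) ≥ 0` for this function `g`. -/
def subAction (f : TwoSided M → ℝ) (x : TwoSided M) : ℝ :=
  sInf {r | ∃ (n : ℕ) (y : TwoSided M), (∀ i : ℤ, 0 ≤ i → y.1 i = x.1 i) ∧ r = pastSum f n y x}

lemma HasModulus.abs_sub_le_of_future {C α : ℝ} {f : TwoSided M → ℝ} (hf : HasModulus C α f)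
    {x y : TwoSided M} (h : ∀ i : ℤ, 0 ≤ i → y.1 i = x.1 i) (i : ℕ) :
    |f (shiftBy i y) - f (shiftBy i x)| ≤ C * α ^ i :=
  hf i _ _ fun j hj => by
    rw [abs_lt] at hj
    exact h _ (by omega)

lemma HasModulus.summable_of_future {C α : ℝ} (hα : 0 ≤ α) (hα1 : α < 1)
    {f : TwoSided M → ℝ} (hf : HasModulus C α f) {x y : TwoSided M}
    (h : ∀ i : ℤ, 0 ≤ i → y.1 i = x.1 i) :
    Summable fun i : ℕ => f (shiftBy i y) - f (shiftBy i x) :=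
  Summable.of_norm_bounded ((summable_geometric_of_lt_one hα hα1).mul_left C)
    (hf.abs_sub_le_of_future h)

lemma HasModulus.le_pastSum {C α K : ℝ} (hα : 0 ≤ α) (hα1 : α < 1)
    {f : TwoSided M → ℝ} (hf : HasModulus C α f) (hK : ∀ n x, -K ≤ S n f x) {x y : TwoSided M}
    (h : ∀ i : ℤ, 0 ≤ i → y.1 i = x.1 i) (n : ℕ) : -(K + C / (1 - α)) ≤ pastSum f n y x := by
  have h1 := tsum_of_norm_bounded (f := fun i : ℕ => f (shiftBy i y) - f (shiftBy i x))
    ((hasSum_geometric_of_lt_one hα hα1).mul_left C) (hf.abs_sub_le_of_future h)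
  rw [Real.norm_eq_abs, abs_le, ← div_eq_mul_inv] at h1
  have h2 := hK n (shiftBy (-n) y)
  unfold pastSum
  linarith

/-- The comparison of `pastSum` at two nearby points `x` and `x'`: the same past is used for both, and
the differences along the future are split at half of the separation time. -/
lemma HasModulus.pastSum_glue_le {C α γ : ℝ} (hC : 0 ≤ C) (hα : 0 < α) (hα1 : α < 1)
    (hγ : α ≤ γ) (hγ1 : γ < 1) (hαγ : α ≤ γ ^ 3) {f : TwoSided M → ℝ} (hf : HasModulus C α f)
    {x x' y : TwoSided M} (h : ∀ i : ℤ, 0 ≤ i → y.1 i = x.1 i) {N : ℕ}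
    (hN : ∀ i : ℤ, |i| < N → x.1 i = x'.1 i) (h0 : y.1 0 = x'.1 0) (n : ℕ) :
    pastSum f n (glue y x' h0) x' ≤
      pastSum f n y x + (C / (1 - α) + 2 * C / (1 - γ)) * γ ^ N := by
  have hγ0 : 0 < γ := hα.trans_le hγ
  set y' := glue y x' h0 with hy'
  have hyy' : ∀ i : ℤ, i < N → y'.1 i = y.1 i := by
    intro i hi
    rcases le_total i 0 with h1 | h1
    · exact glue_of_nonpos h0 h1
    · rw [hy', glue_of_nonneg h0 h1, h i h1]
      exact (hN i (by rwa [abs_of_nonneg h1])).symm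
  have hy'x' : ∀ i : ℤ, 0 ≤ i → y'.1 i = x'.1 i := fun i hi => glue_of_nonneg h0 hi
  have h1 : S n f (shiftBy (-n) y') - S n f (shiftBy (-n) y) ≤ C / (1 - α) * γ ^ N := by
    refine (le_abs_self _).trans ((hf.abs_S_sub_S_le hC hα.le hα1 (q := N) fun i hi => ?_).trans
      (mul_le_mul_of_nonneg_left (pow_le_pow_left₀ hα.le hγ N)
        (div_nonneg hC (by linarith))))
    exact hyy' _ (by omega)
  -- the `i`-th difference is controlled both by `α ^ i` and by `α ^ (N - i)`
  have hterm : ∀ i : ℕ, ‖(f (shiftBy i y') - f (shiftBy i x')) -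
      (f (shiftBy i y) - f (shiftBy i x))‖ ≤ 2 * C * γ ^ N * γ ^ i := by
    intro i
    have ha := hf.abs_sub_le_of_future h i
    have hb := hf.abs_sub_le_of_future hy'x' i
    have hc : |f (shiftBy i y') - f (shiftBy i y)| ≤ C * α ^ (N - i) :=
      hf _ _ _ fun j hj => by
        rw [abs_lt] at hj
        exact hyy' _ (by omega)
    have hd : |f (shiftBy i x) - f (shiftBy i x')| ≤ C * α ^ (N - i) :=
      hf _ _ _ fun j hj => by
        refine hN _ ?_
        rw [abs_lt] at hj ⊢
        omega
    have hmax : α ^ max i (N - i) ≤ γ ^ N * γ ^ i := by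
      calc α ^ max i (N - i) ≤ (γ ^ 3) ^ max i (N - i) := pow_le_pow_left₀ hα.le hαγ _
        _ = γ ^ (3 * max i (N - i)) := (pow_mul _ _ _).symm
        _ ≤ γ ^ (N + i) := pow_le_pow_of_le_one hγ0.le hγ1.le (by omega)
        _ = γ ^ N * γ ^ i := pow_add _ _ _
    have hle : |(f (shiftBy i y') - f (shiftBy i x')) - (f (shiftBy i y) - f (shiftBy i x))| ≤
        2 * C * α ^ max i (N - i) := by
      rw [abs_le] at *
      rcases max_choice i (N - i) with h' | h' <;> rw [h'] <;> constructor <;> linarith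
    rw [Real.norm_eq_abs]
    refine hle.trans ?_
    rw [mul_assoc (2 * C)]
    exact mul_le_mul_of_nonneg_left hmax (by positivity)
  have h2 := tsum_of_norm_bounded
    ((hasSum_geometric_of_lt_one hγ0.le hγ1).mul_left (2 * C * γ ^ N)) hterm
  rw [(hf.summable_of_future hα.le hα1 hy'x').tsum_sub (hf.summable_of_future hα.le hα1 h)] at h2
  have h3 := (le_abs_self _).trans h2
  have h4 : (C / (1 - α) + 2 * C / (1 - γ)) * γ ^ N =
    C / (1 - α) * γ ^ N + 2 * C * γ ^ N * (1 - γ)⁻¹ := by ring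
  unfold pastSum
  rw [h4]
  linarith

/-- If the Birkhoff sums of a centred Hölder function are bounded from below, then it is a
coboundary. -/
theorem isCoboundary_of_le_S (hM : IsIrreducibleTransition M) (hψ : IsHolderPlus ψ)
    (hψn : IsNormalized ψ) (hν : IsGibbsMeasure ψ ν) {f : TwoSided M → ℝ} (hf : IsHolder f)
    (hf0 : ∫ x, f x ∂ν = 0) {K : ℝ} (hK : ∀ n x, -K ≤ S n f x) : IsCoboundary f := by
  have := hν.isProbabilityMeasure
  obtain ⟨C, α, hC, hα, hα1, hfm⟩ := hf.exists_modulus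
  obtain ⟨-, γ, -, hγ, hγ1, hαγ, -⟩ := exists_pow_div_le hα hα1 (p := 3) (by norm_num)
  have hγ0 : 0 < γ := hα.trans_le hγ
  have h1α : 0 < 1 - α := by linarith
  have h1γ : 0 < 1 - γ := by linarith
  set g := subAction f with hg
  have hbdd : ∀ x, BddBelow {r | ∃ (n : ℕ) (y : TwoSided M),
      (∀ i : ℤ, 0 ≤ i → y.1 i = x.1 i) ∧ r = pastSum f n y x} := fun x =>
    ⟨-(K + C / (1 - α)), by
      rintro r ⟨n, y, hy, rfl⟩
      exact hfm.le_pastSum hα.le hα1 hK hy n⟩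
  have hne : ∀ x, {r | ∃ (n : ℕ) (y : TwoSided M),
      (∀ i : ℤ, 0 ≤ i → y.1 i = x.1 i) ∧ r = pastSum f n y x}.Nonempty := fun x =>
    ⟨_, 0, x, fun _ _ => rfl, rfl⟩
  have hg_le : ∀ (n : ℕ) (x y : TwoSided M), (∀ i : ℤ, 0 ≤ i → y.1 i = x.1 i) →
      g x ≤ pastSum f n y x := fun n x y hy => csInf_le (hbdd x) ⟨n, y, hy, rfl⟩
  have hle_g : ∀ (x : TwoSided M) (b : ℝ), (∀ (n : ℕ) (y : TwoSided M),
      (∀ i : ℤ, 0 ≤ i → y.1 i = x.1 i) → b ≤ pastSum f n y x) → b ≤ g x := fun x b hb =>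
    le_csInf (hne x) (by
      rintro r ⟨n, y, hy, rfl⟩
      exact hb n y hy)
  have hg_nonpos : ∀ x, g x ≤ 0 := fun x => by
    simpa [pastSum] using hg_le 0 x x fun _ _ => rfl
  have hK0 : 0 ≤ K := by
    obtain ⟨x⟩ := ν.nonempty_of_neZero
    simpa using hK 0 x
  set E : ℝ := K + C / (1 - α) + 2 * C / (1 - γ) with hE
  have hE0 : 0 < E := by positivity
  have hone : ∀ (N : ℕ) (x x' : TwoSided M), (∀ i : ℤ, |i| < N → x.1 i = x'.1 i) →
      g x' - g x ≤ E * γ ^ N := by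
    intro N x x' hN
    rcases Nat.eq_zero_or_pos N with rfl | hNpos
    · have h1 := hle_g x _ fun n y hy => hfm.le_pastSum hα.le hα1 hK hy n
      have h2 := hg_nonpos x'
      have h3 : 0 < 2 * C / (1 - γ) := by positivity
      rw [pow_zero, mul_one]
      linarith
    · have h1 : g x' - (C / (1 - α) + 2 * C / (1 - γ)) * γ ^ N ≤ g x := by
        refine hle_g x _ fun n y hy => ?_
        have h0 : y.1 0 = x'.1 0 := (hy 0 le_rfl).trans (hN 0 (by simpa using hNpos))
        have h2 := hfm.pastSum_glue_le hC.le hα hα1 hγ hγ1 hαγ hy hN h0 n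
        have h3 := hg_le n x' (glue y x' h0) fun i hi => glue_of_nonneg h0 hi
        linarith
      have h4 : 0 ≤ K * γ ^ N := by positivity
      rw [hE]
      linarith
  have hgm : HasModulus E γ g := fun N x x' hN => abs_le.mpr
    ⟨by linarith [hone N x x' hN], by linarith [hone N x' x fun i hi => (hN i hi).symm]⟩
  -- a competitor for `x` gives a competitor for `T x`, with one more step in the past
  have hsub : ∀ x, 0 ≤ f x - (g (shift x) - g x) := by
    intro x
    have h1 : g (shift x) - f x ≤ g x := by
      refine hle_g x _ fun n y hy => ?_
      have h2 := hg_le (n + 1) (shift x) (shift y) fun i hi => hy (i + 1) (by omega)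
      have h3 : pastSum f (n + 1) (shift y) (shift x) = pastSum f n y x + f x := by
        unfold pastSum
        rw [(hfm.summable_of_future hα.le hα1 hy).tsum_eq_zero_add, shift_eq_shiftBy,
          shift_eq_shiftBy, shiftBy_shiftBy, S_succ, shiftBy_shiftBy]
        simp only [shiftBy_shiftBy]
        have e1 : (-((n + 1 : ℕ) : ℤ) + 1) = -n := by push_cast; ring
        have e2 : ((n : ℤ) + (-((n + 1 : ℕ) : ℤ) + 1)) = 0 := by push_cast; ring
        rw [e2, e1]
        push_cast
        simp only [shiftBy_zero]
        ring
      linarith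
    linarith
  have hgc := hgm.continuous hγ0.le hγ1
  have hfc := hfm.continuous hα.le hα1
  obtain ⟨Bg, -, hBg⟩ := hgm.exists_bound hE0.le
  obtain ⟨Bf, -, hBf⟩ := hfm.exists_bound hC.le
  have hgi : Integrable g ν := integrable_of_bdd hgc hBg
  have hgsi : Integrable (fun x => g (shift x)) ν :=
    integrable_of_bdd (hgc.comp (continuous_shiftBy 1)) fun x => hBg _
  have hfi : Integrable f ν := integrable_of_bdd hfc hBf
  have hzero : ∫ x, (f x - (g (shift x) - g x)) ∂ν = 0 := by
    have h1 : ∫ x, g (shift x) ∂ν = ∫ x, g x ∂ν := hν.integral_comp_shiftBy hgc 1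
    rw [integral_sub (g := fun x => g (shift x) - g x) hfi (hgsi.sub hgi),
      integral_sub hgsi hgi, h1, hf0]
    ring
  have hdiff : HasModulus (C + E / γ + E) γ fun x => f x - (g (shift x) - g x) := by
    intro N x x' hN
    have h1 := (hfm.mono hC.le hα.le hγ) N x x' hN
    have h2 := hgm N x x' hN
    have h3 : |g (shift x) - g (shift x')| ≤ E * γ ^ (N - 1) := hgm _ _ _ fun i hi => by
      rw [abs_lt] at hi
      exact hN _ (by rw [abs_lt]; omega)
    have h4 : γ ^ (N - 1) ≤ γ ^ N / γ := by
      rw [le_div_iff₀ hγ0, ← pow_succ]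
      exact pow_le_pow_of_le_one hγ0.le hγ1.le (by omega)
    have h5 : E * γ ^ (N - 1) ≤ E / γ * γ ^ N := by
      calc E * γ ^ (N - 1) ≤ E * (γ ^ N / γ) := mul_le_mul_of_nonneg_left h4 hE0.le
        _ = E / γ * γ ^ N := by ring
    rw [abs_le] at *
    constructor <;> linarith
  refine ⟨g, hgm.isHolder hE0 hγ0 hγ1, fun x => ?_⟩
  have := eq_zero_of_integral_eq_zero hM hψ hψn hν (by positivity) hγ0.le hγ1 hdiff hsub hzero x
  linarith

/-- A centred Hölder function that is not a coboundary has arbitrarily negative Birkhoff sums. -/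
lemma exists_S_lt (hM : IsIrreducibleTransition M) (hψ : IsHolderPlus ψ)
    (hψn : IsNormalized ψ) (hν : IsGibbsMeasure ψ ν) {f : TwoSided M → ℝ} (hf : IsHolder f)
    (hf0 : ∫ x, f x ∂ν = 0) (hcob : ¬ IsCoboundary f) (K : ℝ) : ∃ n x, S n f x < -K := by
  by_contra! h
  exact hcob (isCoboundary_of_le_S hM hψ hψn hν hf hf0 h)

end Coboundary

/-! ### Visits of the walk to the bottom of its range -/

section Visits

variable {ψ : OneSided M → ℝ} {ν : Measure (TwoSided M)}

/-- A continuous function with values in `[0, 1]`, equal to `1` on `[0, ∞)` and to `0` on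
`(-∞, -1]`. -/
def ramp (r : ℝ) : ℝ := max 0 (min 1 (r + 1))

lemma continuous_ramp : Continuous ramp := by unfold ramp; fun_prop

lemma ramp_nonneg (r : ℝ) : 0 ≤ ramp r := le_max_left _ _

lemma ramp_le_one (r : ℝ) : ramp r ≤ 1 := max_le zero_le_one (min_le_left _ _)

lemma ramp_eq_one {r : ℝ} (hr : 0 ≤ r) : ramp r = 1 := by
  rw [ramp, min_eq_left (by linarith), max_eq_right zero_le_one]

lemma neg_one_lt_of_ramp_ne_zero {r : ℝ} (hr : ramp r ≠ 0) : -1 < r := by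
  by_contra! h
  exact hr (max_eq_left (min_le_of_right_le (by linarith)))

/-- A continuous version, depending on the past up to time `l` only, of the indicator function of
the event that the walk `S_j f` stays above `-t` up to time `l` and is below `-s` at time `l`. -/
def visit (hM : IsIrreducibleTransition M) (f : TwoSided M → ℝ) (s t : ℝ) (l : ℕ)
    (x : TwoSided M) : ℝ :=
  ramp (-S l f (trunc hM l x) - s) *
    ∏ i ∈ Finset.range l, ramp (S (i + 1) f (trunc hM l x) + t)

lemma continuous_visit (hM : IsIrreducibleTransition M) {f : TwoSided M → ℝ} (hf : Continuous f)
    (s t : ℝ) (l : ℕ) : Continuous (visit hM f s t l) := by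
  have h : ∀ i, Continuous fun x => S i f (trunc hM l x) := fun i =>
    (continuous_S i hf).comp (continuous_trunc hM l)
  exact (continuous_ramp.comp ((h l).neg.sub continuous_const)).mul
    (continuous_finsetProd _ fun i _ => continuous_ramp.comp ((h (i + 1)).add continuous_const))

lemma visit_nonneg (hM : IsIrreducibleTransition M) (f : TwoSided M → ℝ) (s t : ℝ) (l : ℕ)
    (x : TwoSided M) : 0 ≤ visit hM f s t l x :=
  mul_nonneg (ramp_nonneg _) (Finset.prod_nonneg fun _ _ => ramp_nonneg _)

lemma visit_le_one (hM : IsIrreducibleTransition M) (f : TwoSided M → ℝ) (s t : ℝ) (l : ℕ)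
    (x : TwoSided M) : visit hM f s t l x ≤ 1 :=
  mul_le_one₀ (ramp_le_one _) (Finset.prod_nonneg fun _ _ => ramp_nonneg _)
    (Finset.prod_le_one (fun _ _ => ramp_nonneg _) fun _ _ => ramp_le_one _)

lemma dependsOnPast_visit (hM : IsIrreducibleTransition M) (f : TwoSided M → ℝ) (s t : ℝ) (l : ℕ) :
    DependsOnPast l (visit hM f s t l) := fun x y h => by
  simp only [visit, trunc_congr hM h]

lemma visit_eq_one (hM : IsIrreducibleTransition M) {f : TwoSided M → ℝ} {s t : ℝ} {l : ℕ}
    {x : TwoSided M} (h1 : S l f (trunc hM l x) ≤ -s)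
    (h2 : ∀ i, 1 ≤ i → i ≤ l → -t ≤ S i f (trunc hM l x)) : visit hM f s t l x = 1 := by
  rw [visit, ramp_eq_one (by linarith), one_mul]
  refine Finset.prod_eq_one fun i hi => ramp_eq_one ?_
  rw [Finset.mem_range] at hi
  linarith [h2 (i + 1) (by omega) (by omega)]

lemma lt_of_visit_ne_zero (hM : IsIrreducibleTransition M) {f : TwoSided M → ℝ} {s t : ℝ} {l : ℕ}
    {x : TwoSided M} (h : visit hM f s t l x ≠ 0) : S l f (trunc hM l x) < -s + 1 ∧
      ∀ i, 1 ≤ i → i ≤ l → -t - 1 < S i f (trunc hM l x) := by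
  refine ⟨?_, fun i h1 hi => ?_⟩
  · linarith [neg_one_lt_of_ramp_ne_zero (left_ne_zero_of_mul h)]
  · obtain ⟨j, rfl⟩ : ∃ j, i = j + 1 := ⟨i - 1, by omega⟩
    have := Finset.prod_ne_zero_iff.mp (right_ne_zero_of_mul h) j (Finset.mem_range.mpr (by omega))
    linarith [neg_one_lt_of_ramp_ne_zero this]

/-- A sum of terms at most `1`, the nonzero ones having indices in an interval of length `q`. -/
lemma sum_le_of_separated {a : ℕ → ℝ} (ha : ∀ l, a l ≤ 1) {q : ℕ}
    (hsep : ∀ l l', a l ≠ 0 → a l' ≠ 0 → l' < l + q) (n : ℕ) :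
    ∑ l ∈ Finset.range n, a l ≤ q := by
  rw [← Finset.sum_filter_ne_zero]
  set A := (Finset.range n).filter fun l => a l ≠ 0 with hA
  have h1 : ∑ l ∈ A, a l ≤ A.card := by
    simpa using Finset.sum_le_card_nsmul A a 1 fun l _ => ha l
  refine h1.trans (Nat.cast_le.mpr ?_)
  rcases A.eq_empty_or_nonempty with h | h
  · simp [h]
  · have hmin := (Finset.mem_filter.mp (A.min'_mem h)).2
    have hsub : A ⊆ Finset.Ico (A.min' h) (A.min' h + q) := fun l hl =>
      Finset.mem_Ico.mpr ⟨A.min'_le l hl, hsep _ _ hmin (Finset.mem_filter.mp hl).2⟩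
    simpa using Finset.card_le_card hsub

/-- The expected number of visits of the walk to a window of bounded width situated at the bottom
of its range is bounded, whatever the level of the window: at each visit, and whatever the past,
the walk has a probability bounded below to fall below the window within a bounded time. -/
theorem exists_sum_integral_visit_le (hM : IsIrreducibleTransition M) (hψ : IsHolderPlus ψ)
    (hψn : IsNormalized ψ) (hν : IsGibbsMeasure ψ ν) {f : TwoSided M → ℝ} (hf : IsHolder f)
    (hf0 : ∫ x, f x ∂ν = 0) (hcob : ¬ IsCoboundary f) (W : ℝ) :
    ∃ C : ℝ, 0 < C ∧ ∀ s t : ℝ, t - s ≤ W → ∀ n : ℕ,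
      ∑ l ∈ Finset.range n, ∫ x, visit hM f s t l x ∂ν ≤ C := by
  obtain ⟨c, _, _, p, hc, _, _, _, hmix⟩ := exists_mixing hM hψ hψn hν
  obtain ⟨C, α, hC, hα, hα1, hfm⟩ := hf.exists_modulus
  have hfc := hfm.continuous hα.le hα1
  obtain ⟨B, hB, hfB⟩ := hfm.exists_bound hC.le
  have := hν.isProbabilityMeasure
  set H := C / (1 - α) with hH
  -- a fall that exceeds the width of the window, the errors due to `trunc`, and the largest possible
  -- rise during the `p` steps needed to reach the cylinder of `x₀`
  obtain ⟨m, x₀, hx₀⟩ := exists_S_lt hM hψ hψn hν hf hf0 hcob (p * B + 2 * H + (|W| + 2 + 2 * H))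
  have hH0 : 0 ≤ H := div_nonneg hC.le (by linarith)
  have hm : 0 < m := by
    by_contra! h0
    obtain rfl : m = 0 := by omega
    rw [S_zero] at hx₀
    have : 0 ≤ p * B + 2 * H + (|W| + 2 + 2 * H) := by positivity
    linarith
  set v := cylinder (M := M) (proj x₀).1 m with hv
  have hvpos : 0 < ∫ x, v (proj x) ∂ν := integral_cylinder_proj_pos hM hψ hψn hν m _
  have hvc : Continuous v := continuous_cylinder _ _
  have hv1 : ∀ z, |v z| ≤ 1 := fun z => by
    rw [abs_of_nonneg (cylinder_nonneg _ _ _)]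
    exact cylinder_le_one _ _ _
  have hSp : ∀ (n : ℕ) (x : TwoSided M), S n f x ≤ n * B := fun n x => by
    rw [S_eq_sum]
    have := Finset.sum_le_card_nsmul (Finset.range n) (fun i : ℕ => f (shiftBy i x)) B
      fun i _ => (abs_le.mp (hfB _)).2
    simpa using this
  set c' := c * ∫ x, v (proj x) ∂ν with hc'
  have hc'0 : 0 < c' := mul_pos hc hvpos
  refine ⟨(p + m : ℕ) / c' + 1, by positivity, fun s t hst n => ?_⟩
  have hstep : ∀ l : ℕ, c' * ∫ x, visit hM f s t l x ∂ν ≤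
      ∫ x, visit hM f s t l x * v (proj (shiftBy ((l + p : ℕ) : ℤ) x)) ∂ν := by
    intro l
    have := (hmix l _ (continuous_visit hM hfc s t l) (visit_nonneg hM f s t l)
      ⟨1, visit_le_one hM f s t l⟩ (dependsOnPast_visit hM f s t l) v 1 hvc hv1).2
      (cylinder_nonneg _ _)
    refine le_trans (le_of_eq ?_) this
    rw [hc']
    ring
  have hint : ∀ l : ℕ, Integrable
      (fun x => visit hM f s t l x * v (proj (shiftBy ((l + p : ℕ) : ℤ) x))) ν := fun l =>
    integrable_of_bdd ((continuous_visit hM hfc s t l).mul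
      (hvc.comp (continuous_proj.comp (continuous_shiftBy _)))) (B := 1 * 1) fun x => by
        rw [abs_mul, abs_of_nonneg (visit_nonneg hM f s t l x)]
        exact mul_le_mul (visit_le_one hM f s t l x) (hv1 _) (abs_nonneg _) zero_le_one
  have hpoint : ∀ x, ∑ l ∈ Finset.range n,
      visit hM f s t l x * v (proj (shiftBy ((l + p : ℕ) : ℤ) x)) ≤ (p + m : ℕ) := by
    intro x
    refine sum_le_of_separated (fun l => ?_) (fun l l' hl hl' => ?_) n
    · exact mul_le_one₀ (visit_le_one hM f s t l x) (cylinder_nonneg _ _ _)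
        (cylinder_le_one _ _ _)
    · by_contra! hll'
      have h1 := (lt_of_visit_ne_zero hM (left_ne_zero_of_mul hl)).1
      have h2 := (lt_of_visit_ne_zero hM (left_ne_zero_of_mul hl')).2 (l + (p + m)) (by omega) hll'
      have h3 := agree_of_cylinder_ne_zero (right_ne_zero_of_mul hl)
      have h4 := hfm.abs_S_sub_S_le hC.le hα.le hα1 (j := l) (q := 0) (x := trunc hM l x) (y := x)
        fun i hi => trunc_apply_of_le hM (by push_cast at hi; omega) x
      have h5 := hfm.abs_S_sub_S_le hC.le hα.le hα1 (j := l + (p + m)) (q := 0)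
        (x := trunc hM l' x) (y := x)
        fun i hi => trunc_apply_of_le hM (by push_cast at hi; omega) x
      have h6 := hfm.abs_S_sub_S_le_of_agree hC.le hα.le hα1 (j := m)
        (x := shiftBy ((l + p : ℕ) : ℤ) x) (y := x₀) fun i hi hi' => by
          have := h3 i.toNat (by omega)
          simp only [proj, Int.toNat_of_nonneg hi] at this
          exact this
      have h7 := hSp p (shiftBy l x)
      rw [pow_zero, mul_one, abs_le] at h4 h5
      rw [abs_le] at h6
      have h8 : S (l + (p + m)) f x = S l f x +
          (S p f (shiftBy l x) + S m f (shiftBy ((l + p : ℕ) : ℤ) x)) := by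
        rw [S_add l, S_add p, shiftBy_shiftBy]
        congr 4
        push_cast
        ring
      linarith [le_abs_self W]
  have h1 : c' * ∑ l ∈ Finset.range n, ∫ x, visit hM f s t l x ∂ν ≤ (p + m : ℕ) := by
    rw [Finset.mul_sum]
    refine (Finset.sum_le_sum fun l _ => hstep l).trans ?_
    rw [← integral_finsetSum _ fun l _ => hint l]
    have := integral_mono (μ := ν) (integrable_finsetSum _ fun l _ => hint l)
      (integrable_const _) hpoint
    simpa using this
  have h2 := (le_div_iff₀' hc'0).mpr h1
  linarith

end Visits

/-! ### Killed walks with a starting point spread over an interval -/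

section Level

variable {ψ : OneSided M → ℝ} {ν : Measure (TwoSided M)}

/-- The maximum of `-S_j f`, `1 ≤ j ≤ n`, truncated to the interval `[s, t]`. For `r ∈ [s, t)` the
walk started from `r` is still nonnegative at time `n` if and only if `level f s t n x ≤ r`. -/
def level (f : TwoSided M → ℝ) (s t : ℝ) : ℕ → TwoSided M → ℝ
  | 0, _ => s
  | n + 1, x => max (level f s t n x) (min t (-S (n + 1) f x))

variable {f : TwoSided M → ℝ} {s t : ℝ}

lemma level_succ (n : ℕ) (x : TwoSided M) :
    level f s t (n + 1) x = max (level f s t n x) (min t (-S (n + 1) f x)) := rfl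

lemma le_level (n : ℕ) (x : TwoSided M) : s ≤ level f s t n x := by
  induction n with
  | zero => exact le_rfl
  | succ n ih => exact ih.trans (le_max_left _ _)

lemma level_le (hst : s ≤ t) (n : ℕ) (x : TwoSided M) : level f s t n x ≤ t := by
  induction n with
  | zero => exact hst
  | succ n ih => exact max_le ih (min_le_left _ _)

lemma level_le_succ (n : ℕ) (x : TwoSided M) : level f s t n x ≤ level f s t (n + 1) x :=
  le_max_left _ _

lemma continuous_level (hf : Continuous f) (n : ℕ) : Continuous (level f s t n) := by
  induction n with
  | zero => exact continuous_const
  | succ n ih => exact ih.max (continuous_const.min (continuous_S _ hf).neg)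

lemma level_le_iff {r : ℝ} (hsr : s ≤ r) (hrt : r < t) (n : ℕ) (x : TwoSided M) :
    level f s t n x ≤ r ↔ ∀ i, 1 ≤ i → i ≤ n → 0 ≤ r + S i f x := by
  induction n with
  | zero => exact ⟨fun _ i h1 h2 => by omega, fun _ => hsr⟩
  | succ n ih =>
    rw [level_succ, max_le_iff, ih, min_le_iff]
    constructor
    · rintro ⟨h1, h2⟩ i hi hin
      rcases hin.eq_or_lt with rfl | hlt
      · rcases h2 with h2 | h2
        · exact absurd h2 (not_le.mpr hrt)
        · linarith
      · exact h1 i hi (by omega)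
    · intro h
      exact ⟨fun i hi hin => h i hi (by omega), Or.inr (by linarith [h (n + 1) (by omega) le_rfl])⟩

lemma abs_level_sub_level_le {δ : ℝ} (hδ : 0 ≤ δ) {x y : TwoSided M} (n : ℕ)
    (h : ∀ i, i ≤ n → |S i f x - S i f y| ≤ δ) :
    |level f s t n x - level f s t n y| ≤ δ := by
  induction n with
  | zero => simpa [level] using hδ
  | succ n ih =>
    refine (abs_max_sub_max_le_max _ _ _ _).trans (max_le (ih fun i hi => h i (by omega)) ?_)
    refine (abs_min_sub_min_le_max _ _ _ _).trans (max_le (by simpa using hδ) ?_)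
    rw [neg_sub_neg, abs_sub_comm]
    exact h (n + 1) le_rfl

lemma neg_lt_S_of_level_lt (n : ℕ) {x : TwoSided M} (h : level f s t n x < t) :
    ∀ i, 1 ≤ i → i ≤ n → -t < S i f x := by
  induction n with
  | zero => intro i h1 h2; omega
  | succ n ih =>
    rw [level_succ, max_lt_iff] at h
    intro i h1 hin
    rcases hin.eq_or_lt with rfl | hlt
    · rcases min_lt_iff.mp h.2 with h2 | h2
      · exact absurd h2 (lt_irrefl _)
      · linarith
    · exact ih h.1 i h1 (by omega)

/-- The length of the set of starting points in `[s, t)` from which the walk first becomes negative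
at time `l + 1`. -/
def drop (f : TwoSided M → ℝ) (s t : ℝ) (l : ℕ) (x : TwoSided M) : ℝ :=
  level f s t (l + 1) x - level f s t l x

lemma drop_nonneg (l : ℕ) (x : TwoSided M) : 0 ≤ drop f s t l x :=
  sub_nonneg.mpr (level_le_succ l x)

lemma drop_le (hst : s ≤ t) (l : ℕ) (x : TwoSided M) : drop f s t l x ≤ t - s :=
  sub_le_sub (level_le hst _ x) (le_level _ x)

lemma continuous_drop (hf : Continuous f) (l : ℕ) : Continuous (drop f s t l) :=
  (continuous_level hf _).sub (continuous_level hf _)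

lemma sum_drop (n : ℕ) (x : TwoSided M) :
    ∑ l ∈ Finset.range n, drop f s t l x = level f s t n x - s :=
  Finset.sum_range_sub (fun l => level f s t l x) n

lemma bounds_of_drop_ne_zero {l : ℕ} {x : TwoSided M} (h : drop f s t l x ≠ 0) :
    S (l + 1) f x < -s ∧ ∀ i, 1 ≤ i → i ≤ l → -t < S i f x := by
  have h1 : level f s t l x < min t (-S (l + 1) f x) := by
    by_contra! hle
    exact h (by rw [drop, level_succ, max_eq_left hle, sub_self])
  have h2 := le_level (f := f) (s := s) (t := t) l x
  refine ⟨?_, neg_lt_S_of_level_lt l (h1.trans_le (min_le_left _ _))⟩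
  linarith [h1.trans_le (min_le_right _ _)]

lemma abs_S_le_of_drop_ne_zero {B : ℝ} (hB : ∀ x, |f x| ≤ B) {l : ℕ} {x : TwoSided M}
    (h : drop f s t l x ≠ 0) : s < -S (l + 1) f x ∧ -S (l + 1) f x ≤ max t 0 + B := by
  obtain ⟨h1, h2⟩ := bounds_of_drop_ne_zero h
  refine ⟨by linarith, ?_⟩
  rw [S_succ]
  have h3 := (abs_le.mp (hB (shiftBy l x))).1
  rcases Nat.eq_zero_or_pos l with h4 | h4
  · subst h4
    rw [S_zero]
    linarith [le_max_right t 0]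
  · linarith [h2 l h4 le_rfl, le_max_left t 0]

/-- The drop at time `l` vanishes unless the walk visits at time `l` a window at the bottom of its
range. -/
lemma drop_eq_zero_or_visit_eq_one (hM : IsIrreducibleTransition M) {C α B : ℝ} (hC : 0 ≤ C)
    (hα : 0 ≤ α) (hα1 : α < 1) (hfm : HasModulus C α f) (hB : ∀ x, |f x| ≤ B) {l : ℕ}
    {x y : TwoSided M} (hxy : ∀ i : ℤ, i ≤ l → x.1 i = y.1 i) :
    drop f s t l y = 0 ∨ visit hM f (s - B - C / (1 - α)) (t + C / (1 - α)) l x = 1 := by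
  by_cases h : drop f s t l y = 0
  · exact Or.inl h
  · right
    obtain ⟨h1, h2⟩ := bounds_of_drop_ne_zero h
    have h3 : ∀ i, i ≤ l → |S i f (trunc hM l x) - S i f y| ≤ C / (1 - α) := fun i hi => by
      have := hfm.abs_S_sub_S_le hC hα hα1 (j := i) (q := 0) (x := trunc hM l x) (y := y)
        fun m hm => by
          rw [trunc_apply_of_le hM (by push_cast at hm; omega)]
          exact hxy m (by push_cast at hm; omega)
      simpa using this
    refine visit_eq_one hM ?_ fun i hi hil => ?_
    · have h4 := (abs_le.mp (h3 l le_rfl)).2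
      rw [S_succ] at h1
      linarith [(abs_le.mp (hB (shiftBy l y))).1]
    · linarith [(abs_le.mp (h3 i hil)).1, h2 i hi hil]

/-- The correlations of `f ∘ T^{l+1+r}` with the drop at time `l` decay exponentially fast in `r`,
relatively to the expected number of visits at time `l`. -/
theorem exists_drop_decorrelation (hM : IsIrreducibleTransition M) (hψ : IsHolderPlus ψ)
    (hψn : IsNormalized ψ) (hν : IsGibbsMeasure ψ ν) (hf : IsHolder f) (hf0 : ∫ x, f x ∂ν = 0)
    {C α B : ℝ} (hC : 0 < C) (hα : 0 < α) (hα1 : α < 1) (hfm : HasModulus C α f)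
    (hB0 : 0 < B) (hB : ∀ x, |f x| ≤ B) :
    ∃ K β : ℝ, 0 < K ∧ 0 < β ∧ β < 1 ∧ ∀ s t : ℝ, s ≤ t → ∀ l r : ℕ,
      |∫ x, drop f s t l x * f (shiftBy ((l + 1 + r : ℕ) : ℤ) x) ∂ν| ≤
        K * (1 + (t - s)) * β ^ r *
          ∫ x, visit hM f (s - B - C / (1 - α)) (t + C / (1 - α)) l x ∂ν := by
  obtain ⟨K₁, β₁, hK₁, hβ₁, hβ₁1, hdec⟩ := exists_decorrelation hM hψ hψn hν hf hf0
  have hfc := hfm.continuous hα.le hα1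
  have := hν.isProbabilityMeasure
  set H := C / (1 - α) with hH
  have hH0 : 0 ≤ H := div_nonneg hC.le (by linarith)
  set β₀ := max α β₁ with hβ₀
  have hβ₀0 : 0 < β₀ := hα.trans_le (le_max_left _ _)
  have hβ₀1 : β₀ < 1 := max_lt hα1 hβ₁1
  obtain ⟨K', β, hK', hβ, hβ1, -, hpow⟩ := exists_pow_div_le hβ₀0 hβ₀1 (p := 2) (by norm_num)
  refine ⟨(K₁ + B * (2 * H)) * K', β, by positivity, hβ₀0.trans_le hβ, hβ1,
    fun s t hst l r => ?_⟩
  set w := visit hM f (s - B - H) (t + H) l with hw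
  have hwi : Integrable w ν := integrable_of_bdd (continuous_visit hM hfc _ _ l) (B := 1)
    fun x => by
      rw [hw, abs_of_nonneg (visit_nonneg hM _ _ _ _ _)]
      exact visit_le_one hM _ _ _ _ _
  have hw0 : 0 ≤ ∫ x, w x ∂ν := integral_nonneg (visit_nonneg hM _ _ _ _)
  -- half of the gap is used to make the drop depend on the past only, the other half to decorrelate
  set q := r / 2 with hq
  set u : TwoSided M → ℝ := fun x => drop f s t l (trunc hM ((l + 1 + q : ℕ) : ℤ) x) with hu
  have hDc : Continuous (drop f s t l) := continuous_drop hfc l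
  have huc : Continuous u := hDc.comp (continuous_trunc hM _)
  have hagree : ∀ (x : TwoSided M) (i : ℤ), i ≤ ((l + 1 + q : ℕ) : ℤ) →
      (trunc hM ((l + 1 + q : ℕ) : ℤ) x).1 i = x.1 i := fun x i hi => trunc_apply_of_le hM hi x
  have hsupp : ∀ x, (drop f s t l x = 0 ∧ u x = 0) ∨ w x = 1 := by
    intro x
    rcases drop_eq_zero_or_visit_eq_one (s := s) (t := t) hM hC.le hα.le hα1 hfm hB (l := l)
      (x := x) (y := x) fun _ _ => rfl with h1 | h1
    · rcases drop_eq_zero_or_visit_eq_one (s := s) (t := t) hM hC.le hα.le hα1 hfm hB (l := l)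
        (x := x) (y := trunc hM ((l + 1 + q : ℕ) : ℤ) x)
        (fun i hi => (hagree x i (by push_cast; omega)).symm) with h2 | h2
      · exact Or.inl ⟨h1, h2⟩
      · exact Or.inr h2
    · exact Or.inr h1
  have hule : ∀ x, u x ≤ (t - s) * w x := by
    intro x
    rcases hsupp x with h | h
    · rw [h.2]
      exact mul_nonneg (by linarith) (visit_nonneg hM _ _ _ _ _)
    · rw [h, mul_one]
      exact drop_le hst _ _
  have hui : Integrable u ν := integrable_of_bdd huc (B := t - s) fun x => by
    rw [hu, abs_of_nonneg (drop_nonneg _ _)]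
    exact drop_le hst _ _
  have hdiff : ∀ x, |drop f s t l x - u x| ≤ 2 * H * α ^ q * w x := by
    intro x
    rcases hsupp x with h | h
    · rw [h.1, h.2, sub_zero, abs_zero]
      exact mul_nonneg (by positivity) (visit_nonneg hM _ _ _ _ _)
    · rw [h, mul_one]
      have h1 : ∀ i, i ≤ l + 1 →
          |S i f x - S i f (trunc hM ((l + 1 + q : ℕ) : ℤ) x)| ≤ H * α ^ q := fun i hi =>
        hfm.abs_S_sub_S_le hC.le hα.le hα1 fun m hm =>
          (hagree x m (by push_cast; omega)).symm
      have h2 := abs_level_sub_level_le (s := s) (t := t) (by positivity) (l + 1) h1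
      have h3 := abs_level_sub_level_le (s := s) (t := t) (δ := H * α ^ q) (by positivity) l
        fun i hi => h1 i (by omega)
      rw [hu]
      simp only [drop]
      rw [abs_le] at *
      constructor <;> linarith
  have hfc' : Continuous fun x => f (shiftBy ((l + 1 + r : ℕ) : ℤ) x) :=
    hfc.comp (continuous_shiftBy _)
  have h1 := hdec (l + 1 + q) (r - q) u huc (fun x => drop_nonneg _ _)
    ⟨t - s, fun x => drop_le hst _ _⟩
    (dependsOnPast_comp_trunc hM _ _)
  rw [show l + 1 + q + (r - q) = l + 1 + r by omega] at h1
  have hprod : ∀ F : TwoSided M → ℝ, Continuous F → (∀ x, |F x| ≤ t - s) →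
      Integrable (fun x => F x * f (shiftBy ((l + 1 + r : ℕ) : ℤ) x)) ν := fun F hF hFb =>
    integrable_of_bdd (hF.mul hfc') (B := (t - s) * B) fun x => by
      rw [abs_mul]
      exact mul_le_mul (hFb x) (hB _) (abs_nonneg _) (by linarith)
  have hi1 := hprod (drop f s t l) hDc fun x => by
    rw [abs_of_nonneg (drop_nonneg _ _)]
    exact drop_le hst _ _
  have hi2 := hprod u huc fun x => by
    rw [hu, abs_of_nonneg (drop_nonneg _ _)]
    exact drop_le hst _ _
  have h2 : |∫ x, drop f s t l x * f (shiftBy ((l + 1 + r : ℕ) : ℤ) x) ∂ν -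
      ∫ x, u x * f (shiftBy ((l + 1 + r : ℕ) : ℤ) x) ∂ν| ≤ B * (2 * H) * α ^ q * ∫ x, w x ∂ν := by
    rw [← integral_sub hi1 hi2, ← integral_const_mul]
    refine (abs_integral_le_integral_abs).trans
      (integral_mono (hi1.sub hi2).abs (hwi.const_mul _) fun x => ?_)
    change |_ - _| ≤ B * (2 * H) * α ^ q * w x
    rw [← sub_mul, abs_mul, mul_comm]
    refine (mul_le_mul (hB _) (hdiff x) (abs_nonneg _) hB0.le).trans_eq (by ring)
  have h3 : ∫ x, u x ∂ν ≤ (t - s) * ∫ x, w x ∂ν := by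
    rw [← integral_const_mul]
    exact integral_mono hui (hwi.const_mul _) hule
  have hp1 : β₁ ^ (r - q) ≤ β₀ ^ q :=
    (pow_le_pow_left₀ hβ₁.le (le_max_right _ _) _).trans
      (pow_le_pow_of_le_one hβ₀0.le hβ₀1.le (by omega))
  have hp2 : α ^ q ≤ β₀ ^ q := pow_le_pow_left₀ hα.le (le_max_left _ _) _
  have h4 : K₁ * β₁ ^ (r - q) * ∫ x, u x ∂ν ≤ K₁ * β₀ ^ q * ((t - s) * ∫ x, w x ∂ν) :=
    mul_le_mul (mul_le_mul_of_nonneg_left hp1 hK₁.le) h3 (integral_nonneg fun x => drop_nonneg _ _)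
      (by positivity)
  have h5 : B * (2 * H) * α ^ q * ∫ x, w x ∂ν ≤ B * (2 * H) * β₀ ^ q * ∫ x, w x ∂ν :=
    mul_le_mul_of_nonneg_right (mul_le_mul_of_nonneg_left hp2 (by positivity)) hw0
  have h6 : 0 ≤ β₀ ^ q * ∫ x, w x ∂ν := by positivity
  calc |∫ x, drop f s t l x * f (shiftBy ((l + 1 + r : ℕ) : ℤ) x) ∂ν|
      ≤ B * (2 * H) * β₀ ^ q * ∫ x, w x ∂ν + K₁ * β₀ ^ q * ((t - s) * ∫ x, w x ∂ν) := by
        rw [abs_le] at *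
        constructor <;> linarith
    _ ≤ (K₁ + B * (2 * H)) * (1 + (t - s)) * (β₀ ^ q * ∫ x, w x ∂ν) := by
        have h7 : 0 ≤ K₁ * (β₀ ^ q * ∫ x, w x ∂ν) := by positivity
        have h8 : 0 ≤ B * (2 * H) * (t - s) * (β₀ ^ q * ∫ x, w x ∂ν) :=
          mul_nonneg (mul_nonneg (by positivity) (by linarith)) h6
        linarith
    _ ≤ (K₁ + B * (2 * H)) * (1 + (t - s)) * (K' * β ^ r * ∫ x, w x ∂ν) :=
        mul_le_mul_of_nonneg_left (mul_le_mul_of_nonneg_right (hpow r) hw0)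
          (mul_nonneg (by positivity) (by linarith))
    _ = _ := by ring

/-- The partial sums of the convolution of a geometric sequence and a summable sequence. -/
lemma sum_convolution_le {β : ℝ} (hβ : 0 < β) (hβ1 : β < 1) {b : ℕ → ℝ} (hb : ∀ l, 0 ≤ b l)
    {Q : ℝ} (hQ : ∀ n, ∑ l ∈ Finset.range n, b l ≤ Q) (n : ℕ) :
    ∑ j ∈ Finset.range n, ∑ l ∈ Finset.range j, β ^ (j - 1 - l) * b l ≤ Q / (1 - β) := by
  set e : ℕ → ℝ := fun j => ∑ l ∈ Finset.range j, β ^ (j - 1 - l) * b l with he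
  have hrec : ∀ j, e (j + 1) = β * e j + b j := by
    intro j
    simp only [he, Finset.sum_range_succ, Finset.mul_sum]
    congr 1
    · refine Finset.sum_congr rfl fun l hl => ?_
      rw [Finset.mem_range] at hl
      rw [show j + 1 - 1 - l = (j - 1 - l) + 1 by omega, pow_succ]
      ring
    · simp
  have hsum : ∀ n, (1 - β) * ∑ j ∈ Finset.range n, e j + e n = ∑ l ∈ Finset.range n, b l := by
    intro n
    induction n with
    | zero => simp [he]
    | succ n ih =>
      rw [Finset.sum_range_succ, Finset.sum_range_succ, ← ih, hrec]
      ring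
  have he0 : 0 ≤ e n := Finset.sum_nonneg fun l _ => mul_nonneg (by positivity) (hb l)
  rw [le_div_iff₀' (by linarith)]
  linarith [hsum n, hQ n]

/-- The integral over the starting points `r ∈ [s, t)` of the mean of `S_n f` on the event that the
walk started from `r` is not killed before time `n`, see `integral_killedMean`. -/
def averagedMean (ν : Measure (TwoSided M)) (f : TwoSided M → ℝ) (s t : ℝ) (n : ℕ) : ℝ :=
  ∫ x, S n f x * (t - level f s t n x) ∂ν

lemma abs_S_le {B : ℝ} (hB : ∀ x, |f x| ≤ B) (n : ℕ) (x : TwoSided M) : |S n f x| ≤ n * B := by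
  rw [S_eq_sum]
  refine (Finset.abs_sum_le_sum_abs _ _).trans ?_
  have := Finset.sum_le_card_nsmul (Finset.range n) (fun i : ℕ => |f (shiftBy i x)|) B
    fun i _ => hB _
  simpa using this

/-- Summation by parts: the increment of `S_n f (t - level)` splits into a correlation and a term
carried by the drop. -/
lemma averagedMean_succ (hν : IsGibbsMeasure ψ ν) (hfc : Continuous f) {B : ℝ}
    (hB : ∀ x, |f x| ≤ B) (hf0 : ∫ x, f x ∂ν = 0) (hst : s ≤ t) (n : ℕ) :
    averagedMean ν f s t (n + 1) = averagedMean ν f s t n -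
      ∑ l ∈ Finset.range n, ∫ x, drop f s t l x * f (shiftBy n x) ∂ν -
      ∫ x, S (n + 1) f x * drop f s t n x ∂ν := by
  have := hν.isProbabilityMeasure
  have hB0 : 0 ≤ B := by
    obtain ⟨x⟩ := ν.nonempty_of_neZero
    exact (abs_nonneg _).trans (hB x)
  have hfn : Continuous fun x : TwoSided M => f (shiftBy n x) := hfc.comp (continuous_shiftBy _)
  have hdi : ∀ l, Integrable (fun x => drop f s t l x * f (shiftBy n x)) ν := fun l =>
    integrable_of_bdd ((continuous_drop hfc l).mul hfn) (B := (t - s) * B) fun x => by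
      rw [abs_mul, abs_of_nonneg (drop_nonneg _ _)]
      exact mul_le_mul (drop_le hst _ _) (hB _) (abs_nonneg _) (by linarith)
  have hSi : ∀ n : ℕ, Integrable (fun x => S n f x * (t - level f s t n x)) ν := fun n =>
    integrable_of_bdd ((continuous_S n hfc).mul (continuous_const.sub (continuous_level hfc n)))
      (B := n * B * (t - s)) fun x => by
      have h1 := level_le (f := f) hst n x
      have h2 := le_level (f := f) (s := s) (t := t) n x
      rw [abs_mul, abs_of_nonneg (sub_nonneg.mpr h1)]
      exact mul_le_mul (abs_S_le hB n x) (by linarith) (by linarith) (by positivity)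
  have hSd : Integrable (fun x => S (n + 1) f x * drop f s t n x) ν :=
    integrable_of_bdd ((continuous_S _ hfc).mul (continuous_drop hfc n))
      (B := (n + 1 : ℕ) * B * (t - s)) fun x => by
      rw [abs_mul, abs_of_nonneg (drop_nonneg _ _)]
      exact mul_le_mul (abs_S_le hB _ x) (drop_le hst _ _) (drop_nonneg _ _) (by positivity)
  have hfi : Integrable (fun x => (t - s) * f (shiftBy n x)) ν :=
    (integrable_of_bdd hfn fun x => hB _).const_mul _
  have hpt : ∀ x, S (n + 1) f x * (t - level f s t (n + 1) x) =
      S n f x * (t - level f s t n x) + ((t - s) * f (shiftBy n x) -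
        ∑ l ∈ Finset.range n, drop f s t l x * f (shiftBy n x)) -
      S (n + 1) f x * drop f s t n x := by
    intro x
    rw [← Finset.sum_mul, sum_drop, drop, S_succ]
    ring
  have hsumi : Integrable (fun x => ∑ l ∈ Finset.range n, drop f s t l x * f (shiftBy n x)) ν :=
    integrable_finsetSum _ fun l _ => hdi l
  unfold averagedMean
  simp only [hpt]
  rw [integral_sub (f := fun x => S n f x * (t - level f s t n x) + ((t - s) * f (shiftBy n x) -
        ∑ l ∈ Finset.range n, drop f s t l x * f (shiftBy n x))) ((hSi n).add (hfi.sub hsumi)) hSd,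
    integral_add (g := fun x => (t - s) * f (shiftBy n x) -
        ∑ l ∈ Finset.range n, drop f s t l x * f (shiftBy n x)) (hSi n) (hfi.sub hsumi),
    integral_sub hfi hsumi, integral_const_mul, hν.integral_comp_shiftBy hfc, hf0,
    integral_finsetSum _ fun l _ => hdi l]
  ring

/-- The averaged means converge, and for an interval of length one they are controlled uniformly
in `n` and in the position of the interval. -/
theorem exists_averagedMean_estimates (hM : IsIrreducibleTransition M) (hψ : IsHolderPlus ψ)
    (hψn : IsNormalized ψ) (hν : IsGibbsMeasure ψ ν) (hf : IsHolder f) (hf0 : ∫ x, f x ∂ν = 0)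
    (hcob : ¬ IsCoboundary f) :
    (∀ s t, s ≤ t → ∃ Λ, Tendsto (averagedMean ν f s t) atTop (𝓝 Λ)) ∧
      ∃ c : ℝ, 0 < c ∧ ∀ s n, averagedMean ν f s (s + 1) n ≤ max s 0 + c ∧
        s * ∫ x, (level f s (s + 1) n x - s) ∂ν - c ≤ averagedMean ν f s (s + 1) n := by
  obtain ⟨C, α, hC, hα, hα1, hfm⟩ := hf.exists_modulus
  have hfc := hfm.continuous hα.le hα1
  obtain ⟨B, hB0, hB⟩ := hfm.exists_bound hC.le
  have := hν.isProbabilityMeasure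
  obtain ⟨K, β, hK, hβ, hβ1, hdec⟩ :=
    exists_drop_decorrelation hM hψ hψn hν hf hf0 hC hα hα1 hfm hB0 hB
  set H := C / (1 - α) with hH
  set a : ℝ → ℝ → ℕ → ℝ := fun s t n =>
    ∑ l ∈ Finset.range n, ∫ x, drop f s t l x * f (shiftBy n x) ∂ν with ha
  set d : ℝ → ℝ → ℕ → ℝ := fun s t n => ∫ x, -S (n + 1) f x * drop f s t n x ∂ν with hd
  have hA : ∀ s t, s ≤ t → ∀ n, averagedMean ν f s t n =
      ∑ j ∈ Finset.range n, d s t j - ∑ j ∈ Finset.range n, a s t j := by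
    intro s t hst n
    induction n with
    | zero => simp [averagedMean]
    | succ n ih =>
      rw [averagedMean_succ hν hfc hB hf0 hst, ih, Finset.sum_range_succ, Finset.sum_range_succ]
      have h1 : d s t n = -∫ x, S (n + 1) f x * drop f s t n x ∂ν := by
        simp only [hd, neg_mul, integral_neg]
      rw [h1]
      simp only [ha]
      ring
  have hasum : ∀ W : ℝ, 0 ≤ W → ∃ Q : ℝ, 0 < Q ∧ ∀ s t, s ≤ t → t - s ≤ W → ∀ n,
      ∑ j ∈ Finset.range n, |a s t j| ≤ Q := by
    intro W hW
    obtain ⟨Q, hQ, hvis⟩ :=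
      exists_sum_integral_visit_le hM hψ hψn hν hf hf0 hcob (W + B + 2 * H)
    have h1β : 0 < 1 - β := by linarith
    refine ⟨K * (1 + W) * (Q / (1 - β)), by positivity, fun s t hst hW' n => ?_⟩
    have hv0 : ∀ l, 0 ≤ ∫ x, visit hM f (s - B - H) (t + H) l x ∂ν := fun l =>
      integral_nonneg (visit_nonneg hM _ _ _ _)
    have h1 := sum_convolution_le hβ hβ1 hv0
      (hvis (s - B - H) (t + H) (by linarith)) n
    refine le_trans ?_ (mul_le_mul_of_nonneg_left h1 (by positivity))
    rw [Finset.mul_sum]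
    refine Finset.sum_le_sum fun j _ => ?_
    simp only [ha]
    refine (Finset.abs_sum_le_sum_abs _ _).trans ?_
    rw [Finset.mul_sum]
    refine Finset.sum_le_sum fun l hl => ?_
    rw [Finset.mem_range] at hl
    have h2 := hdec s t hst l (j - 1 - l)
    rw [show l + 1 + (j - 1 - l) = j by omega] at h2
    refine h2.trans ?_
    rw [mul_assoc]
    refine mul_le_mul_of_nonneg_right ?_ (mul_nonneg (by positivity) (hv0 l))
    exact mul_le_mul_of_nonneg_left (by linarith) hK.le
  have hdi : ∀ s t, s ≤ t → ∀ l, Integrable (drop f s t l) ν := fun s t hst l =>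
    integrable_of_bdd (continuous_drop hfc l) (B := t - s) fun x => by
      rw [abs_of_nonneg (drop_nonneg _ _)]
      exact drop_le hst _ _
  have hSdi : ∀ s t, s ≤ t → ∀ n : ℕ, Integrable (fun x => -S (n + 1) f x * drop f s t n x) ν :=
    fun s t hst n =>
    integrable_of_bdd ((continuous_S _ hfc).neg.mul (continuous_drop hfc n))
      (B := (n + 1 : ℕ) * B * (t - s)) fun x => by
      rw [abs_mul, abs_of_nonneg (drop_nonneg _ _), abs_neg]
      exact mul_le_mul (abs_S_le hB _ x) (drop_le hst _ _) (drop_nonneg _ _) (by positivity)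
  have hdrop : ∀ s t, s ≤ t → ∀ n, ∑ j ∈ Finset.range n, ∫ x, drop f s t j x ∂ν =
      ∫ x, (level f s t n x - s) ∂ν := by
    intro s t hst n
    rw [← integral_finsetSum _ fun l _ => hdi s t hst l]
    simp only [sum_drop]
  have hlevi : ∀ s t, s ≤ t → ∀ n, Integrable (fun x => level f s t n x - s) ν := fun s t hst n =>
    integrable_of_bdd ((continuous_level hfc n).sub continuous_const) (B := t - s) fun x => by
      rw [abs_of_nonneg (sub_nonneg.mpr (le_level n x))]
      linarith [level_le (f := f) hst n x]
  have hlevle : ∀ s t, s ≤ t → ∀ n, ∫ x, (level f s t n x - s) ∂ν ≤ t - s := by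
    intro s t hst n
    have := integral_mono (hlevi s t hst n) (integrable_const (t - s)) fun x => by
      linarith [level_le (f := f) hst n x]
    simpa using this
  have hlev0 : ∀ s t n, 0 ≤ ∫ x, (level f s t n x - s) ∂ν := fun s t n =>
    integral_nonneg fun x => sub_nonneg.mpr (le_level n x)
  have hdup : ∀ s t, s ≤ t → ∀ n, d s t n ≤ (max t 0 + B) * ∫ x, drop f s t n x ∂ν := by
    intro s t hst n
    rw [← integral_const_mul]
    refine integral_mono (hSdi s t hst n) ((hdi s t hst n).const_mul _) fun x => ?_
    by_cases h : drop f s t n x = 0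
    · simp [h]
    · exact mul_le_mul_of_nonneg_right (abs_S_le_of_drop_ne_zero hB h).2 (drop_nonneg _ _)
  have hdlow : ∀ s t, s ≤ t → ∀ n, s * ∫ x, drop f s t n x ∂ν ≤ d s t n := by
    intro s t hst n
    rw [← integral_const_mul]
    refine integral_mono ((hdi s t hst n).const_mul _) (hSdi s t hst n) fun x => ?_
    by_cases h : drop f s t n x = 0
    · simp [h]
    · exact mul_le_mul_of_nonneg_right (abs_S_le_of_drop_ne_zero hB h).1.le (drop_nonneg _ _)
  have hdsum_up : ∀ s t, s ≤ t → ∀ n, ∑ j ∈ Finset.range n, d s t j ≤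
      (max t 0 + B) * ∫ x, (level f s t n x - s) ∂ν := by
    intro s t hst n
    rw [← hdrop s t hst, Finset.mul_sum]
    exact Finset.sum_le_sum fun j _ => hdup s t hst j
  have hdsum_low : ∀ s t, s ≤ t → ∀ n, s * ∫ x, (level f s t n x - s) ∂ν ≤
      ∑ j ∈ Finset.range n, d s t j := by
    intro s t hst n
    rw [← hdrop s t hst, Finset.mul_sum]
    exact Finset.sum_le_sum fun j _ => hdlow s t hst j
  refine ⟨fun s t hst => ?_, ?_⟩
  · obtain ⟨Q, -, hQ⟩ := hasum (t - s) (by linarith)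
    have hs1 : Summable (a s t) := (summable_of_sum_range_le (fun n => abs_nonneg _)
      (hQ s t hst le_rfl)).of_abs
    have hs2 : Summable (d s t) := by
      refine (summable_of_sum_range_le (c := (|s| + (max t 0 + B)) * (t - s))
        (fun n => abs_nonneg _) fun n => ?_).of_abs
      refine le_trans ?_ (mul_le_mul_of_nonneg_left (hlevle s t hst n) (by positivity))
      rw [← hdrop s t hst, Finset.mul_sum]
      refine Finset.sum_le_sum fun j _ => ?_
      have h0 : 0 ≤ ∫ x, drop f s t j x ∂ν := integral_nonneg fun x => drop_nonneg _ _
      have h1 := hdup s t hst j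
      have h2 := hdlow s t hst j
      have h3 := mul_le_mul_of_nonneg_right (neg_abs_le s) h0
      have h4 : 0 ≤ |s| * ∫ x, drop f s t j x ∂ν := by positivity
      have h5 : 0 ≤ (max t 0 + B) * ∫ x, drop f s t j x ∂ν := by positivity
      rw [abs_le]
      constructor <;> linarith
    refine ⟨_, ((hs2.hasSum.tendsto_sum_nat).sub (hs1.hasSum.tendsto_sum_nat)).congr fun n => ?_⟩
    exact (hA s t hst n).symm
  · obtain ⟨Q, hQ0, hQ⟩ := hasum 1 zero_le_one
    refine ⟨Q + 1 + B, by positivity, fun s n => ?_⟩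
    have hst : s ≤ s + 1 := by linarith
    have h1 := (abs_le.mp ((Finset.abs_sum_le_sum_abs (a s (s + 1)) (Finset.range n)).trans
      (hQ s (s + 1) hst (by linarith) n)))
    have h2 := hdsum_up s (s + 1) hst n
    have h3 := hdsum_low s (s + 1) hst n
    have h4 := hlevle s (s + 1) hst n
    have h5 : max (s + 1) 0 ≤ max s 0 + 1 :=
      max_le (by linarith [le_max_left s 0]) (by linarith [le_max_right s 0])
    rw [hA s (s + 1) hst n]
    refine ⟨?_, by linarith [h1.2]⟩
    have h6 : (max (s + 1) 0 + B) * ∫ x, (level f s (s + 1) n x - s) ∂ν ≤ max (s + 1) 0 + B :=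
      mul_le_of_le_one_right (by positivity) (by linarith)
    linarith [h1.1]

/-- The walk started from a point of `[s, t)` is killed almost surely. -/
theorem tendsto_integral_sub_level (hM : IsIrreducibleTransition M) (hψ : IsHolderPlus ψ)
    (hψn : IsNormalized ψ) (hν : IsGibbsMeasure ψ ν) (hf : IsHolder f) (hf0 : ∫ x, f x ∂ν = 0)
    (hcob : ¬ IsCoboundary f) (hst : s ≤ t) :
    Tendsto (fun n => ∫ x, (t - level f s t n x) ∂ν) atTop (𝓝 0) := by
  obtain ⟨C, α, hC, hα, hα1, hfm⟩ := hf.exists_modulus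
  have hfc := hfm.continuous hα.le hα1
  obtain ⟨B, hB0, hB⟩ := hfm.exists_bound hC.le
  have := hν.isProbabilityMeasure
  set H := C / (1 - α) with hH
  obtain ⟨Λ, hΛ⟩ := (exists_averagedMean_estimates hM hψ hψn hν hf hf0 hcob).1 s t hst
  have hF0 : ∀ n x, 0 ≤ t - level f s t n x := fun n x => sub_nonneg.mpr (level_le hst n x)
  have hFle : ∀ n x, t - level f s t n x ≤ t - s := fun n x => by
    linarith [le_level (f := f) (s := s) (t := t) n x]
  have hFi : ∀ n, Integrable (fun x => t - level f s t n x) ν := fun n =>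
    integrable_of_bdd (continuous_const.sub (continuous_level hfc n)) (B := t - s) fun x => by
      rw [abs_of_nonneg (hF0 n x)]
      exact hFle n x
  have hSi : ∀ n : ℕ, Integrable (fun x => S n f x * (t - level f s t n x)) ν := fun n =>
    integrable_of_bdd ((continuous_S n hfc).mul (continuous_const.sub (continuous_level hfc n)))
      (B := n * B * (t - s)) fun x => by
      rw [abs_mul, abs_of_nonneg (hF0 n x)]
      exact mul_le_mul (abs_S_le hB n x) (hFle n x) (hF0 n x) (by positivity)
  obtain ⟨b, hb⟩ : ∃ b, ∀ n, averagedMean ν f s t n ≤ b := by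
    obtain ⟨b, hb⟩ := hΛ.bddAbove_range
    exact ⟨b, fun n => hb ⟨n, rfl⟩⟩
  set b' := |b| + |t| * (t - s) + 1 with hb'
  have hb'0 : 0 < b' := by
    have : 0 ≤ |t| * (t - s) := mul_nonneg (abs_nonneg _) (by linarith)
    positivity
  have hvis0 : ∀ R : ℝ, Tendsto (fun n => ∫ x, visit hM f (t - R - H) (t + H) n x ∂ν) atTop
      (𝓝 0) := by
    intro R
    obtain ⟨Q, -, hQ⟩ := exists_sum_integral_visit_le hM hψ hψn hν hf hf0 hcob (R + 2 * H)
    exact (summable_of_sum_range_le (fun n => integral_nonneg (visit_nonneg hM _ _ _ _))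
      (hQ (t - R - H) (t + H) (by linarith))).tendsto_atTop_zero
  -- a surviving walk is either above level `R`, where the bound on the mean makes it rare, or in a
  -- bounded window, where the probability tends to `0`
  have hmain : ∀ R : ℝ, 0 < R → ∀ n, 1 ≤ n → R * ∫ x, (t - level f s t n x) ∂ν ≤
      b' + R * (t - s) * ∫ x, visit hM f (t - R - H) (t + H) n x ∂ν := by
    intro R hR n hn
    set w := visit hM f (t - R - H) (t + H) n with hw
    have hwi : Integrable w ν := integrable_of_bdd (continuous_visit hM hfc _ _ n) (B := 1)
      fun x => by
        rw [hw, abs_of_nonneg (visit_nonneg hM _ _ _ _ _)]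
        exact visit_le_one hM _ _ _ _ _
    have hpt : ∀ x, R * (t - level f s t n x) ≤ (S n f x * (t - level f s t n x) +
        |t| * (t - level f s t n x)) + R * (t - s) * w x := by
      intro x
      have hw0 : 0 ≤ w x := visit_nonneg hM _ _ _ _ _
      have hRw : 0 ≤ R * (t - s) * w x := mul_nonneg (mul_nonneg hR.le (by linarith)) hw0
      rcases (level_le (f := f) hst n x).eq_or_lt with h | h
      · rw [h, sub_self]
        simpa using hRw
      · have hS := neg_lt_S_of_level_lt n h
        have h1 := hS n hn le_rfl
        have h2 : 0 < t - level f s t n x := by linarith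
        by_cases hlt : S n f x + t < R
        · have hw1 : w x = 1 := by
            have h3 : ∀ i, i ≤ n → |S i f (trunc hM n x) - S i f x| ≤ H := fun i hi => by
              have := hfm.abs_S_sub_S_le hC.le hα.le hα1 (j := i) (q := 0)
                (x := trunc hM n x) (y := x)
                fun m hm => trunc_apply_of_le hM (by push_cast at hm; omega) x
              simpa using this
            refine visit_eq_one hM ?_ fun i hi hin => ?_
            · linarith [(abs_le.mp (h3 n le_rfl)).2]
            · linarith [(abs_le.mp (h3 i hin)).1, hS i hi hin]
          rw [hw1, mul_one]
          have h4 : 0 ≤ (S n f x + |t|) * (t - level f s t n x) :=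
            mul_nonneg (by linarith [le_abs_self t]) h2.le
          have h5 := mul_le_mul_of_nonneg_left (hFle n x) hR.le
          linarith
        · push Not at hlt
          have h4 := mul_le_mul_of_nonneg_right
            (hlt.trans (add_le_add_right (le_abs_self t) (S n f x))) h2.le
          linarith
    have hint := integral_mono ((hFi n).const_mul R)
      (((hSi n).add ((hFi n).const_mul |t|)).add (hwi.const_mul (R * (t - s)))) hpt
    have e1 : ∫ x, R * (t - level f s t n x) ∂ν = R * ∫ x, (t - level f s t n x) ∂ν :=
      integral_const_mul _ _
    have e2 : ∫ x, |t| * (t - level f s t n x) ∂ν = |t| * ∫ x, (t - level f s t n x) ∂ν :=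
      integral_const_mul _ _
    have e3 : ∫ x, R * (t - s) * w x ∂ν = R * (t - s) * ∫ x, w x ∂ν := integral_const_mul _ _
    rw [integral_add' ((hSi n).add ((hFi n).const_mul |t|)) (hwi.const_mul (R * (t - s))),
      integral_add' (hSi n) ((hFi n).const_mul |t|), e1, e2, e3] at hint
    have h1 : ∫ x, (t - level f s t n x) ∂ν ≤ t - s := by
      have := integral_mono (hFi n) (integrable_const (t - s)) (hFle n)
      simpa using this
    have h2 := mul_le_mul_of_nonneg_left h1 (abs_nonneg t)
    have h3 : ∫ x, S n f x * (t - level f s t n x) ∂ν ≤ |b| := (hb n).trans (le_abs_self b)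
    linarith
  refine tendsto_order.mpr ⟨fun ε hε => Eventually.of_forall fun n =>
    hε.trans_le (integral_nonneg (hF0 n)), fun ε hε => ?_⟩
  have h1 := ((hvis0 (2 * b' / ε)).const_mul (t - s)).eventually
    (gt_mem_nhds (show (t - s) * 0 < ε / 2 by rw [mul_zero]; exact half_pos hε))
  filter_upwards [h1, eventually_ge_atTop 1] with n hn1 hn2
  have hR : 0 < 2 * b' / ε := by positivity
  have h2 := hmain _ hR n hn2
  have h3 : b' = 2 * b' / ε * (ε / 2) := by field_simp
  have h4 := mul_lt_mul_of_pos_left hn1 hR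
  have h5 : 2 * b' / ε * ∫ x, (t - level f s t n x) ∂ν < 2 * b' / ε * ε := by linarith
  exact lt_of_mul_lt_mul_left h5 hR.le

end Level

/-! ### Limits of monotone functions -/

section RealFunctions

/-- Right-continuous functions that are comparable almost everywhere are comparable. -/
lemma le_of_ae_le_of_rightContinuous {u v : ℝ → ℝ} {t : ℝ}
    (hu : ContinuousWithinAt u (Set.Ici t) t) (hv : ContinuousWithinAt v (Set.Ici t) t)
    (huv : ∀ᵐ r, u r ≤ v r) : u t ≤ v t := by
  by_contra! h
  have h1 : ∀ᶠ r in 𝓝[≥] t, v r < u r := hv.eventually_lt hu h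
  obtain ⟨b, hb, hsub⟩ := mem_nhdsGE_iff_exists_Ico_subset.mp h1
  have h2 : volume (Set.Ico t b) = 0 :=
    measure_mono_null (fun r hr => by simpa using hsub hr) (ae_iff.mp huv)
  rw [Real.volume_Ico, ENNReal.ofReal_eq_zero] at h2
  have hb' : t < b := hb
  linarith

lemma integrableOn_Ico_of_monotone {u : ℝ → ℝ} (hu : Monotone u) (s t : ℝ) :
    IntegrableOn u (Set.Ico s t) :=
  ((hu.monotoneOn _).integrableOn_isCompact isCompact_Icc).mono_set Set.Ico_subset_Icc_self

lemma setIntegral_Ico_bounds_of_monotone {u : ℝ → ℝ} (hu : Monotone u) {s t : ℝ} (hst : s ≤ t) :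
    (t - s) * u s ≤ ∫ r in Set.Ico s t, u r ∧ ∫ r in Set.Ico s t, u r ≤ (t - s) * u t := by
  have hc : ∀ c : ℝ, ∫ _ in Set.Ico s t, c = (t - s) * c := fun c => by
    rw [setIntegral_const, Real.volume_real_Ico_of_le hst, smul_eq_mul]
  have hi : ∀ c : ℝ, IntegrableOn (fun _ : ℝ => c) (Set.Ico s t) := fun c =>
    integrableOn_const measure_Ico_lt_top.ne
  constructor
  · rw [← hc]
    exact setIntegral_mono_on (hi _) (integrableOn_Ico_of_monotone hu s t) measurableSet_Ico
      fun r hr => hu hr.1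
  · rw [← hc (u t)]
    exact setIntegral_mono_on (integrableOn_Ico_of_monotone hu s t) (hi _) measurableSet_Ico
      fun r hr => hu hr.2.le

/-- Monotone functions whose integrals over bounded intervals converge have a right-continuous
monotone limit, almost everywhere. -/
theorem exists_ae_tendsto_of_tendsto_setIntegral {U : ℕ → ℝ → ℝ} (hU : ∀ n, Monotone (U n))
    (hlim : ∀ s t, s ≤ t → ∃ Λ, Tendsto (fun n => ∫ r in Set.Ico s t, U n r) atTop (𝓝 Λ)) :
    ∃ V : ℝ → ℝ, Monotone V ∧ (∀ t, ContinuousWithinAt V (Set.Ici t) t) ∧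
      ∀ᵐ t, Tendsto (fun n => U n t) atTop (𝓝 (V t)) := by
  have hlim' : ∀ s t, ∃ m, s < t →
      Tendsto (fun n => (∫ r in Set.Ico s t, U n r) / (t - s)) atTop (𝓝 m) := fun s t => by
    by_cases h : s < t
    · obtain ⟨Λ, hΛ⟩ := hlim s t h.le
      exact ⟨Λ / (t - s), fun _ => hΛ.div_const _⟩
    · exact ⟨0, fun h' => absurd h' h⟩
  choose m hm using hlim'
  have hleft : ∀ {s t}, s < t → ∀ n, (∫ r in Set.Ico s t, U n r) / (t - s) ≤ U n t :=
    fun {s t} hst n => (div_le_iff₀' (sub_pos.mpr hst)).mpr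
      (setIntegral_Ico_bounds_of_monotone (hU n) hst.le).2
  have hright : ∀ {s t}, s < t → ∀ n, U n s ≤ (∫ r in Set.Ico s t, U n r) / (t - s) :=
    fun {s t} hst n => (le_div_iff₀' (sub_pos.mpr hst)).mpr
      (setIntegral_Ico_bounds_of_monotone (hU n) hst.le).1
  have hmm : ∀ {s t b}, s < t → t < b → m s t ≤ m t b := fun {s t b} hst htb =>
    le_of_tendsto_of_tendsto' (hm s t hst) (hm t b htb) fun n => (hleft hst n).trans (hright htb n)
  -- the limits of the means over intervals that start at `t` decrease to the value at `t`
  set W : ℝ → ℝ := fun t => sInf (m t '' Set.Ioi t) with hW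
  have hbdd : ∀ t, BddBelow (m t '' Set.Ioi t) := fun t =>
    ⟨m (t - 1) t, by
      rintro _ ⟨b, hb, rfl⟩
      exact hmm (by linarith) hb⟩
  have hWle : ∀ {s t}, s < t → W s ≤ m s t := fun {s t} hst => csInf_le (hbdd s) ⟨t, hst, rfl⟩
  have hleW : ∀ {s t}, s < t → m s t ≤ W t := fun {s t} hst =>
    le_csInf ⟨_, t + 1, by simp, rfl⟩ (by
      rintro _ ⟨b, hb, rfl⟩
      exact hmm hst hb)
  have hWmono : Monotone W := fun s t hst => by
    rcases hst.eq_or_lt with rfl | h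
    · exact le_rfl
    · exact (hWle h).trans (hleW h)
  refine ⟨hWmono.stieltjesFunction, hWmono.stieltjesFunction.mono,
    hWmono.stieltjesFunction.right_continuous, ?_⟩
  have hae : ∀ᵐ t, ContinuousAt W t :=
    ae_iff.mpr (hWmono.countable_not_continuousAt.measure_zero volume)
  filter_upwards [hae] with t ht
  have hVt : hWmono.stieltjesFunction t = W t := by
    rw [hWmono.stieltjesFunction_eq]
    exact ht.continuousWithinAt.rightLim_eq
  rw [hVt]
  refine tendsto_order.mpr ⟨fun a ha => ?_, fun a ha => ?_⟩
  · have h1 : ∀ᶠ s in 𝓝[<] t, a < W s := (ht.tendsto.mono_left nhdsWithin_le_nhds).eventually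
      (lt_mem_nhds ha)
    obtain ⟨s, hs, hst⟩ := (h1.and self_mem_nhdsWithin).exists
    filter_upwards [(hm s t hst).eventually (lt_mem_nhds (hs.trans_le (hWle hst)))] with n hn
    exact hn.trans_le (hleft hst n)
  · have h1 : ∀ᶠ s in 𝓝[>] t, W s < a := (ht.tendsto.mono_left nhdsWithin_le_nhds).eventually
      (gt_mem_nhds ha)
    obtain ⟨s, hs, hst⟩ := (h1.and self_mem_nhdsWithin).exists
    filter_upwards [(hm t s hst).eventually (gt_mem_nhds ((hleW hst).trans_lt hs))] with n hn
    exact (hright hst n).trans_lt hn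

end RealFunctions

/-! ### The exit time and the killed walk -/

section Survival

variable {ψ : OneSided M → ℝ} {ν : Measure (TwoSided M)} {f : TwoSided M → ℝ}

lemma lt_exitTime_iff (n : ℕ) (t : ℝ) (x : TwoSided M) :
    (n : ℕ∞) < exitTime f t x ↔ ∀ i, 1 ≤ i → i ≤ n → 0 ≤ t + S i f x := by
  constructor
  · intro h i h1 hin
    by_contra! hneg
    have h2 : exitTime f t x ≤ (i : ℕ∞) := iInf₂_le i ⟨h1, hneg⟩
    exact absurd (h.trans_le h2) (not_lt.mpr (by exact_mod_cast hin))
  · intro h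
    have h1 : ((n + 1 : ℕ) : ℕ∞) ≤ exitTime f t x := by
      refine le_iInf₂ fun j hj => ?_
      by_contra! hlt
      have hjn : j < n + 1 := by exact_mod_cast hlt
      exact absurd (h j hj.1 (by omega)) (not_le.mpr hj.2)
    refine lt_of_lt_of_le ?_ h1
    exact_mod_cast Nat.lt_succ_self n

/-- The integral of `g` over the event that the walk started from `t` is not killed up to time
`n`. -/
def survivalMean (ν : Measure (TwoSided M)) (f g : TwoSided M → ℝ) (n : ℕ) (t : ℝ) : ℝ :=
  ∫ x, Set.indicator {x | (n : ℕ∞) < exitTime f t x} g x ∂ν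

lemma measurableSet_survival (hf : Continuous f) (n : ℕ) :
    MeasurableSet {p : ℝ × TwoSided M | (n : ℕ∞) < exitTime f p.1 p.2} := by
  have h : {p : ℝ × TwoSided M | (n : ℕ∞) < exitTime f p.1 p.2} =
      ⋂ i : ℕ, ⋂ _ : 1 ≤ i, ⋂ _ : i ≤ n, {p | 0 ≤ p.1 + S i f p.2} := by
    ext p
    simp [lt_exitTime_iff]
  rw [h]
  refine MeasurableSet.iInter fun i => MeasurableSet.iInter fun _ =>
    MeasurableSet.iInter fun _ => ?_
  exact measurableSet_le measurable_const
    (measurable_fst.add ((continuous_S i hf).measurable.comp measurable_snd))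

lemma measurableSet_survival_right (hf : Continuous f) (n : ℕ) (t : ℝ) :
    MeasurableSet {x : TwoSided M | (n : ℕ∞) < exitTime f t x} :=
  measurable_prodMk_left (measurableSet_survival hf n)

lemma setIntegral_indicator_survival {s t : ℝ} (hst : s ≤ t) (n : ℕ) (x : TwoSided M) (c : ℝ) :
    ∫ r in Set.Ico s t, ({r | (n : ℕ∞) < exitTime f r x} : Set ℝ).indicator (fun _ => c) r =
      c * (t - level f s t n x) := by
  have h1 : ∀ r ∈ Set.Ico s t,
      ({r | (n : ℕ∞) < exitTime f r x} : Set ℝ).indicator (fun _ => c) r =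
        (Set.Ici (level f s t n x)).indicator (fun _ => c) r := by
    intro r hr
    have h2 : r ∈ {r | (n : ℕ∞) < exitTime f r x} ↔ r ∈ Set.Ici (level f s t n x) := by
      rw [Set.mem_ofPred_eq, lt_exitTime_iff, Set.mem_Ici, level_le_iff hr.1 hr.2]
    by_cases h : r ∈ Set.Ici (level f s t n x)
    · rw [Set.indicator_of_mem h, Set.indicator_of_mem (h2.mpr h)]
    · rw [Set.indicator_of_notMem h, Set.indicator_of_notMem (mt h2.mp h)]
  rw [setIntegral_congr_fun measurableSet_Ico h1, setIntegral_indicator measurableSet_Ici]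
  have h3 : Set.Ico s t ∩ Set.Ici (level f s t n x) = Set.Ico (level f s t n x) t := by
    ext r
    simp only [Set.mem_inter_iff, Set.mem_Ico, Set.mem_Ici]
    constructor
    · rintro ⟨⟨-, h⟩, h'⟩
      exact ⟨h', h⟩
    · rintro ⟨h, h'⟩
      exact ⟨⟨(le_level n x).trans h, h'⟩, h⟩
  rw [h3, setIntegral_const, Real.volume_real_Ico_of_le (level_le hst n x), smul_eq_mul, mul_comm]

/-- Fubini's theorem for the starting point and the trajectory. -/
lemma setIntegral_survivalMean [IsProbabilityMeasure ν] (hf : Continuous f) {g : TwoSided M → ℝ}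
    (hg : Continuous g) {b : ℝ} (hb : ∀ x, |g x| ≤ b) {s t : ℝ} (hst : s ≤ t) (n : ℕ) :
    ∫ r in Set.Ico s t, survivalMean ν f g n r = ∫ x, g x * (t - level f s t n x) ∂ν := by
  have hmeas : Measurable fun p : ℝ × TwoSided M =>
      ({p : ℝ × TwoSided M | (n : ℕ∞) < exitTime f p.1 p.2}).indicator (fun p => g p.2) p :=
    (hg.measurable.comp measurable_snd).indicator (measurableSet_survival hf n)
  have hint : Integrable (Function.uncurry fun (r : ℝ) (x : TwoSided M) =>
      Set.indicator {x | (n : ℕ∞) < exitTime f r x} g x)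
      ((volume.restrict (Set.Ico s t)).prod ν) := by
    refine Integrable.of_bound (C := b) (hmeas.aestronglyMeasurable) ?_
    refine Eventually.of_forall fun p => ?_
    exact (norm_indicator_le_norm_self g p.2).trans (hb p.2)
  simp only [survivalMean]
  rw [integral_integral_swap hint]
  refine integral_congr_ae (Eventually.of_forall fun x => ?_)
  exact setIntegral_indicator_survival hst n x (g x)

lemma integrable_indicator_survival [IsProbabilityMeasure ν] (hf : Continuous f)
    {g : TwoSided M → ℝ} (hg : Continuous g)
    {b : ℝ} (hb : ∀ x, |g x| ≤ b) (n : ℕ) (t : ℝ) :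
    Integrable (Set.indicator {x | (n : ℕ∞) < exitTime f t x} g) ν :=
  (integrable_of_bdd hg hb).indicator (measurableSet_survival_right hf n t)

lemma exitTime_mono {s t : ℝ} (hst : s ≤ t) (n : ℕ) :
    {x : TwoSided M | (n : ℕ∞) < exitTime f s x} ⊆ {x | (n : ℕ∞) < exitTime f t x} := by
  intro x hx
  rw [Set.mem_ofPred_eq, lt_exitTime_iff] at hx ⊢
  intro i h1 h2
  linarith [hx i h1 h2]

/-- The probability that the walk started from `t` is not killed up to time `n`. -/
def survivalProb (ν : Measure (TwoSided M)) (f : TwoSided M → ℝ) (n : ℕ) (t : ℝ) : ℝ :=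
  survivalMean ν f (fun _ => 1) n t

/-- The mean position `t + S_n f` of the walk started from `t` and killed when it becomes
negative. Unlike `killedMean` it is monotone in `t`. -/
def killedPosition (ν : Measure (TwoSided M)) (f : TwoSided M → ℝ) (n : ℕ) (t : ℝ) : ℝ :=
  survivalMean ν f (fun x => t + S n f x) n t

lemma survivalProb_nonneg (n : ℕ) (t : ℝ) : 0 ≤ survivalProb ν f n t :=
  integral_nonneg fun x => Set.indicator_nonneg (fun _ _ => zero_le_one) x

lemma monotone_survivalProb [IsProbabilityMeasure ν] (hf : Continuous f) (n : ℕ) :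
    Monotone (survivalProb ν f n) := by
  intro s t hst
  refine integral_mono (integrable_indicator_survival hf continuous_const (b := 1) (by simp) n s)
    (integrable_indicator_survival hf continuous_const (b := 1) (by simp) n t) fun x => ?_
  exact Set.indicator_le_indicator_of_subset (exitTime_mono hst n) (fun _ => zero_le_one) x

lemma survivalProb_le_one [IsProbabilityMeasure ν] (hf : Continuous f) (n : ℕ) (t : ℝ) :
    survivalProb ν f n t ≤ 1 := by
  have h := integral_mono (μ := ν) (integrable_indicator_survival hf continuous_const (b := 1)
    (by simp) n t) (integrable_const (1 : ℝ)) fun x =>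
      Set.indicator_le_self' (fun _ _ => zero_le_one) x
  simpa [survivalProb, survivalMean] using h

lemma killedPosition_eq [IsProbabilityMeasure ν] (hf : Continuous f) {B : ℝ}
    (hB : ∀ x, |f x| ≤ B) (n : ℕ) (t : ℝ) :
    killedPosition ν f n t = killedMean ν f n t + t * survivalProb ν f n t := by
  have h1 : ∀ x, Set.indicator {x | (n : ℕ∞) < exitTime f t x} (fun x => t + S n f x) x =
      Set.indicator {x | (n : ℕ∞) < exitTime f t x} (S n f) x +
        t * Set.indicator {x | (n : ℕ∞) < exitTime f t x} (fun _ => (1 : ℝ)) x := by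
    intro x
    by_cases h : x ∈ {x : TwoSided M | (n : ℕ∞) < exitTime f t x}
    · simp only [Set.indicator_of_mem h]
      ring
    · simp only [Set.indicator_of_notMem h]
      ring
  simp only [killedPosition, survivalMean, h1]
  rw [integral_add (integrable_indicator_survival hf (continuous_S n hf) (abs_S_le hB n) n t)
    ((integrable_indicator_survival hf continuous_const (b := 1) (by simp) n t).const_mul t),
    integral_const_mul]
  rfl

lemma killedPosition_nonneg {n : ℕ} (hn : 1 ≤ n) (t : ℝ) : 0 ≤ killedPosition ν f n t :=
  integral_nonneg fun x => Set.indicator_nonneg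
    (fun _ hx => (lt_exitTime_iff n t _).mp hx n hn le_rfl) x

lemma monotone_killedPosition [IsProbabilityMeasure ν] (hf : Continuous f) {B : ℝ}
    (hB : ∀ x, |f x| ≤ B) {n : ℕ}
    (hn : 1 ≤ n) : Monotone (killedPosition ν f n) := by
  intro s t hst
  have hi : ∀ r : ℝ, Integrable (Set.indicator {x | (n : ℕ∞) < exitTime f r x}
      (fun x => r + S n f x)) ν := fun r =>
    integrable_indicator_survival hf (continuous_const.add (continuous_S n hf))
      (b := |r| + n * B) (fun x => (abs_add_le _ _).trans
        (add_le_add_right (abs_S_le hB n x) _)) n r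
  refine integral_mono (hi s) (hi t) fun x => ?_
  by_cases h : x ∈ {x : TwoSided M | (n : ℕ∞) < exitTime f s x}
  · rw [Set.indicator_of_mem h, Set.indicator_of_mem (exitTime_mono hst n h)]
    linarith
  · rw [Set.indicator_of_notMem h]
    exact Set.indicator_nonneg
      (fun _ hx => (lt_exitTime_iff n t _).mp hx n hn le_rfl) x

lemma integral_killedMean [IsProbabilityMeasure ν] (hf : Continuous f) {B : ℝ}
    (hB : ∀ x, |f x| ≤ B) {s t : ℝ}
    (hst : s ≤ t) (n : ℕ) :
    ∫ r in Set.Ico s t, killedMean ν f n r = averagedMean ν f s t n :=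
  setIntegral_survivalMean hf (continuous_S n hf) (abs_S_le hB n) hst n

lemma integral_survivalProb [IsProbabilityMeasure ν] (hf : Continuous f) {s t : ℝ} (hst : s ≤ t)
    (n : ℕ) :
    ∫ r in Set.Ico s t, survivalProb ν f n r = ∫ x, (t - level f s t n x) ∂ν := by
  have h := setIntegral_survivalMean (ν := ν) hf (g := fun _ => 1) continuous_const (b := 1)
    (by simp) hst n
  simp only [one_mul] at h
  exact h

/-- The mean position and the mean of `S_n f` of the killed walk have nearly the same integrals
over `[s, t)`. -/
lemma abs_integral_killedPosition_sub_le [IsProbabilityMeasure ν] (hf : Continuous f) {B : ℝ}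
    (hB : ∀ x, |f x| ≤ B)
    {s t : ℝ} (hst : s ≤ t) {n : ℕ} (hn : 1 ≤ n) :
    |(∫ r in Set.Ico s t, killedPosition ν f n r) - averagedMean ν f s t n| ≤
      (|s| + |t|) * ∫ x, (t - level f s t n x) ∂ν := by
  have hUi : IntegrableOn (killedPosition ν f n) (Set.Ico s t) :=
    integrableOn_Ico_of_monotone (monotone_killedPosition hf hB hn) s t
  have hPi : IntegrableOn (survivalProb ν f n) (Set.Ico s t) :=
    integrableOn_Ico_of_monotone (monotone_survivalProb hf n) s t
  have hle : ∀ r ∈ Set.Ico s t, |r * survivalProb ν f n r| ≤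
      (|s| + |t|) * survivalProb ν f n r := by
    intro r hr
    rw [abs_mul, abs_of_nonneg (survivalProb_nonneg n r)]
    refine mul_le_mul_of_nonneg_right ?_ (survivalProb_nonneg n r)
    rw [abs_le]
    constructor
    · linarith [hr.1, neg_abs_le s, abs_nonneg t]
    · linarith [hr.2, le_abs_self t, abs_nonneg s]
  have hrPi : IntegrableOn (fun r => r * survivalProb ν f n r) (Set.Ico s t) := by
    refine Integrable.mono' (hPi.const_mul (|s| + |t|))
      (measurable_id.mul (monotone_survivalProb hf n).measurable).aestronglyMeasurable ?_
    exact (ae_restrict_mem measurableSet_Ico).mono hle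
  have hK : ∀ r, killedMean ν f n r = killedPosition ν f n r - r * survivalProb ν f n r :=
    fun r => by
      rw [killedPosition_eq hf hB]
      ring
  rw [← integral_killedMean hf hB hst]
  simp only [hK]
  rw [integral_sub hUi hrPi, sub_sub_cancel, ← integral_survivalProb hf hst, ← integral_const_mul]
  exact (abs_integral_le_integral_abs).trans
    (setIntegral_mono_on hrPi.abs (hPi.const_mul _) measurableSet_Ico hle)

end Survival

/-! ### Existence and uniqueness of the limit -/

section Limit

variable {ψ : OneSided M → ℝ} {ν : Measure (TwoSided M)} {f : TwoSided M → ℝ}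

/-- Uniqueness of the limit: test functions determine it almost everywhere. -/
lemma IsHarmonicFunction.eq {V W : ℝ → ℝ} (hV : IsHarmonicFunction ν f V)
    (hW : IsHarmonicFunction ν f W) : W = V := by
  have hae : ∀ᵐ t, W t = V t :=
    ae_eq_of_integral_contDiff_smul_eq hW.monotone.locallyIntegrable hV.monotone.locallyIntegrable
      fun φ hφ hφs => tendsto_nhds_unique (hW.tendsto φ hφ.continuous hφs)
        (hV.tendsto φ hφ.continuous hφs)
  funext t
  exact le_antisymm
    (le_of_ae_le_of_rightContinuous (hW.rightContinuous t) (hV.rightContinuous t)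
      (hae.mono fun _ h => h.le))
    (le_of_ae_le_of_rightContinuous (hV.rightContinuous t) (hW.rightContinuous t)
      (hae.mono fun _ h => h.ge))

/-- Existence of the limit `V`, as the almost everywhere limit of the mean positions of the killed
walk. The times `n + 1` are used since the mean position is nonnegative and monotone for `n ≥ 1`
only. -/
theorem exists_isHarmonicFunction (hM : IsIrreducibleTransition M) (hψ : IsHolderPlus ψ)
    (hψn : IsNormalized ψ) (hν : IsGibbsMeasure ψ ν) (hf : IsHolder f) (hf0 : ∫ x, f x ∂ν = 0)
    (hcob : ¬ IsCoboundary f) : ∃ V : ℝ → ℝ, IsHarmonicFunction ν f V ∧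
      ∃ c : ℝ, 0 < c ∧ ∀ t : ℝ, max (t - c) 0 ≤ V t ∧ V t ≤ max t 0 + c := by
  have := hν.isProbabilityMeasure
  obtain ⟨C, α, hC, hα, hα1, hfm⟩ := hf.exists_modulus
  have hfc := hfm.continuous hα.le hα1
  obtain ⟨B, -, hB⟩ := hfm.exists_bound hC.le
  obtain ⟨hlim, c, hc, hbound⟩ := exists_averagedMean_estimates hM hψ hψn hν hf hf0 hcob
  have hkill : ∀ s t, s ≤ t → Tendsto (fun n => ∫ x, (t - level f s t (n + 1) x) ∂ν) atTop (𝓝 0) :=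
    fun s t hst => (tendsto_add_atTop_iff_nat 1).mpr
      (tendsto_integral_sub_level hM hψ hψn hν hf hf0 hcob hst)
  have hmono : ∀ n, Monotone (killedPosition ν f (n + 1)) := fun n =>
    monotone_killedPosition hfc hB (by omega)
  have herr : ∀ s t, s ≤ t → ∀ n, |(∫ r in Set.Ico s t, killedPosition ν f (n + 1) r) -
      averagedMean ν f s t (n + 1)| ≤ (|s| + |t|) * ∫ x, (t - level f s t (n + 1) x) ∂ν :=
    fun s t hst n => abs_integral_killedPosition_sub_le hfc hB hst (by omega)
  obtain ⟨V, hVmono, hVrc, hVlim⟩ :=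
      exists_ae_tendsto_of_tendsto_setIntegral hmono fun s t hst => by
    obtain ⟨Λ, hΛ⟩ := hlim s t hst
    refine ⟨Λ, ?_⟩
    have h1 : Tendsto (fun n => (∫ r in Set.Ico s t, killedPosition ν f (n + 1) r) -
        averagedMean ν f s t (n + 1)) atTop (𝓝 0) :=
      squeeze_zero_norm (herr s t hst) (by simpa using (hkill s t hst).const_mul (|s| + |t|))
    simpa using h1.add ((tendsto_add_atTop_iff_nat 1).mpr hΛ)
  have hupper : ∀ n t, killedPosition ν f (n + 1) t ≤
      max t 0 + c + (|t| + |t + 1|) * ∫ x, (t + 1 - level f t (t + 1) (n + 1) x) ∂ν := by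
    intro n t
    have h1 := (setIntegral_Ico_bounds_of_monotone (hmono n) (show t ≤ t + 1 by linarith)).1
    have h2 := (abs_le.mp (herr t (t + 1) (by linarith) n)).2
    have h3 := (hbound t (n + 1)).1
    linarith
  have hlower : ∀ n t, (t - 1) * (1 - ∫ x, (t - 1 + 1 - level f (t - 1) (t - 1 + 1) (n + 1) x) ∂ν)
      - c - (|t - 1| + |t - 1 + 1|) *
        ∫ x, (t - 1 + 1 - level f (t - 1) (t - 1 + 1) (n + 1) x) ∂ν ≤
      killedPosition ν f (n + 1) t := by
    intro n t
    set s := t - 1 with hs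
    have h1 := (setIntegral_Ico_bounds_of_monotone (hmono n) (show s ≤ s + 1 by linarith)).2
    have h2 := (abs_le.mp (herr s (s + 1) (by linarith) n)).1
    have h3 := (hbound s (n + 1)).2
    have h4 : ∫ x, (level f s (s + 1) (n + 1) x - s) ∂ν =
        1 - ∫ x, (s + 1 - level f s (s + 1) (n + 1) x) ∂ν := by
      have hi : Integrable (level f s (s + 1) (n + 1)) ν :=
        integrable_of_bdd (continuous_level hfc _) (B := |s| + |s + 1|) fun x => by
          have h5 := le_level (f := f) (s := s) (t := s + 1) (n + 1) x
          have h6 := level_le (f := f) (show s ≤ s + 1 by linarith) (n + 1) x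
          rw [abs_le]
          constructor
          · linarith [neg_abs_le s, abs_nonneg (s + 1)]
          · linarith [le_abs_self (s + 1), abs_nonneg s]
      rw [integral_sub hi (integrable_const _), integral_sub (integrable_const _) hi]
      simp only [integral_const, probReal_univ, smul_eq_mul]
      ring
    rw [h4] at h3
    have h5 : killedPosition ν f (n + 1) (s + 1) = killedPosition ν f (n + 1) t := by
      rw [hs, sub_add_cancel]
    linarith
  have hVnonneg : ∀ t, 0 ≤ V t := fun t =>
    le_of_ae_le_of_rightContinuous continuousWithinAt_const (hVrc t)
      (hVlim.mono fun r hr => ge_of_tendsto' hr fun n => killedPosition_nonneg (by omega) r)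
  have hVupper : ∀ t, V t ≤ max t 0 + c := fun t => by
    refine le_of_ae_le_of_rightContinuous (v := fun t => max t 0 + c) (hVrc t)
      (by fun_prop) (hVlim.mono fun r hr => ?_)
    refine le_of_tendsto_of_tendsto' hr ?_ fun n => hupper n r
    simpa using ((hkill r (r + 1) (by linarith)).const_mul (|r| + |r + 1|)).const_add (max r 0 + c)
  have hVlower : ∀ t, t - (c + 1) ≤ V t := fun t => by
    refine le_of_ae_le_of_rightContinuous (u := fun t => t - (c + 1)) (by fun_prop) (hVrc t)
      (hVlim.mono fun r hr => ?_)
    refine le_of_tendsto_of_tendsto' ?_ hr fun n => hlower n r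
    have h1 := hkill (r - 1) (r - 1 + 1) (by linarith)
    have h2 := (((h1.const_sub 1).const_mul (r - 1)).sub_const c).sub
      (h1.const_mul (|r - 1| + |r - 1 + 1|))
    convert h2 using 2
    ring
  refine ⟨V, ⟨hVnonneg, hVmono, hVrc, fun φ hφ hφs => ?_⟩, c + 1, by linarith, fun t =>
    ⟨max_le (hVlower t) (hVnonneg t), (hVupper t).trans (by linarith)⟩⟩
  have hPle : ∀ n t, survivalProb ν f (n + 1) t ≤
      ∫ x, (t + 1 - level f t (t + 1) (n + 1) x) ∂ν := by
    intro n t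
    have h1 := (setIntegral_Ico_bounds_of_monotone (monotone_survivalProb (ν := ν) hfc (n + 1))
      (show t ≤ t + 1 by linarith)).1
    rw [integral_survivalProb hfc (by linarith)] at h1
    linarith
  have hFle : ∀ n t, ∫ x, (t + 1 - level f t (t + 1) (n + 1) x) ∂ν ≤ 1 := by
    intro n t
    have h1 := integral_mono (μ := ν) (f := fun x => t + 1 - level f t (t + 1) (n + 1) x)
      (integrable_of_bdd (continuous_const.sub (continuous_level hfc _)) (B := 1) fun x => by
        rw [abs_of_nonneg (sub_nonneg.mpr (level_le (by linarith) _ x))]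
        linarith [le_level (f := f) (s := t) (t := t + 1) (n + 1) x])
      (integrable_const (1 : ℝ)) fun x => by
        linarith [le_level (f := f) (s := t) (t := t + 1) (n + 1) x]
    simpa using h1
  have hK : ∀ n r, killedMean ν f n r = killedPosition ν f n r - r * survivalProb ν f n r :=
    fun n r => by
      rw [killedPosition_eq hfc hB]
      ring
  set G : ℝ → ℝ := fun t => max t 0 + c + (|t| + |t + 1|) + |t| with hG
  have hG0 : ∀ t, 0 ≤ G t := fun t => by
    have := le_max_right t 0
    simp only [hG]
    positivity
  rw [← tendsto_add_atTop_iff_nat 1]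
  refine tendsto_integral_of_dominated_convergence (fun t => ‖φ t * G t‖) (fun n => ?_) ?_
    (fun n => Eventually.of_forall fun t => ?_) ?_
  · simp only [hK]
    exact (hφ.measurable.mul ((hmono n).measurable.sub
      (measurable_id.mul (monotone_survivalProb hfc (n + 1)).measurable))).aestronglyMeasurable
  · exact (Continuous.integrable_of_hasCompactSupport (hφ.mul (by fun_prop)) hφs.mul_right).norm
  · rw [norm_mul, norm_mul]
    refine mul_le_mul_of_nonneg_left ?_ (norm_nonneg _)
    rw [Real.norm_eq_abs, Real.norm_eq_abs, abs_of_nonneg (hG0 t), hK]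
    have h1 := hupper n t
    have h2 := mul_le_mul_of_nonneg_left (hFle n t) (by positivity : 0 ≤ |t| + |t + 1|)
    have h3 : 0 ≤ killedPosition ν f (n + 1) t := killedPosition_nonneg (by omega) t
    have h4 : |t * survivalProb ν f (n + 1) t| ≤ |t| := by
      rw [abs_mul, abs_of_nonneg (survivalProb_nonneg _ _)]
      exact mul_le_of_le_one_right (abs_nonneg _) (survivalProb_le_one hfc _ _)
    have h5 := abs_sub (killedPosition ν f (n + 1) t) (t * survivalProb ν f (n + 1) t)
    rw [abs_of_nonneg h3] at h5
    simp only [hG]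
    linarith
  · filter_upwards [hVlim] with t ht
    have h1 : Tendsto (fun n => survivalProb ν f (n + 1) t) atTop (𝓝 0) :=
      squeeze_zero (fun n => survivalProb_nonneg _ _) (fun n => hPle n t)
        (hkill t (t + 1) (by linarith))
    have h2 := (ht.sub (h1.const_mul t)).const_mul (φ t)
    simp only [hK]
    simpa using h2

end Limit

end SFT

end

theorem theorem3p1 {k : ℕ} (hk : 2 ≤ k) (M : Matrix (Fin k) (Fin k) ℕ)
    (hM : SFT.IsIrreducibleTransition M)
    (ψ : SFT.OneSided M → ℝ) (hψ : SFT.IsHolderPlus ψ) (hψ_norm : SFT.IsNormalized ψ)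
    (ν : Measure (SFT.TwoSided M)) (hν : SFT.IsGibbsMeasure ψ ν)
    (f : SFT.TwoSided M → ℝ) (hf : SFT.IsHolder f) (hf_mean : ∫ x, f x ∂ν = 0)
    (hf_cob : ¬ SFT.IsCoboundary f) :
    ∃ V : ℝ → ℝ, SFT.IsHarmonicFunction ν f V ∧
      (∀ W : ℝ → ℝ, SFT.IsHarmonicFunction ν f W → W = V) ∧
      ∃ c : ℝ, 0 < c ∧ ∀ t : ℝ, max (t - c) 0 ≤ V t ∧ V t ≤ max t 0 + c := by
  obtain ⟨V, hV, hbound⟩ := SFT.exists_isHarmonicFunction hM hψ hψ_norm hν hf hf_mean hf_cob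
  exact ⟨V, hV, fun W hW => hV.eq hW, hbound⟩
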